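/- For a non-increasing $\nu\in\mathbb Z^4$ let $\Sigma_\nu$ be the Schur functor on four-dimensional complex vector spaces (for $d\in\mathbb Z$, $\Sigma_{\nu+(d,d,d,d)}=\Sigma_\nu\otimes\det^{d}$), so that $\Sigma_\nu(\mathbb C^4)$ is an irreducible representation of $\mathrm{GL}_4(\mathbb C)$. Let $m\ge t\ge s\ge 0$ be integers with $m\ge t+s$ and put $\lambda=(m,t,s,0)$. (A) Among the irreducible factors of $\Sigma_{(m,t,s,0)}\otimes\Sigma_{(m,m-s,m-t,0)}$ we have 1. $\Sigma_{(m,m,m,m)}$ with multiplicity $1$; 2. $\Sigma_{(m+1,m+1,m-1,m-1)}$ with multiplicity $0$ if $t=s=0$, $2$ if $t>s>0$, and $1$ otherwise; 3. $\Sigma_{(m+2,m,m,m-2)}$ with multiplicity $0$ if $m\le 1$, and $\ge 1$ if $m>1$. (B) Let $\sigma\in\bigwedge^3V_{10}^\vee$, where $V_{10}=\mathbb C^{10}$, and let $X=\{W\in\mathrm{Gr}(6,V_{10}) : \sigma|_W=0\}$ be the zero locus of the section of $\bigwedge^3\mathcal U^\vee$ defined by $\sigma$ ($\mathcal U$ is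 the tautological subbundle). Suppose that this section is transverse to zero, i.e. that $X$ is a Debarre–Voisin hyperkähler fourfold. Let $\mathcal Q$ be the rank-four quotient bundle on $X$, with fibre $V_{10}/W$ at $W$, and $\mathcal O_X(1)=\det\mathcal Q$. Then there is an isomorphism of algebraic vector bundles on $X$ $$\mathcal End(\Sigma_\lambda\mathcal Q)=\Sigma_\lambda\mathcal Q\otimes(\Sigma_\lambda\mathcal Q)^\vee\;\cong\;\bigoplus_{\nu}(\Sigma_\nu\mathcal Q)^{\oplus N_\nu},$$ where $\nu$ runs through the non-increasing sequences in $\mathbb Z^4$ and $N_\nu$ is the multiplicity of $\Sigma_\nu(\mathbb C^4)$ in the $\mathrm{GL}_4(\mathbb C)$-representation $\Sigma_\lambda(\mathbb C^4)\otimes\Sigma_\lambda(\mathbb C^4)^\vee$. Among these factors we have 1. $\mathcal O_X\cong\Sigma_{(0,0,0,0)}\mathcal Q$ with multiplicity $1$; 2. $\Sigma_{(2,2,0,0)}\mathcal Q\otimes\mathcal O_X(-1)\cong\Sigma_{(1,1,-1,-1)}\mathcal Q$ with multiplicity $0$ if $t=s=0$, $2$ if $t>s>0$, and $1$ otherwise;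 3. $\Sigma_{(4,2,2,0)}\mathcal Q\otimes\mathcal O_X(-2)\cong\Sigma_{(2,0,0,-2)}\mathcal Q$ with multiplicity $0$ if $m\le 1$, and $\ge 1$ if $m>1$. -/

import Mathlib

open scoped TensorProduct

noncomputable section

/-! ### Natural constructions on complex vector spaces -/

/-- A functor from the groupoid of complex vector spaces (and linear isomorphisms) to itself.
Such a functor, evaluated on `ℂⁿ`, is a representation of `GLₙ(ℂ)`; applied fibrewise to a vector
bundle, it gives a new vector bundle. -/
structure VectFunctor where
  obj : (E : Type) → [AddCommGroup E] → [Module ℂ E] → Type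
  [addCommGroup : ∀ (E : Type) [AddCommGroup E] [Module ℂ E], AddCommGroup (obj E)]
  [module : ∀ (E : Type) [AddCommGroup E] [Module ℂ E], Module ℂ (obj E)]
  map : ∀ {E E' : Type} [AddCommGroup E] [Module ℂ E] [AddCommGroup E'] [Module ℂ E'],
    (E ≃ₗ[ℂ] E') → (obj E ≃ₗ[ℂ] obj E')
  map_refl : ∀ (E : Type) [AddCommGroup E] [Module ℂ E],
    map (LinearEquiv.refl ℂ E) = LinearEquiv.refl ℂ (obj E)
  map_trans : ∀ {E E' E'' : Type} [AddCommGroup E] [Module ℂ E] [AddCommGroup E'] [Module ℂ E']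
    [AddCommGroup E''] [Module ℂ E''] (e : E ≃ₗ[ℂ] E') (e' : E' ≃ₗ[ℂ] E''),
    map (e.trans e') = (map e).trans (map e')

namespace VectFunctor

attribute [instance] VectFunctor.addCommGroup VectFunctor.module

/-- The constant functor `ℂ`: the trivial representation, the structure sheaf. -/
def trivial : VectFunctor where
  obj _ _ _ := ℂ
  map _ := LinearEquiv.refl ℂ ℂ
  map_refl _ := rfl
  map_trans _ _ := rfl

/-- The tensor product `F(E) ⊗ G(E)`. -/
def tensor (F G : VectFunctor) : VectFunctor where
  obj E _ _ := F.obj E ⊗[ℂ] G.obj E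
  map e := TensorProduct.congr (F.map e) (G.map e)
  map_refl E _ _ := by simp [F.map_refl, G.map_refl]
  map_trans e e' := by simp [F.map_trans, G.map_trans, TensorProduct.congr_trans]

/-- The dual `F(E)^∨`, an isomorphism acting by its inverse transpose. -/
def dual (F : VectFunctor) : VectFunctor where
  obj E _ _ := Module.Dual ℂ (F.obj E)
  map e := (F.map e).symm.dualMap
  map_refl E _ _ := by rw [F.map_refl]; rfl
  map_trans e e' := by rw [F.map_trans]; rfl

/-- The endomorphisms `End F(E) = F(E) ⊗ F(E)^∨`. -/
def endo (F : VectFunctor) : VectFunctor := F.tensor F.dual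

/-- The tensor power `F(E)^{⊗ n}`. -/
def pow (F : VectFunctor) : ℕ → VectFunctor
  | 0 => trivial
  | n + 1 => (F.pow n).tensor F

/-- The direct sum `F(E)^{⊕ n}` of `n` copies. -/
def copies (F : VectFunctor) (n : ℕ) : VectFunctor where
  obj E _ _ := Fin n → F.obj E
  map e := LinearEquiv.piCongrRight fun _ => F.map e
  map_refl E _ _ := by simp only [F.map_refl]; rfl
  map_trans e e' := by simp only [F.map_trans]; rfl

/-- The direct sum `⨁ i, F i (E)` of a family. -/
def directSum {I : Type} (F : I → VectFunctor) : VectFunctor where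
  obj E _ _ := DirectSum I fun i => (F i).obj E
  map e := DFinsupp.mapRange.linearEquiv fun i => (F i).map e
  map_refl E _ _ := by
    simp only [VectFunctor.map_refl]
    exact DFinsupp.mapRange.linearEquiv_refl
  map_trans e e' := by
    simp only [VectFunctor.map_trans]
    exact DFinsupp.mapRange.linearEquiv_trans _ _

/-- The top exterior power `⋀⁴ E` of a four-dimensional space. -/
def det : VectFunctor where
  obj E _ _ := ⋀[ℂ]^4 E
  map e := LinearEquiv.ofLinearMap (exteriorPower.map 4 e.toLinearMap)
    (exteriorPower.map 4 e.symm.toLinearMap)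
    (by rw [← exteriorPower.map_comp]; simp)
    (by rw [← exteriorPower.map_comp]; simp)
  map_refl E _ _ := by
    ext1 x
    exact LinearMap.congr_fun exteriorPower.map_id x
  map_trans e e' := by
    ext1 x
    exact LinearMap.congr_fun (exteriorPower.map_comp e.toLinearMap e'.toLinearMap) x

end VectFunctor

/-! ### Schur functors -/

/-- The boxes of the diagram with rows of lengths `κ 0, …, κ 3`; a box is a row and a column. -/
abbrev Boxes (κ : Fin 4 → ℕ) : Type := (i : Fin 4) × Fin (κ i)

/-- `σ` acting on `E^{⊗ boxes}` by permuting the tensor factors. -/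
def permuteFactors (κ : Fin 4 → ℕ) (E : Type) [AddCommGroup E] [Module ℂ E]
    (σ : Equiv.Perm (Boxes κ)) :
    (⨂[ℂ] _ : Boxes κ, E) →ₗ[ℂ] (⨂[ℂ] _ : Boxes κ, E) :=
  (PiTensorProduct.reindex ℂ (fun _ : Boxes κ => E) σ).toLinearMap

open Classical in
/-- The sum over all permutations that preserve each row. -/
def rowSymmetrizer (κ : Fin 4 → ℕ) (E : Type) [AddCommGroup E] [Module ℂ E] :
    (⨂[ℂ] _ : Boxes κ, E) →ₗ[ℂ] (⨂[ℂ] _ : Boxes κ, E) :=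
  ∑ p : Equiv.Perm (Boxes κ) with ∀ x, (p x).1 = x.1, permuteFactors κ E p

open Classical in
/-- The signed sum over all permutations that preserve each column. -/
def columnAntisymmetrizer (κ : Fin 4 → ℕ) (E : Type) [AddCommGroup E] [Module ℂ E] :
    (⨂[ℂ] _ : Boxes κ, E) →ₗ[ℂ] (⨂[ℂ] _ : Boxes κ, E) :=
  ∑ q : Equiv.Perm (Boxes κ) with ∀ x, ((q x).2 : ℕ) = (x.2 : ℕ),
    ((Equiv.Perm.sign q : ℤ) : ℂ) • permuteFactors κ E q

/-- The Young symmetrizer of the diagram `κ`, acting on `E^{⊗ boxes}`. -/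
def youngSymmetrizer (κ : Fin 4 → ℕ) (E : Type) [AddCommGroup E] [Module ℂ E] :
    (⨂[ℂ] _ : Boxes κ, E) →ₗ[ℂ] (⨂[ℂ] _ : Boxes κ, E) :=
  rowSymmetrizer κ E ∘ₗ columnAntisymmetrizer κ E

theorem permuteFactors_congr (κ : Fin 4 → ℕ) {E E' : Type} [AddCommGroup E] [Module ℂ E]
    [AddCommGroup E'] [Module ℂ E'] (e : E ≃ₗ[ℂ] E') (σ : Equiv.Perm (Boxes κ))
    (x : ⨂[ℂ] _ : Boxes κ, E) :
    permuteFactors κ E' σ (PiTensorProduct.congr (fun _ => e) x) =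
      PiTensorProduct.congr (fun _ => e) (permuteFactors κ E σ x) :=
  (PiTensorProduct.map_reindex (fun _ : Boxes κ => e.toLinearMap) σ x).symm

theorem youngSymmetrizer_congr (κ : Fin 4 → ℕ) {E E' : Type} [AddCommGroup E] [Module ℂ E]
    [AddCommGroup E'] [Module ℂ E'] (e : E ≃ₗ[ℂ] E') (x : ⨂[ℂ] _ : Boxes κ, E) :
    youngSymmetrizer κ E' (PiTensorProduct.congr (fun _ => e) x) =
      PiTensorProduct.congr (fun _ => e) (youngSymmetrizer κ E x) := by
  simp only [youngSymmetrizer, rowSymmetrizer, columnAntisymmetrizer, LinearMap.comp_apply,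
    LinearMap.sum_apply, LinearMap.smul_apply, permuteFactors_congr, map_sum, map_smul]

theorem youngSymmetrizer_range_map (κ : Fin 4 → ℕ) {E E' : Type} [AddCommGroup E] [Module ℂ E]
    [AddCommGroup E'] [Module ℂ E'] (e : E ≃ₗ[ℂ] E') :
    (LinearMap.range (youngSymmetrizer κ E)).map
      (PiTensorProduct.congr (fun _ : Boxes κ => e)).toLinearMap =
      LinearMap.range (youngSymmetrizer κ E') := by
  ext y
  constructor
  · rintro ⟨_, ⟨x, rfl⟩, rfl⟩
    exact ⟨_, youngSymmetrizer_congr κ e x⟩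
  · rintro ⟨x, rfl⟩
    refine ⟨_, ⟨(PiTensorProduct.congr (fun _ => e)).symm x, rfl⟩, ?_⟩
    rw [LinearEquiv.coe_coe, ← youngSymmetrizer_congr, LinearEquiv.apply_symm_apply]

namespace VectFunctor

/-- The Schur functor `Σ_κ` of a partition `κ₀ ≥ κ₁ ≥ κ₂ ≥ κ₃ ≥ 0`: the image of the Young
symmetrizer. In particular `Σ_{(k,0,0,0)} = Sym^k` and `Σ_{(1,1,0,0)} = ⋀²`. -/
def schurPartition (κ : Fin 4 → ℕ) : VectFunctor where
  obj E _ _ := LinearMap.range (youngSymmetrizer κ E)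
  map e := LinearEquiv.ofSubmodules (PiTensorProduct.congr fun _ => e) _ _
    (youngSymmetrizer_range_map κ e)
  map_refl E _ _ := by
    ext1 x
    apply Subtype.ext
    exact LinearMap.congr_fun PiTensorProduct.map_id x.1
  map_trans e e' := by
    ext1 x
    apply Subtype.ext
    exact LinearMap.congr_fun (PiTensorProduct.map_comp
      (fun _ : Boxes κ => e'.toLinearMap) (fun _ => e.toLinearMap)) x.1

/-- The twist by `det^{-d}`, which on the quotient bundle of the Grassmannian is `𝒪(-d)`. -/
def detInv (d : ℕ) : VectFunctor := det.dual.pow d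

/-- The Schur functor `Σ_ν` of a non-increasing `ν ∈ ℤ⁴`. With `d = max(0, -ν₃)` it is
`Σ_{ν + d} ⊗ det^{-d}`; for a partition `ν` one has `d = 0`, and for instance
`Σ_{(1,1,-1,-1)} = Σ_{(2,2,0,0)} ⊗ det^{-1}`. -/
def schur (ν : Fin 4 → ℤ) : VectFunctor :=
  (schurPartition fun i => (ν i + ((-ν 3).toNat : ℤ)).toNat).tensor (detInv (-ν 3).toNat)

/-- The `GL₄(ℂ)`-equivariant linear maps `G(ℂ⁴) → F(ℂ⁴)`. -/
def equivariantMaps (G F : VectFunctor) :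
    Submodule ℂ (G.obj (Fin 4 → ℂ) →ₗ[ℂ] F.obj (Fin 4 → ℂ)) where
  carrier := {f | ∀ (g : (Fin 4 → ℂ) ≃ₗ[ℂ] (Fin 4 → ℂ)) (x : G.obj (Fin 4 → ℂ)),
    f (G.map g x) = F.map g (f x)}
  zero_mem' := by simp
  add_mem' := by
    intro a b ha hb g x
    simp [ha g x, hb g x]
  smul_mem' := by
    intro c a ha g x
    simp [ha g x]

/-- The multiplicity of the (irreducible) representation `G(ℂ⁴)` of `GL₄(ℂ)` in the
representation `F(ℂ⁴)`, that is `dim Hom_{GL₄}(G(ℂ⁴), F(ℂ⁴))`. -/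
def mult (G F : VectFunctor) : ℕ := Module.finrank ℂ (equivariantMaps G F)

end VectFunctor

/-! ### Debarre–Voisin fourfolds and bundles on them -/

/-- The space `V₁₀`. -/
abbrev V10 : Type := Fin 10 → ℂ

/-- The zero locus in `Gr(6, V₁₀)` of the section of `⋀³ 𝒰^∨` defined by a 3-form `σ`:
the six-dimensional subspaces on which `σ` vanishes. -/
def zeroLocus (σ : V10 [⋀^Fin 3]→ₗ[ℂ] ℂ) : Set (Submodule ℂ V10) :=
  {W | Module.finrank ℂ W = 6 ∧ ∀ w : Fin 3 → V10, (∀ i, w i ∈ W) → σ w = 0}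

/-- The section defined by `σ` is transverse to zero: at each point `W` of the zero locus its
derivative `T_W Gr = Hom(W, V₁₀/W) → ⋀³ W^∨` is surjective (a tangent vector is given here by a
lift `φ : W → V₁₀`; the derivative does not depend on the lift). Equivalently, the zero scheme is
smooth of dimension `24 - 20 = 4`, i.e. it is a Debarre–Voisin hyperkähler fourfold. -/
def IsDebarreVoisin (σ : V10 [⋀^Fin 3]→ₗ[ℂ] ℂ) : Prop :=
  ∀ W ∈ zeroLocus σ, ∀ η : W [⋀^Fin 3]→ₗ[ℂ] ℂ, ∃ φ : W →ₗ[ℂ] V10, ∀ w : Fin 3 → W,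
    η w = ∑ i, σ (Function.update (fun j => (w j : V10)) i (φ (w i)))

/-- The frame bundle of the quotient bundle `𝒬` on `X ⊆ Gr(6, V₁₀)`, whose fibre at `W` is
`V₁₀/W`: a point `W` of `X` with an isomorphism `V₁₀/W ≃ ℂ⁴`. It is a principal `GL₄`-bundle
over `X`. -/
structure QFrame (X : Set (Submodule ℂ V10)) where
  pt : X
  iso : (V10 ⧸ (pt : Submodule ℂ V10)) ≃ₗ[ℂ] (Fin 4 → ℂ)

/-- The frame bundle as a locally closed subvariety of the space of `4 × 10` matrices: a frame is
sent to the matrix of the surjection `V₁₀ → V₁₀/W ≃ ℂ⁴`, which determines it. -/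
def QFrame.coords {X : Set (Submodule ℂ V10)} (p : QFrame X) : Fin 4 × Fin 10 → ℂ :=
  fun ij => p.iso (Submodule.Quotient.mk (Pi.single ij.2 1)) ij.1

/-- Regular functions on the frame bundle: locally quotients of polynomials in the matrix
entries. -/
def IsRegularFun {X : Set (Submodule ℂ V10)} (f : QFrame X → ℂ) : Prop :=
  ∀ p : QFrame X, ∃ a b : MvPolynomial (Fin 4 × Fin 10) ℂ,
    MvPolynomial.eval p.coords b ≠ 0 ∧
    ∀ p' : QFrame X, MvPolynomial.eval p'.coords b ≠ 0 →
      f p' = MvPolynomial.eval p'.coords a / MvPolynomial.eval p'.coords b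

/-- A family of linear maps `F(V₁₀/W) → G(V₁₀/W)`, `W ∈ X`, is a morphism of algebraic vector
bundles `F(𝒬) → G(𝒬)` on `X` if its matrix coefficients, with respect to the trivializations of
`F(𝒬)` and `G(𝒬)` induced by frames of `𝒬`, are regular functions of the frame. -/
def IsBundleMap {X : Set (Submodule ℂ V10)} (F G : VectFunctor)
    (Φ : ∀ W : X, F.obj (V10 ⧸ (W : Submodule ℂ V10)) →ₗ[ℂ]
      G.obj (V10 ⧸ (W : Submodule ℂ V10))) : Prop :=
  ∀ (v : F.obj (Fin 4 → ℂ)) (ξ : Module.Dual ℂ (G.obj (Fin 4 → ℂ))),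
    IsRegularFun fun p : QFrame X => ξ (G.map p.iso (Φ p.pt ((F.map p.iso).symm v)))

/-- The vector bundles `F(𝒬)` and `G(𝒬)` on `X` are isomorphic. -/
def BundleIso (X : Set (Submodule ℂ V10)) (F G : VectFunctor) : Prop :=
  ∃ Φ : ∀ W : X, F.obj (V10 ⧸ (W : Submodule ℂ V10)) ≃ₗ[ℂ]
      G.obj (V10 ⧸ (W : Submodule ℂ V10)),
    IsBundleMap F G (fun W => (Φ W).toLinearMap) ∧
    IsBundleMap G F (fun W => (Φ W).symm.toLinearMap)

end

/-!
The proof decomposes representations of `GL₄(ℂ)` by highest weights, working with the group alone,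
and transports the result to bundles through frames.

*Highest weight theory.* All representations involved are tame (`IsTame`): they have a basis of
weight vectors in which `g*` acts by the conjugate transpose of the matrix of `g`, hence a hermitian
inner product for which the adjoint of `g` is `g*`. The products of a lower unitriangular, a
diagonal and an upper unitriangular matrix form a dense subset of the group, the big cell, and on it
the matrix coefficient `⟨w, g v⟩` of two highest weight vectors is a character of the diagonal torus
times `⟨w, v⟩`. So normalized coefficients depend only on the weight. Consequently a highest weight
vector can be mapped to any other one of the same weight (`IsTame.exists_commutes`), a
representation generated by a highest weight vector is irreducible and determined by its weight
(`IsTame.exists_equiv`), the multiplicity of an irreducible representation is the dimension of the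
space of highest weight vectors of its weight (`IsTame.finrank_homSpace`), and a tame representation
is the direct sum of irreducible ones (`IsTame.exists_decomposition`). That Schur functors are
irreducible of the expected highest weight (`VectFunctor.exists_isHighest_schur`) follows from two
properties of the image of the Young symmetrizer: its weights are dominated by the partition, and by
polarization (`eq_zero_of_rowSymmetric`) a highest weight vector has a nonzero coefficient at the
word of row numbers.

*Reduction to endomorphisms.* The representation `Σ_(m,m-s,m-t,0)` is `Σ_(m,t,s,0)^∨ ⊗ det ^ m`, so
that the multiplicities in the tensor product of the two are those in `End Σ_(m,t,s,0)`, translated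
by `(m,m,m,m)` (`mult_tensor_schur`). One has to count the highest weight vectors `φ` of weight `0`,
`(1,1,-1,-1)` and `(2,0,0,-2)` in `End Σ_κ`, for `κ = (m,t,s,0)`. For the weight `0` this is Schur's
lemma.

*Lower bounds.* Let `ζ` be the linear form `⟨v, ·⟩ / ⟨v, v⟩` for a highest weight vector `v` of
`Σ_κ`. If `P` is any tame representation, `p ∈ P` a highest weight vector and `ξ` a lowest weight
form, both of weight `κ`, then every highest weight endomorphism `φ` of `P` induces one of `Σ_κ`
with the same coefficient function `ξ (φ (g p))` (`IsLowestForm.exists_of_isEndCoeff`). These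
functions are multiplicative under tensor products (`IsEndCoeff.mul`), so that nonzero endomorphisms
can be built from small explicit representations: `ℂ⁴`, its dual, alternating matrices and the
adjoint representation.

*Upper bounds.* A highest weight endomorphism `φ` of weight `(1,1,-1,-1)` is the image of `(e₀ ∧
e₁)^{⊗ 2}` under an equivariant map, and the coefficient at `v` of its conjugate by `g` is, up to a
factor `det(g)⁻¹`, a quadratic form in the Plücker coordinates of the first two columns of `g`. This
form is invariant under the torus, which leaves two parameters, and each of the equalities `t = s`
and `s = 0` makes a simple reflection act by a sign that kills one of them
(`IsLowestForm.exists_params`). The parameters determine `φ` (`IsLowestForm.endomorphism_eq_zero`),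
and `(1,1,-1,-1)` occurs `[t > s] + [s > 0]` times. For `(2,0,0,-2)` and `m ≤ 1`, the first
coordinate of every weight of `Σ_κ` is `0` or `1`, so that no endomorphism raises it by `2`.

*Bundles.* An isomorphism of the representations `F(ℂ⁴)` and `G(ℂ⁴)` gives isomorphisms of the
fibres `F(V₁₀/W)` and `G(V₁₀/W)` that do not depend on the frame used to define them. In frames
their matrix coefficients are constant, hence regular (`VectFunctor.bundleIso_of_equiv`).
-/

open scoped TensorProduct

noncomputable section

open Filter Topology Matrix
open scoped InnerProductSpace ComplexConjugate

/-! ### The group `GL₄(ℂ)` and its big cell -/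


/-- The group `GL₄(ℂ)` of invertible complex `4 × 4` matrices. -/
abbrev G4 : Type := (Matrix (Fin 4) (Fin 4) ℂ)ˣ

/-- The diagonal torus. -/
def torus : (Fin 4 → ℂˣ) →* G4 :=
  (Units.map (Matrix.diagonalRingHom (Fin 4) ℂ).toMonoidHom).comp
    (MulEquiv.piUnits (M := fun _ : Fin 4 => ℂ)).symm.toMonoidHom

@[simp] theorem coe_torus (t : Fin 4 → ℂˣ) :
    (torus t : Matrix (Fin 4) (Fin 4) ℂ) = Matrix.diagonal fun k => (t k : ℂ) := rfl

/-- Upper triangular matrices with ones on the diagonal. -/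
def IsUnitri (g : G4) : Prop :=
  ∀ i j : Fin 4, j ≤ i → (g : Matrix (Fin 4) (Fin 4) ℂ) i j = (1 : Matrix (Fin 4) (Fin 4) ℂ) i j

theorem star_torus (t : Fin 4 → ℂˣ) : star (torus t) = torus (star t) := by
  apply Units.ext
  rw [Units.coe_star, coe_torus, coe_torus, Matrix.star_eq_conjTranspose,
    Matrix.diagonal_conjTranspose]
  rfl

/-- The character of the torus with exponents `μ`. -/
def wchar (μ : Fin 4 → ℤ) (t : Fin 4 → ℂˣ) : ℂ := ∏ k, (t k : ℂ) ^ μ k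

theorem wchar_ne_zero (μ : Fin 4 → ℤ) (t : Fin 4 → ℂˣ) : wchar μ t ≠ 0 :=
  Finset.prod_ne_zero_iff.2 fun k _ => zpow_ne_zero _ (t k).ne_zero

theorem wchar_add (μ ν : Fin 4 → ℤ) (t : Fin 4 → ℂˣ) :
    wchar (μ + ν) t = wchar μ t * wchar ν t := by
  simp [wchar, ← Finset.prod_mul_distrib, zpow_add₀]

theorem wchar_neg (μ : Fin 4 → ℤ) (t : Fin 4 → ℂˣ) : wchar (-μ) t = (wchar μ t)⁻¹ := by
  simp [wchar]

theorem wchar_inv (μ : Fin 4 → ℤ) (t : Fin 4 → ℂˣ) : wchar μ t⁻¹ = (wchar μ t)⁻¹ := by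
  simp [wchar]

@[simp] theorem wchar_zero (t : Fin 4 → ℂˣ) : wchar 0 t = 1 := by simp [wchar]

theorem star_wchar (μ : Fin 4 → ℤ) (t : Fin 4 → ℂˣ) : star (wchar μ t) = wchar μ (star t) := by
  simp [wchar]

/-- Convergence in the topology of the group of units is convergence of matrices, since inversion is
continuous. -/
theorem tendsto_units {α : Type*} {l : Filter α} {f : α → G4} {g : G4}
    (h : Tendsto (fun a => (f a : Matrix (Fin 4) (Fin 4) ℂ)) l (𝓝 (g : Matrix _ _ ℂ))) :
    Tendsto f l (𝓝 g) := by
  rw [Units.isInducing_embedProduct.tendsto_nhds_iff]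
  refine Tendsto.prodMk_nhds h ?_
  refine (MulOpposite.continuous_op.tendsto _).comp ?_
  have key : ∀ x : G4, ((x⁻¹ : G4) : Matrix (Fin 4) (Fin 4) ℂ) =
      (x : Matrix (Fin 4) (Fin 4) ℂ).det⁻¹ • (x : Matrix (Fin 4) (Fin 4) ℂ).adjugate := by
    intro x
    rw [Matrix.coe_units_inv, Matrix.inv_def, Ring.inverse_eq_inv']
  simp only [key]
  have hd : (g : Matrix (Fin 4) (Fin 4) ℂ).det ≠ 0 :=
    ((Matrix.isUnit_iff_isUnit_det _).1 g.isUnit).ne_zero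
  exact ((((continuous_id.matrix_det).tendsto _).comp h).inv₀ hd).smul
    (((continuous_id.matrix_adjugate).tendsto _).comp h)

theorem IsUnitri.inv {u : G4} (h : IsUnitri u) : IsUnitri u⁻¹ := by
  have hb : (u : Matrix (Fin 4) (Fin 4) ℂ).BlockTriangular id := fun i j hij => by
    rw [h i j (le_of_lt hij)]
    exact Matrix.one_apply_ne (ne_of_gt hij)
  let _ : Invertible (u : Matrix (Fin 4) (Fin 4) ℂ) := u.invertible
  have hb' := Matrix.blockTriangular_inv_of_blockTriangular hb
  rw [← Matrix.coe_units_inv] at hb'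
  intro i j hij
  rcases hij.lt_or_eq with hlt | rfl
  · rw [hb' hlt, Matrix.one_apply_ne (ne_of_gt hlt)]
  · have h1 := congr_fun (congr_fun (u.mul_inv) j) j
    rw [Matrix.mul_apply, Finset.sum_eq_single j] at h1
    · rwa [h j j le_rfl, Matrix.one_apply_eq, one_mul, ← Matrix.one_apply_eq j] at h1
    · intro k _ hk
      rcases lt_or_gt_of_ne hk with hk | hk
      · rw [h j k hk.le, Matrix.one_apply_ne hk.ne', zero_mul]
      · rw [hb' hk, mul_zero]
    · simp

/-- Gauss elimination: a matrix whose leading principal minors do not vanish is a product of a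
lower unitriangular, a diagonal and an upper unitriangular matrix. -/
theorem exists_lower_diagonal_upper : ∀ (n : ℕ) (A : Matrix (Fin n) (Fin n) ℂ),
    (∀ (k : ℕ) (hk : k ≤ n), (A.submatrix (Fin.castLE hk) (Fin.castLE hk)).det ≠ 0) →
    ∃ (L U : Matrix (Fin n) (Fin n) ℂ) (d : Fin n → ℂ),
      (∀ i j, i ≤ j → L i j = (1 : Matrix (Fin n) (Fin n) ℂ) i j) ∧
      (∀ i j, j ≤ i → U i j = (1 : Matrix (Fin n) (Fin n) ℂ) i j) ∧
      A = L * Matrix.diagonal d * U := by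
  intro n
  induction n with
  | zero => intro A _; exact ⟨1, 1, fun _ => 1, fun i => i.elim0, fun i => i.elim0,
      by ext i; exact i.elim0⟩
  | succ n ih =>
    intro A hA
    set A' := A.submatrix (Fin.castSucc) (Fin.castSucc) with hA'
    obtain ⟨L, U, d, hL, hU, hLU⟩ := ih A' (fun k hk => hA k (hk.trans n.le_succ))
    have hdet : A'.det ≠ 0 := hA n n.le_succ
    rw [hLU, Matrix.det_mul, Matrix.det_mul] at hdet
    have hLd : IsUnit (L * Matrix.diagonal d).det := by
      rw [Matrix.det_mul]; exact (left_ne_zero_of_mul hdet).isUnit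
    have hdU : IsUnit (Matrix.diagonal d * U).det := by
      rw [Matrix.det_mul]
      exact (mul_ne_zero (right_ne_zero_of_mul (left_ne_zero_of_mul hdet))
        (right_ne_zero_of_mul hdet)).isUnit
    -- the new row of `L` and the new column of `U`
    set y : Fin n → ℂ := (L * Matrix.diagonal d)⁻¹.mulVec fun i => A i.castSucc (Fin.last n)
      with hy
    set x : Fin n → ℂ := Matrix.vecMul (fun i => A (Fin.last n) i.castSucc)
      (Matrix.diagonal d * U)⁻¹ with hx
    have hy' : (L * Matrix.diagonal d).mulVec y = fun i => A i.castSucc (Fin.last n) := by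
      rw [hy, Matrix.mulVec_mulVec, Matrix.mul_nonsing_inv _ hLd, Matrix.one_mulVec]
    have hx' : Matrix.vecMul x (Matrix.diagonal d * U) = fun i => A (Fin.last n) i.castSucc := by
      rw [hx, Matrix.vecMul_vecMul, Matrix.nonsing_inv_mul _ hdU, Matrix.vecMul_one]
    let e : ℂ := A (Fin.last n) (Fin.last n) - ∑ k, x k * d k * y k
    refine ⟨Matrix.of (Fin.lastCases (Fin.lastCases 1 x) fun i => Fin.lastCases 0 (L i)),
      Matrix.of (Fin.lastCases (Fin.lastCases 1 fun _ => 0) fun i => Fin.lastCases (y i) (U i)),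
      Fin.lastCases e d, ?_, ?_, ?_⟩
    · intro i j
      refine Fin.lastCases ?_ (fun i => ?_) i <;> refine Fin.lastCases ?_ (fun j => ?_) j
      · simp
      · intro h; exact absurd h (by simp)
      · intro _; simp [Fin.castSucc_ne_last]
      · intro h
        simp only [Matrix.of_apply, Fin.lastCases_castSucc]
        rw [hL i j (by simpa using h)]; simp [Matrix.one_apply]
    · intro i j
      refine Fin.lastCases ?_ (fun i => ?_) i <;> refine Fin.lastCases ?_ (fun j => ?_) j
      · simp
      · intro _; simp [(Fin.castSucc_ne_last _).symm]
      · intro h; exact absurd h (by simp)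
      · intro h
        simp only [Matrix.of_apply, Fin.lastCases_castSucc]
        rw [hU i j (by simpa using h)]; simp [Matrix.one_apply]
    · ext i j
      rw [Matrix.mul_apply]
      simp only [Matrix.mul_diagonal, Fin.sum_univ_castSucc, Matrix.of_apply,
        Fin.lastCases_castSucc, Fin.lastCases_last]
      refine Fin.lastCases ?_ (fun i => ?_) i <;> refine Fin.lastCases ?_ (fun j => ?_) j
      · simp [e]
      · have := congr_fun hx' j
        simp only [Matrix.vecMul, dotProduct, Matrix.diagonal_mul] at this
        simp only [Fin.lastCases_castSucc, Fin.lastCases_last, mul_zero, add_zero, ← this]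
        exact Finset.sum_congr rfl fun k _ => by ring
      · have := congr_fun hy' i
        simp only [Matrix.mulVec, dotProduct, Matrix.mul_diagonal] at this
        simp [← this]
      · have := congr_fun (congr_fun hLU i) j
        rw [Matrix.mul_apply] at this
        simp only [Matrix.mul_diagonal, hA', Matrix.submatrix_apply] at this
        simp [this]

/-- The big cell: products of a lower unitriangular, a diagonal and an upper unitriangular
matrix. -/
def bigCell : Set G4 :=
  {g | ∃ (u u' : G4) (t : Fin 4 → ℂˣ), IsUnitri u ∧ IsUnitri u' ∧ g = star u * torus t * u'}

theorem mem_bigCell {g : G4}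
    (h : ∀ (k : ℕ) (hk : k ≤ 4), ((g : Matrix (Fin 4) (Fin 4) ℂ).submatrix
      (Fin.castLE hk) (Fin.castLE hk)).det ≠ 0) : g ∈ bigCell := by
  obtain ⟨L, U, d, hL, hU, hg⟩ := exists_lower_diagonal_upper 4 g h
  have hd : (g : Matrix (Fin 4) (Fin 4) ℂ).det ≠ 0 :=
    ((Matrix.isUnit_iff_isUnit_det _).1 g.isUnit).ne_zero
  have hd' := hd
  rw [hg, Matrix.det_mul, Matrix.det_mul] at hd
  have hLd : Lᴴ.det ≠ 0 := by
    rw [Matrix.det_conjTranspose]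
    exact star_ne_zero.2 (left_ne_zero_of_mul (left_ne_zero_of_mul hd))
  have hUd : U.det ≠ 0 := right_ne_zero_of_mul hd
  have hdd : ∀ k, d k ≠ 0 := by
    have := right_ne_zero_of_mul (left_ne_zero_of_mul hd)
    rw [Matrix.det_diagonal] at this
    exact fun k => Finset.prod_ne_zero_iff.1 this k (Finset.mem_univ k)
  refine ⟨Matrix.GeneralLinearGroup.mkOfDetNeZero _ hLd,
    Matrix.GeneralLinearGroup.mkOfDetNeZero _ hUd, fun k => Units.mk0 (d k) (hdd k), ?_, hU, ?_⟩
  · intro i j hij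
    change Lᴴ i j = _
    rw [Matrix.conjTranspose_apply, hL j i hij]
    simp [Matrix.one_apply, eq_comm]
  · apply Units.ext
    change (g : Matrix (Fin 4) (Fin 4) ℂ) = star Lᴴ * Matrix.diagonal d * U
    rw [hg, Matrix.star_eq_conjTranspose, Matrix.conjTranspose_conjTranspose]

/-- The elements `g + z` lie in the big cell for all but finitely many small `z ≠ 0`. -/
theorem dense_bigCell : Dense bigCell := by
  intro g
  let p : ℂ → Matrix (Fin 4) (Fin 4) ℂ := fun z => (g : Matrix (Fin 4) (Fin 4) ℂ) + z • 1
  have hp : ∀ (k : ℕ) (hk : k ≤ 4), ∀ᶠ z in 𝓝[≠] (0 : ℂ),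
      ((p z).submatrix (Fin.castLE hk) (Fin.castLE hk)).det ≠ 0 := by
    intro k hk
    -- the leading minor of `g + z` is a monic polynomial in `z`
    set B := (g : Matrix (Fin 4) (Fin 4) ℂ).submatrix (Fin.castLE hk) (Fin.castLE hk)
    have h0 : (-B).charpoly ≠ 0 := (Matrix.charpoly_monic _).ne_zero
    have hfin : ({z | (-B).charpoly.IsRoot z} \ {0}).Finite :=
      (Polynomial.finite_setOfPred_isRoot h0).subset Set.sdiff_subset
    have hnhds : ({z | (-B).charpoly.IsRoot z} \ {0})ᶜ ∈ 𝓝 (0 : ℂ) :=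
      hfin.isClosed.isOpen_compl.mem_nhds (by simp)
    filter_upwards [self_mem_nhdsWithin, mem_nhdsWithin_of_mem_nhds hnhds] with z hz hz'
    have h1 : ¬ (-B).charpoly.IsRoot z := fun h => hz' ⟨h, hz⟩
    rw [Polynomial.IsRoot.def, Matrix.eval_charpoly] at h1
    convert h1 using 2
    ext i j
    simp [p, B, Matrix.one_apply, Matrix.diagonal_apply, add_comm]
  have hpall : ∀ᶠ z in 𝓝[≠] (0 : ℂ), ∀ (k : ℕ) (hk : k ≤ 4),
      ((p z).submatrix (Fin.castLE hk) (Fin.castLE hk)).det ≠ 0 := by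
    have := (Filter.eventually_all (ι := Fin 5)).2 fun k => hp k (by omega)
    filter_upwards [this] with z hz k hk using hz ⟨k, by omega⟩
  have hdet : ∀ᶠ z in 𝓝[≠] (0 : ℂ), (p z).det ≠ 0 := by
    filter_upwards [hpall] with z hz using by simpa using hz 4 le_rfl
  let γ : ℂ → G4 := fun z => if h : (p z).det ≠ 0 then
    Matrix.GeneralLinearGroup.mkOfDetNeZero _ h else g
  have hγ : ∀ z, (p z).det ≠ 0 → (γ z : Matrix (Fin 4) (Fin 4) ℂ) = p z := by
    intro z hz; simp only [γ, dif_pos hz]; rfl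
  have hlim : Tendsto γ (𝓝[≠] 0) (𝓝 g) := by
    apply tendsto_units
    have h1 : Tendsto p (𝓝[≠] 0) (𝓝 (p 0)) := by
      refine Tendsto.mono_left (Continuous.tendsto ?_ 0) nhdsWithin_le_nhds
      fun_prop
    have h2 : p 0 = g := by simp [p]
    rw [h2] at h1
    refine h1.congr' ?_
    filter_upwards [hdet] with z hz using (hγ z hz).symm
  refine mem_closure_of_tendsto hlim ?_
  filter_upwards [hdet, hpall] with z hz hz'
  exact mem_bigCell (by rw [hγ z hz]; exact hz')

/-- Continuous functions on the group that agree on the big cell are equal. -/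
theorem eq_of_eqOn_bigCell {f f' : G4 → ℂ} (hf : Continuous f) (hf' : Continuous f')
    (h : ∀ u u' t, IsUnitri u → IsUnitri u' →
      f (star u * torus t * u') = f' (star u * torus t * u')) : f = f' :=
  Continuous.ext_on dense_bigCell hf hf' (by rintro _ ⟨u, u', t, hu, hu', rfl⟩; exact h u u' t hu hu')

/-! ### Tame representations and highest weight vectors -/

section Tame

variable {M N : Type} [AddCommGroup M] [Module ℂ M] [AddCommGroup N] [Module ℂ N]

/-- A representation of `GL₄(ℂ)` is tame if it has a basis of weight vectors in which the matrix of
`g*` is the conjugate transpose of the matrix of `g` (so that the basis is orthonormal for a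
hermitian inner product that is invariant under the unitary group) and the matrix coefficients are
continuous. -/
structure IsTame (ρ : Representation ℂ G4 M) : Prop where
  exists_basis : ∃ (ι : Type) (_ : Fintype ι) (b : Module.Basis ι ℂ M) (wt : ι → Fin 4 → ℤ),
    (∀ g i j, b.repr (ρ (star g) (b j)) i = star (b.repr (ρ g (b i)) j)) ∧
    (∀ t i, ρ (torus t) (b i) = wchar (wt i) t • b i) ∧
    (∀ i j, Continuous fun g => b.repr (ρ g (b j)) i)

/-- The space of highest weight vectors of weight `μ`. -/
def hwSpace (ρ : Representation ℂ G4 M) (μ : Fin 4 → ℤ) : Submodule ℂ M where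
  carrier := {v | (∀ u, IsUnitri u → ρ u v = v) ∧ ∀ t, ρ (torus t) v = wchar μ t • v}
  zero_mem' := by simp
  add_mem' := by
    rintro a b ⟨ha, ha'⟩ ⟨hb, hb'⟩
    exact ⟨fun u hu => by rw [map_add, ha u hu, hb u hu],
      fun t => by rw [map_add, ha', hb', smul_add]⟩
  smul_mem' := by
    rintro c a ⟨ha, ha'⟩
    exact ⟨fun u hu => by rw [map_smul, ha u hu],
      fun t => by rw [map_smul, ha', smul_comm]⟩

/-- The linear forms that are invariant under lower unitriangular matrices and on which the torus
acts by the character `μ`; coefficient functions of vectors of highest weight `μ`. -/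
def lwForms (ρ : Representation ℂ G4 M) (μ : Fin 4 → ℤ) : Submodule ℂ (Module.Dual ℂ M) where
  carrier := {ξ | (∀ u, IsUnitri u → ∀ x, ξ (ρ (star u) x) = ξ x) ∧
    ∀ t x, ξ (ρ (torus t) x) = wchar μ t * ξ x}
  zero_mem' := by simp
  add_mem' := by
    rintro a b ⟨ha, ha'⟩ ⟨hb, hb'⟩
    exact ⟨fun u hu x => by simp [ha u hu, hb u hu], fun t x => by simp [ha', hb', mul_add]⟩
  smul_mem' := by
    rintro c a ⟨ha, ha'⟩
    exact ⟨fun u hu x => by simp [ha u hu], fun t x => by simp [ha']; ring⟩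

/-- `v` is a highest weight vector of weight `μ` that generates the representation. -/
structure IsHighest (ρ : Representation ℂ G4 M) (μ : Fin 4 → ℤ) (v : M) : Prop where
  mem : v ∈ hwSpace ρ μ
  ne_zero : v ≠ 0
  span_eq : Submodule.span ℂ (Set.range fun g => ρ g v) = ⊤

/-- A linear map commutes with the action of `GL₄(ℂ)`. -/
def Commutes (ρ : Representation ℂ G4 M) (ρ' : Representation ℂ G4 N) (f : M →ₗ[ℂ] N) : Prop :=
  ∀ g x, f (ρ g x) = ρ' g (f x)

theorem Commutes.map_hwSpace {ρ : Representation ℂ G4 M} {ρ' : Representation ℂ G4 N}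
    {f : M →ₗ[ℂ] N} (h : Commutes ρ ρ' f) {μ : Fin 4 → ℤ} {v : M} (hv : v ∈ hwSpace ρ μ) :
    f v ∈ hwSpace ρ' μ :=
  ⟨fun u hu => by rw [← h, hv.1 u hu], fun t => by rw [← h, hv.2 t, map_smul]⟩

theorem wchar_injective {μ ν : Fin 4 → ℤ} (h : ∀ t, wchar μ t = wchar ν t) : μ = ν := by
  funext k
  have h2 := h (Function.update 1 k (Units.mk0 2 two_ne_zero))
  simp only [wchar] at h2
  rw [Finset.prod_eq_single k (by intro b _ hb; simp [hb]) (by simp),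
    Finset.prod_eq_single k (by intro b _ hb; simp [hb]) (by simp)] at h2
  simp only [Function.update_self, Units.val_mk0] at h2
  have h3 : ((2 : ℝ) ^ μ k) = (2 : ℝ) ^ ν k := Complex.ofReal_injective (by push_cast; exact h2)
  exact zpow_right_injective₀ (by norm_num) (by norm_num) h3

/-- The inner product for which a basis is orthonormal. -/
@[reducible] def basisCore {ι : Type} [Fintype ι] (b : Module.Basis ι ℂ M) :
    InnerProductSpace.Core ℂ M where
  inner x y := ∑ i, conj (b.repr x i) * b.repr y i
  conj_inner_symm x y := by simp [mul_comm]
  re_inner_nonneg x := by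
    simp only [map_sum]
    refine Finset.sum_nonneg fun i _ => ?_
    rw [← Complex.normSq_eq_conj_mul_self]
    exact Complex.normSq_nonneg _
  add_left x y z := by simp [add_mul, Finset.sum_add_distrib]
  smul_left x y r := by simp [Finset.mul_sum, mul_assoc]
  definite x h := by
    have : ∀ i, b.repr x i = 0 := by
      intro i
      simp_rw [← Complex.normSq_eq_conj_mul_self] at h
      norm_cast at h
      rw [Finset.sum_eq_zero_iff_of_nonneg fun i _ => Complex.normSq_nonneg _] at h
      simpa using h i (Finset.mem_univ i)
    exact b.ext_elem fun i => by simp [this]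

theorem dual_apply_eq_sum {ι : Type} [Fintype ι] (b : Module.Basis ι ℂ M) (L : Module.Dual ℂ M)
    (x : M) : L x = ∑ j, b.repr x j * L (b j) :=
  calc L x = L (∑ j, b.repr x j • b j) := by rw [b.sum_repr]
    _ = _ := by simp only [map_sum, map_smul, smul_eq_mul]

theorem IsTame.finite {ρ : Representation ℂ G4 M} (h : IsTame ρ) : Module.Finite ℂ M := by
  obtain ⟨ι, _, b, _⟩ := h.exists_basis
  exact Module.Finite.of_basis b

theorem IsTame.continuous_coeff {ρ : Representation ℂ G4 M} (h : IsTame ρ)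
    (ξ : Module.Dual ℂ M) (v : M) : Continuous fun g => ξ (ρ g v) := by
  obtain ⟨ι, _, b, wt, -, -, hc⟩ := h.exists_basis
  have key : ∀ g, ξ (ρ g v) = ∑ j, ∑ i, b.repr v j * (b.repr (ρ g (b j)) i * ξ (b i)) := by
    intro g
    refine (dual_apply_eq_sum b (ξ ∘ₗ ρ g) v).trans ?_
    simp only [← Finset.mul_sum]
    exact Finset.sum_congr rfl fun j _ => congrArg _ (dual_apply_eq_sum b ξ _)
  simp only [key]
  exact continuous_finsetSum _ fun j _ => continuous_finsetSum _ fun i _ =>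
    continuous_const.mul ((hc i j).mul continuous_const)

theorem basisCore_inner_left {ρ : Representation ℂ G4 M} {ι : Type} [Fintype ι]
    (b : Module.Basis ι ℂ M)
    (hs : ∀ g i j, b.repr (ρ (star g) (b j)) i = star (b.repr (ρ g (b i)) j)) (g : G4) (x y : M) :
    ∑ i, conj (b.repr (ρ g x) i) * b.repr y i =
      ∑ i, conj (b.repr x i) * b.repr (ρ (star g) y) i := by
  have key : ∀ (g : G4) (x : M) i, b.repr (ρ g x) i = ∑ j, b.repr x j * b.repr (ρ g (b j)) i := by
    intro g x i
    exact dual_apply_eq_sum b (b.coord i ∘ₗ ρ g) x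
  simp only [key g x, key (star g) y, map_sum, map_mul, Finset.sum_mul, Finset.mul_sum]
  rw [Finset.sum_comm]
  refine Finset.sum_congr rfl fun i _ => Finset.sum_congr rfl fun j _ => ?_
  rw [hs g i j]
  simp only [RCLike.star_def]
  ring

/-- The hermitian inner product for which the basis of a tame representation is orthonormal. -/
theorem IsTame.exists_core {ρ : Representation ℂ G4 M} (h : IsTame ρ) :
    ∃ c : InnerProductSpace.Core ℂ M, ∀ g x y, c.inner (ρ g x) y = c.inner x (ρ (star g) y) := by
  obtain ⟨ι, _, b, wt, hs, -, -⟩ := h.exists_basis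
  exact ⟨basisCore b, basisCore_inner_left b hs⟩

/-- The regular dominant element `diag(7,5,3,2)` of the torus. Its entries are distinct primes, so
that it separates all weights. -/
def primeTorus : Fin 4 → ℂˣ :=
  ![Units.mk0 7 (by norm_num), Units.mk0 5 (by norm_num), Units.mk0 3 (by norm_num),
    Units.mk0 2 (by norm_num)]

/-- The value of the weight `μ` at `diag(7,5,3,2)`. -/
def primeValue (μ : Fin 4 → ℤ) : ℚ := 7 ^ μ 0 * 5 ^ μ 1 * 3 ^ μ 2 * 2 ^ μ 3

theorem wchar_primeTorus (μ : Fin 4 → ℤ) : wchar μ primeTorus = (primeValue μ : ℂ) := by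
  simp [wchar, primeTorus, primeValue, Fin.prod_univ_four]

theorem primeValue_pos (μ : Fin 4 → ℤ) : 0 < primeValue μ := by
  unfold primeValue; positivity

theorem padicValRat_primeValue (p : ℕ) [Fact p.Prime] (μ : Fin 4 → ℤ) :
    padicValRat p (primeValue μ) = μ 0 * padicValNat p 7 + μ 1 * padicValNat p 5 +
      μ 2 * padicValNat p 3 + μ 3 * padicValNat p 2 := by
  have h : ∀ (n : ℕ) (k : ℤ), padicValRat p ((n : ℚ) ^ k) = k * padicValNat p n := by
    intro n k
    rw [padicValRat.zpow, padicValRat.of_nat]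
  have := h 7 (μ 0)
  have := h 5 (μ 1)
  have := h 3 (μ 2)
  have := h 2 (μ 3)
  push_cast at *
  unfold primeValue
  rw [padicValRat.mul (by positivity) (by positivity), padicValRat.mul (by positivity)
    (by positivity), padicValRat.mul (by positivity) (by positivity)]
  simp [*]

theorem primeValue_injective : Function.Injective primeValue := by
  intro μ ν h
  have key : ∀ p : ℕ, p.Prime → μ 0 * padicValNat p 7 + μ 1 * padicValNat p 5 +
      μ 2 * padicValNat p 3 + μ 3 * padicValNat p 2 = ν 0 * padicValNat p 7 +
      ν 1 * padicValNat p 5 + ν 2 * padicValNat p 3 + ν 3 * padicValNat p 2 := by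
    intro p hp
    have := Fact.mk hp
    rw [← padicValRat_primeValue, ← padicValRat_primeValue, h]
  have hz : ∀ p q : ℕ, p.Prime → q.Prime → p ≠ q → padicValNat p q = 0 := fun p q hp hq hpq => by
    have := Fact.mk hp; have := Fact.mk hq; exact padicValNat_primes hpq
  have ho : ∀ p : ℕ, p.Prime → padicValNat p p = 1 := fun p hp => by
    have := Fact.mk hp; exact padicValNat_self
  have p2 : Nat.Prime 2 := by norm_num
  have p3 : Nat.Prime 3 := by norm_num
  have p5 : Nat.Prime 5 := by norm_num
  have p7 : Nat.Prime 7 := by norm_num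
  funext k
  fin_cases k
  · simpa [ho, hz, p2, p3, p5, p7] using key 7 p7
  · simpa [ho, hz, p2, p3, p5, p7] using key 5 p5
  · simpa [ho, hz, p2, p3, p5, p7] using key 3 p3
  · simpa [ho, hz, p2, p3, p5, p7] using key 2 p2

/-- Conjugation by the powers of `diag(7,5,3,2)` contracts unitriangular matrices to `1`. -/
theorem tendsto_conj_primeTorus {u : G4} (hu : IsUnitri u) :
    Tendsto (fun k : ℕ => torus (primeTorus⁻¹ ^ k) * u * torus (primeTorus ^ k)) atTop (𝓝 1) := by
  apply tendsto_units
  refine tendsto_pi_nhds.2 fun i => tendsto_pi_nhds.2 fun j => ?_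
  have key : ∀ k : ℕ, ((torus (primeTorus⁻¹ ^ k) * u * torus (primeTorus ^ k) : G4) :
      Matrix (Fin 4) (Fin 4) ℂ) i j = ((primeTorus i : ℂ)⁻¹ * primeTorus j) ^ k *
        (u : Matrix (Fin 4) (Fin 4) ℂ) i j := by
    intro k
    rw [Units.val_mul, Units.val_mul, coe_torus, coe_torus, Matrix.mul_diagonal,
      Matrix.diagonal_mul]
    simp [mul_pow]
    ring
  simp only [key]
  rcases le_or_gt j i with hij | hij
  · rw [hu i j hij]
    rcases eq_or_ne i j with rfl | hne
    · simp
    · simp [Matrix.one_apply_ne hne]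
  · rw [Units.val_one, Matrix.one_apply_ne hij.ne]
    have : Tendsto (fun k : ℕ => ((primeTorus i : ℂ)⁻¹ * primeTorus j) ^ k) atTop (𝓝 0) := by
      apply tendsto_pow_atTop_nhds_zero_of_norm_lt_one
      fin_cases i <;> fin_cases j <;> simp at hij <;> simp [primeTorus] <;> norm_num
    simpa using this.mul_const _

/-- Every nonzero subrepresentation of a tame representation contains a highest weight vector: an
eigenvector of `diag(7,5,3,2)` for the largest possible eigenvalue. -/
theorem IsTame.exists_hw {ρ : Representation ℂ G4 M} (h : IsTame ρ) (W : Submodule ℂ M)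
    (hW : ∀ g, ∀ x ∈ W, ρ g x ∈ W) (hne : W ≠ ⊥) : ∃ μ, ∃ v ∈ W, v ≠ 0 ∧ v ∈ hwSpace ρ μ := by
  classical
  have hcoeff := fun ξ v => h.continuous_coeff ξ v
  obtain ⟨ι, _, b, wt, -, ht, -⟩ := h.exists_basis
  obtain ⟨w₀, hw₀, hw₀'⟩ := W.ne_bot_iff.1 hne
  let S : Finset ι := Finset.univ.filter fun i => ∃ w ∈ W, b.repr w i ≠ 0
  have hS : S.Nonempty := by
    by_contra hS
    apply hw₀'
    refine b.ext_elem fun i => ?_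
    by_contra hi
    exact hS ⟨i, by simpa [S] using ⟨w₀, hw₀, by simpa using hi⟩⟩
  obtain ⟨i₀, hi₀, hmax⟩ := S.exists_max_image (fun i => primeValue (wt i)) hS
  obtain ⟨w, hw, hwi⟩ : ∃ w ∈ W, b.repr w i₀ ≠ 0 := by simpa [S] using hi₀
  have htorus : ∀ t x i, b.repr (ρ (torus t) x) i = wchar (wt i) t * b.repr x i := by
    intro t x i
    refine (dual_apply_eq_sum b (b.coord i ∘ₗ ρ (torus t)) x).trans ?_
    simp [ht, Finsupp.single_apply, mul_comm]
  -- the projection to the largest eigenvalue is a polynomial in `diag(7,5,3,2)`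
  let P : Polynomial ℂ := ∏ q ∈ (Finset.univ.image fun i => primeValue (wt i)).erase
    (primeValue (wt i₀)), (Polynomial.X - Polynomial.C (q : ℂ))
  have hP : ∀ (Q : Polynomial ℂ) x i, b.repr (Polynomial.aeval (ρ (torus primeTorus)) Q x) i =
      Q.eval (primeValue (wt i) : ℂ) * b.repr x i := by
    intro Q x i
    induction Q using Polynomial.induction_on' generalizing x with
    | add p q hp hq => simp [hp, hq, add_mul]
    | monomial n a =>
      rw [Polynomial.aeval_monomial, Polynomial.eval_monomial]
      simp only [Module.End.mul_apply, Module.algebraMap_end_apply, map_smul, Finsupp.smul_apply,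
        smul_eq_mul, mul_assoc]
      congr 1
      induction n generalizing x with
      | zero => simp
      | succ n ih =>
        rw [pow_succ, Module.End.mul_apply, ih, htorus, wchar_primeTorus, pow_succ, mul_assoc]
  have hPW : ∀ (Q : Polynomial ℂ), ∀ x ∈ W, Polynomial.aeval (ρ (torus primeTorus)) Q x ∈ W := by
    intro Q x hx
    induction Q using Polynomial.induction_on' with
    | add p q hp hq => simpa using W.add_mem hp hq
    | monomial n a =>
      rw [Polynomial.aeval_monomial]
      simp only [Module.End.mul_apply, Module.algebraMap_end_apply]
      refine W.smul_mem _ ?_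
      induction n with
      | zero => simpa
      | succ n ih => rw [pow_succ', Module.End.mul_apply]; exact hW _ _ ih
  set v := Polynomial.aeval (ρ (torus primeTorus)) P w with hv
  have hvW : v ∈ W := hPW P w hw
  have hv0 : ∀ i, primeValue (wt i) ≠ primeValue (wt i₀) → b.repr v i = 0 := by
    intro i hi
    rw [hv, hP, Polynomial.eval_prod, Finset.prod_eq_zero (i := primeValue (wt i)), zero_mul]
    · simp [hi]
    · simp
  have hvi : b.repr v i₀ ≠ 0 := by
    rw [hv, hP, Polynomial.eval_prod]
    refine mul_ne_zero (Finset.prod_ne_zero_iff.2 fun q hq => ?_) hwi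
    have := Finset.ne_of_mem_erase hq
    simp only [Polynomial.eval_sub, Polynomial.eval_X, Polynomial.eval_C]
    rw [sub_ne_zero]
    exact_mod_cast this.symm
  have hnotS : ∀ x ∈ W, ∀ i, i ∉ S → b.repr x i = 0 := by
    intro x hx i hi
    by_contra hne
    exact hi (by simpa [S] using ⟨x, hx, hne⟩)
  have hvt : ∀ t, ρ (torus t) v = wchar (wt i₀) t • v := by
    intro t
    refine b.ext_elem fun i => ?_
    rw [htorus, map_smul, Finsupp.smul_apply, smul_eq_mul]
    by_cases hi : primeValue (wt i) = primeValue (wt i₀)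
    · rw [primeValue_injective hi]
    · rw [hv0 i hi, mul_zero, mul_zero]
  refine ⟨wt i₀, v, hvW, fun h0 => hvi (by simp [h0]), fun u hu => ?_, hvt⟩
  refine b.ext_elem fun i => ?_
  by_cases hi : i ∈ S
  swap
  · rw [hnotS _ (hW u v hvW) i hi, hnotS v hvW i hi]
  have hle := hmax i hi
  have hlim : Tendsto (fun k : ℕ => b.repr (ρ (torus (primeTorus⁻¹ ^ k) * u *
      torus (primeTorus ^ k)) v) i) atTop (𝓝 (b.repr v i)) := by
    have := ((hcoeff (b.coord i) v).tendsto 1).comp (tendsto_conj_primeTorus hu)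
    rw [map_one, Module.End.one_apply] at this
    exact this
  have hpow : ∀ (ν : Fin 4 → ℤ) (t : Fin 4 → ℂˣ) (k : ℕ), wchar ν (t ^ k) = wchar ν t ^ k := by
    intro ν t k
    simp only [wchar, ← Finset.prod_pow, Pi.pow_apply, Units.val_pow_eq_pow_val]
    exact Finset.prod_congr rfl fun j _ => by
      rw [← zpow_natCast, ← zpow_natCast, ← _root_.zpow_mul, ← _root_.zpow_mul, mul_comm]
  have hform : ∀ k : ℕ, b.repr (ρ (torus (primeTorus⁻¹ ^ k) * u * torus (primeTorus ^ k)) v) i =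
      (((primeValue (wt i₀) / primeValue (wt i) : ℚ)) : ℂ) ^ k * b.repr (ρ u v) i := by
    intro k
    rw [map_mul, map_mul, Module.End.mul_apply, Module.End.mul_apply, hvt, map_smul, map_smul,
      map_smul, Finsupp.smul_apply, htorus, hpow, hpow, wchar_inv, wchar_primeTorus,
      wchar_primeTorus]
    push_cast
    rw [div_pow, smul_eq_mul, inv_pow]
    ring
  simp only [hform] at hlim
  rcases hle.eq_or_lt with heq | hlt
  · rw [heq, div_self (primeValue_pos _).ne'] at hlim
    simp only [Rat.cast_one, one_pow, one_mul] at hlim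
    exact tendsto_nhds_unique tendsto_const_nhds hlim
  · have h1 : 1 < primeValue (wt i₀) / primeValue (wt i) := (one_lt_div (primeValue_pos _)).2 hlt
    have hvi0 := hv0 i hlt.ne
    rw [hvi0] at hlim ⊢
    by_contra hy
    have hnorm := hlim.norm
    simp only [norm_mul, norm_pow, norm_zero] at hnorm
    have h2 : (1 : ℝ) < ‖((primeValue (wt i₀) / primeValue (wt i) : ℚ) : ℂ)‖ := by
      rw [Complex.norm_ratCast, abs_of_pos (by exact_mod_cast one_pos.trans h1)]
      exact_mod_cast h1
    have h3 := (tendsto_pow_atTop_atTop_of_one_lt h2).atTop_mul_const (norm_pos_iff.2 hy)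
    exact not_tendsto_nhds_of_tendsto_atTop h3 _ hnorm

end Tame

/-! ### Irreducibility and complete reducibility -/

section Inner

variable {E F : Type} [NormedAddCommGroup E] [InnerProductSpace ℂ E]
  [NormedAddCommGroup F] [InnerProductSpace ℂ F]

/-- The inner product is compatible with the representation: the adjoint of `g` is `g*`, and matrix
coefficients are continuous. -/
structure IsStarRep (ρ : Representation ℂ G4 E) : Prop where
  inner_left : ∀ g x y, ⟪ρ g x, y⟫_ℂ = ⟪x, ρ (star g) y⟫_ℂ
  continuous_inner : ∀ x y, Continuous fun g => ⟪x, ρ g y⟫_ℂ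

variable {ρ : Representation ℂ G4 E} {ρ' : Representation ℂ G4 F}

theorem IsStarRep.inner_right (h : IsStarRep ρ) (g : G4) (x y : E) :
    ⟪x, ρ g y⟫_ℂ = ⟪ρ (star g) x, y⟫_ℂ := by rw [h.inner_left, star_star]

theorem IsStarRep.inner_both (h : IsStarRep ρ) (g k : G4) (x y : E) :
    ⟪ρ g x, ρ k y⟫_ℂ = ⟪x, ρ (star g * k) y⟫_ℂ := by
  rw [h.inner_left, map_mul, Module.End.mul_apply]

/-- Matrix coefficients between highest weight vectors are, on the big cell, multiples of the
character of the torus. -/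
theorem IsStarRep.inner_bigCell (h : IsStarRep ρ) {μ ν : Fin 4 → ℤ} {v w : E}
    (hv : v ∈ hwSpace ρ μ) (hw : w ∈ hwSpace ρ ν) (u u' : G4) (t : Fin 4 → ℂˣ)
    (hu : IsUnitri u) (hu' : IsUnitri u') :
    ⟪w, ρ (star u * torus t * u') v⟫_ℂ = wchar μ t * ⟪w, v⟫_ℂ := by
  rw [map_mul, map_mul, Module.End.mul_apply, Module.End.mul_apply, hv.1 u' hu', hv.2,
    h.inner_right, star_star, hw.1 u hu, inner_smul_right]

/-- The normalized matrix coefficient `g ↦ ⟨v, g v⟩ / ⟨v, v⟩` of a highest weight vector `v` depends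
only on its weight. -/
theorem IsStarRep.inner_mul_inner (h : IsStarRep ρ) (h' : IsStarRep ρ') {μ : Fin 4 → ℤ}
    {v w : E} (hv : v ∈ hwSpace ρ μ) (hw : w ∈ hwSpace ρ μ)
    {v' w' : F} (hv' : v' ∈ hwSpace ρ' μ) (hw' : w' ∈ hwSpace ρ' μ) (g : G4) :
    ⟪w', v'⟫_ℂ * ⟪w, ρ g v⟫_ℂ = ⟪w, v⟫_ℂ * ⟪w', ρ' g v'⟫_ℂ := by
  refine congr_fun (eq_of_eqOn_bigCell (continuous_const.mul (h.continuous_inner w v))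
    (continuous_const.mul (h'.continuous_inner w' v')) fun u u' t hu hu' => ?_) g
  simp only [Pi.mul_apply]
  rw [h.inner_bigCell hv hw u u' t hu hu', h'.inner_bigCell hv' hw' u u' t hu hu']
  ring

theorem IsStarRep.inner_orbit_eq_zero (h : IsStarRep ρ) {μ ν : Fin 4 → ℤ}
    {v w : E} (hv : v ∈ hwSpace ρ μ) (hw : w ∈ hwSpace ρ ν) (h0 : ⟪w, v⟫_ℂ = 0) (g : G4) :
    ⟪w, ρ g v⟫_ℂ = 0 :=
  congr_fun (eq_of_eqOn_bigCell (h.continuous_inner w v) (continuous_const (y := (0 : ℂ)))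
    fun u u' t hu hu' => by rw [h.inner_bigCell hv hw u u' t hu hu', h0, mul_zero]) g

theorem IsStarRep.inner_eq_zero (h : IsStarRep ρ) {μ ν : Fin 4 → ℤ}
    {v w : E} (hv : v ∈ hwSpace ρ μ) (hw : w ∈ hwSpace ρ ν) (hμν : μ ≠ ν) : ⟪w, v⟫_ℂ = 0 := by
  by_contra h0
  refine hμν (wchar_injective fun t => ?_)
  have h1 : ⟪w, ρ (torus t) v⟫_ℂ = wchar μ t * ⟪w, v⟫_ℂ := by rw [hv.2, inner_smul_right]
  rw [h.inner_right, star_torus, hw.2, inner_smul_left, ← RCLike.star_def, star_wchar,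
    star_star] at h1
  exact (mul_right_cancel₀ h0 h1).symm

theorem IsStarRep.orthogonal_invariant (h : IsStarRep ρ) {W : Submodule ℂ E}
    (hW : ∀ g, ∀ x ∈ W, ρ g x ∈ W) (g : G4) (x : E) (hx : x ∈ Wᗮ) : ρ g x ∈ Wᗮ := by
  rw [Submodule.mem_orthogonal] at hx ⊢
  intro y hy
  rw [h.inner_right]
  exact hx _ (hW _ _ hy)

theorem span_orbit_invariant {M : Type} [AddCommGroup M] [Module ℂ M] (σ : Representation ℂ G4 M)
    (v : M) (g : G4) (x : M) (hx : x ∈ Submodule.span ℂ (Set.range fun k => σ k v)) :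
    σ g x ∈ Submodule.span ℂ (Set.range fun k => σ k v) := by
  induction hx using Submodule.span_induction with
  | mem x hx =>
    obtain ⟨k, rfl⟩ := hx
    exact Submodule.subset_span ⟨g * k, by simp⟩
  | zero => simp
  | add x y _ _ hx hy => rw [map_add]; exact Submodule.add_mem _ hx hy
  | smul c x _ hx => rw [map_smul]; exact Submodule.smul_mem _ _ hx

/-- The orthogonal projection to a subrepresentation is equivariant. -/
theorem IsStarRep.exists_projection (h : IsStarRep ρ) [FiniteDimensional ℂ E] {W : Submodule ℂ E}
    (hW : ∀ g, ∀ x ∈ W, ρ g x ∈ W) :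
    ∃ p : E →ₗ[ℂ] W, (∀ x : W, p x = x) ∧ ∀ g x, (p (ρ g x) : E) = ρ g (p x) := by
  refine ⟨W.orthogonalProjectionOnto.toLinearMap, fun x => by simp, fun g x => ?_⟩
  change W.starProjection (ρ g x) = ρ g (W.starProjection x)
  refine Submodule.eq_starProjection_of_mem_orthogonal (hW _ _ (Submodule.starProjection_apply_mem _ _)) ?_
  rw [← map_sub]
  exact h.orthogonal_invariant hW _ _ (Submodule.sub_starProjection_mem_orthogonal _)

/-- A highest weight vector `p` can be mapped to any highest weight vector `w` of the same weight
by an equivariant map: since matrix coefficients depend only on the weight, sending `g p` to `g w`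
is a well-defined linear map on the span of the orbit of `p`. -/
theorem IsStarRep.exists_commutes (h : IsStarRep ρ) (h' : IsStarRep ρ') [FiniteDimensional ℂ E]
    {μ : Fin 4 → ℤ} {p : E} {w : F} (hp : p ∈ hwSpace ρ μ) (hp0 : p ≠ 0) (hw : w ∈ hwSpace ρ' μ) :
    ∃ f : E →ₗ[ℂ] F, Commutes ρ ρ' f ∧ f p = w := by
  let Lp : (G4 →₀ ℂ) →ₗ[ℂ] E := Finsupp.linearCombination ℂ fun g => ρ g p
  let Lw : (G4 →₀ ℂ) →ₗ[ℂ] F := Finsupp.linearCombination ℂ fun g => ρ' g w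
  have hinner : ∀ c d, ⟪p, p⟫_ℂ * ⟪Lw c, Lw d⟫_ℂ = ⟪w, w⟫_ℂ * ⟪Lp c, Lp d⟫_ℂ := by
    intro c d
    induction c using Finsupp.induction_linear with
    | zero => simp
    | add c c' hc hc' => simp only [map_add, inner_add_left, mul_add, hc, hc']
    | single g a =>
      induction d using Finsupp.induction_linear with
      | zero => simp
      | add d d' hd hd' => simp only [map_add, inner_add_right, mul_add, hd, hd']
      | single k b =>
        simp only [Lp, Lw, Finsupp.linearCombination_single, inner_smul_left, inner_smul_right,
          h.inner_both, h'.inner_both]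
        linear_combination (conj a * b) * h'.inner_mul_inner h hw hw hp hp (star g * k)
  have hpp : ⟪p, p⟫_ℂ ≠ 0 := inner_self_ne_zero.2 hp0
  have hker : LinearMap.ker Lp ≤ LinearMap.ker Lw := by
    intro c hc
    rw [LinearMap.mem_ker] at hc ⊢
    have := hinner c c
    rw [hc, inner_zero_left, mul_zero] at this
    exact inner_self_eq_zero.1 ((mul_eq_zero.1 this).resolve_left hpp)
  have hLp : LinearMap.range Lp = Submodule.span ℂ (Set.range fun g => ρ g p) :=
    Finsupp.range_linearCombination ℂ
  have hinv : ∀ g, ∀ x ∈ LinearMap.range Lp, ρ g x ∈ LinearMap.range Lp := by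
    rw [hLp]; exact span_orbit_invariant ρ p
  obtain ⟨q, hq, hq'⟩ := h.exists_projection hinv
  let f₀ : LinearMap.range Lp →ₗ[ℂ] F :=
    ((LinearMap.ker Lp).liftQ Lw hker) ∘ₗ Lp.quotKerEquivRange.symm.toLinearMap
  have hf₀ : ∀ c, f₀ ⟨Lp c, c, rfl⟩ = Lw c := by
    intro c
    have : Lp.quotKerEquivRange.symm ⟨Lp c, c, rfl⟩ = (LinearMap.ker Lp).mkQ c := by
      rw [LinearEquiv.symm_apply_eq]; rfl
    simp only [f₀, LinearMap.comp_apply, LinearEquiv.coe_coe, this, Submodule.mkQ_apply,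
      Submodule.liftQ_apply]
  have hLpg : ∀ g c, ρ g (Lp c) = Lp (Finsupp.mapDomain (g * ·) c) := by
    intro g c
    induction c using Finsupp.induction_linear with
    | zero => simp
    | add c c' hc hc' => simp only [map_add, Finsupp.mapDomain_add, hc, hc']
    | single k a => simp [Lp, Finsupp.mapDomain_single]
  have hLwg : ∀ g c, ρ' g (Lw c) = Lw (Finsupp.mapDomain (g * ·) c) := by
    intro g c
    induction c using Finsupp.induction_linear with
    | zero => simp
    | add c c' hc hc' => simp only [map_add, Finsupp.mapDomain_add, hc, hc']
    | single k a => simp [Lw, Finsupp.mapDomain_single]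
  refine ⟨f₀ ∘ₗ q, fun g x => ?_, ?_⟩
  · obtain ⟨c, hc⟩ := (q x).2
    have h1 : q x = ⟨Lp c, c, rfl⟩ := Subtype.ext hc.symm
    have h2 : q (ρ g x) = ⟨Lp (Finsupp.mapDomain (g * ·) c), _, rfl⟩ := by
      apply Subtype.ext
      rw [hq', ← hc, hLpg]
    have h3 : (f₀ ∘ₗ q) (ρ g x) = f₀ (q (ρ g x)) := rfl
    have h4 : (f₀ ∘ₗ q) x = f₀ (q x) := rfl
    rw [h3, h4, h1, h2, hf₀, hf₀, hLwg]
  · have h1 : Lp (Finsupp.single 1 1) = p := by simp [Lp]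
    have h2 : Lw (Finsupp.single 1 1) = w := by simp [Lw]
    have h3 : q p = ⟨Lp (Finsupp.single 1 1), _, rfl⟩ := by
      rw [← hq ⟨Lp (Finsupp.single 1 1), _, rfl⟩]
      exact congrArg q h1.symm
    change f₀ (q p) = w
    rw [h3, hf₀, h2]

end Inner

section Tame

variable {M N : Type} [AddCommGroup M] [Module ℂ M] [AddCommGroup N] [Module ℂ N]
  {ρ : Representation ℂ G4 M} {ρ' : Representation ℂ G4 N}

/-- The inner product is only asserted to exist: proofs introduce it locally, so that the vector
space carries no distinguished norm. -/
theorem IsTame.isStarRep (h : IsTame ρ) : ∃ c : InnerProductSpace.Core ℂ M,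
    letI : NormedAddCommGroup M := c.toNormedAddCommGroup
    letI : InnerProductSpace ℂ M := InnerProductSpace.ofCore c.toCore
    IsStarRep ρ := by
  obtain ⟨c, hc⟩ := h.exists_core
  refine ⟨c, ?_⟩
  let _ : NormedAddCommGroup M := c.toNormedAddCommGroup
  let _ : InnerProductSpace ℂ M := InnerProductSpace.ofCore c.toCore
  exact ⟨hc, fun x y => h.continuous_coeff (innerₛₗ ℂ x) y⟩

theorem IsTame.exists_commutes (h : IsTame ρ) (h' : IsTame ρ')
    {μ : Fin 4 → ℤ} {p : M} {w : N} (hp : p ∈ hwSpace ρ μ) (hp0 : p ≠ 0) (hw : w ∈ hwSpace ρ' μ) :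
    ∃ f : M →ₗ[ℂ] N, Commutes ρ ρ' f ∧ f p = w := by
  obtain ⟨c, hc⟩ := h.isStarRep
  obtain ⟨c', hc'⟩ := h'.isStarRep
  let _ : NormedAddCommGroup M := c.toNormedAddCommGroup
  let _ : InnerProductSpace ℂ M := InnerProductSpace.ofCore c.toCore
  let _ : NormedAddCommGroup N := c'.toNormedAddCommGroup
  let _ : InnerProductSpace ℂ N := InnerProductSpace.ofCore c'.toCore
  have := h.finite
  exact hc.exists_commutes hc' hp hp0 hw

/-- The highest weight vectors of a representation generated by one of them, `v`, are the multiples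
of `v`. -/
theorem IsTame.eq_smul_of_mem_hwSpace (h : IsTame ρ) {μ ν : Fin 4 → ℤ} {v w : M}
    (hv : IsHighest ρ μ v) (hw : w ∈ hwSpace ρ ν) (hw0 : w ≠ 0) : ν = μ ∧ ∃ a : ℂ, w = a • v := by
  obtain ⟨c, hc⟩ := h.isStarRep
  let _ : NormedAddCommGroup M := c.toNormedAddCommGroup
  let _ : InnerProductSpace ℂ M := InnerProductSpace.ofCore c.toCore
  have key : ∀ ν', ∀ w' ∈ hwSpace ρ ν', ⟪w', v⟫_ℂ = 0 → w' = 0 := by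
    intro ν' w' hw' h0
    have h1 : Submodule.span ℂ (Set.range fun g => ρ g v) ≤ LinearMap.ker (innerₛₗ ℂ w') := by
      rw [Submodule.span_le]
      rintro _ ⟨g, rfl⟩
      exact hc.inner_orbit_eq_zero hv.mem hw' h0 g
    rw [hv.span_eq] at h1
    exact inner_self_eq_zero.1 (h1 (x := w') trivial)
  have hνμ : ν = μ := by
    by_contra hne
    exact hw0 (key ν w hw (hc.inner_eq_zero hv.mem hw (Ne.symm hne)))
  refine ⟨hνμ, ⟪v, w⟫_ℂ / ⟪v, v⟫_ℂ, ?_⟩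
  subst hνμ
  rw [← sub_eq_zero]
  refine key ν _ (Submodule.sub_mem _ hw (Submodule.smul_mem _ _ hv.mem)) ?_
  have hvv : ⟪v, v⟫_ℂ ≠ 0 := inner_self_ne_zero.2 hv.ne_zero
  rw [inner_sub_left, inner_smul_left, map_div₀, inner_conj_symm, inner_conj_symm,
    div_mul_cancel₀ _ hvv, sub_self]

/-- A nonzero highest weight vector generates the representation if all other highest weight vectors
are proportional to it. -/
theorem IsTame.isHighest (h : IsTame ρ) {μ : Fin 4 → ℤ} {v : M} (hv : v ∈ hwSpace ρ μ)
    (hv0 : v ≠ 0) (hall : ∀ ν, ∀ w ∈ hwSpace ρ ν, ∃ a : ℂ, w = a • v) : IsHighest ρ μ v := by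
  refine ⟨hv, hv0, ?_⟩
  obtain ⟨c, hc⟩ := h.isStarRep
  let _ : NormedAddCommGroup M := c.toNormedAddCommGroup
  let _ : InnerProductSpace ℂ M := InnerProductSpace.ofCore c.toCore
  have := h.finite
  rw [← Submodule.orthogonal_eq_bot_iff]
  by_contra hne
  obtain ⟨ν, w, hw, hw0, hwν⟩ := h.exists_hw _
    (hc.orthogonal_invariant (span_orbit_invariant ρ v)) hne
  obtain ⟨a, rfl⟩ := hall ν w hwν
  have h1 : a • v ∈ Submodule.span ℂ (Set.range fun g => ρ g v) :=
    Submodule.smul_mem _ _ (Submodule.subset_span ⟨1, by simp⟩)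
  exact hw0 (inner_self_eq_zero.1 ((Submodule.mem_orthogonal _ _).1 hw _ h1))

/-- Irreducibility: an equivariant map that does not kill the highest weight vector is injective. -/
theorem IsTame.injective_of_commutes (h : IsTame ρ) {μ : Fin 4 → ℤ} {v : M} (hv : IsHighest ρ μ v)
    {f : M →ₗ[ℂ] N} (hf : Commutes ρ ρ' f) (hfv : f v ≠ 0) : Function.Injective f := by
  rw [← LinearMap.ker_eq_bot]
  by_contra hne
  obtain ⟨ν, w, hw, hw0, hwν⟩ := h.exists_hw (LinearMap.ker f)
    (fun g x hx => by rw [LinearMap.mem_ker, hf, LinearMap.mem_ker.1 hx, map_zero]) hne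
  obtain ⟨-, a, rfl⟩ := h.eq_smul_of_mem_hwSpace hv hwν hw0
  rw [LinearMap.mem_ker, map_smul, smul_eq_zero] at hw
  rcases hw with rfl | hw
  · simp at hw0
  · exact hfv hw

theorem IsHighest.eq_of_commutes {μ : Fin 4 → ℤ} {v : M} (hv : IsHighest ρ μ v)
    {f f' : M →ₗ[ℂ] N} (hf : Commutes ρ ρ' f) (hf' : Commutes ρ ρ' f') (h : f v = f' v) :
    f = f' := by
  refine LinearMap.ext_on_range hv.span_eq fun g => ?_
  rw [hf, hf', h]

/-- Irreducible representations of the same highest weight are isomorphic. -/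
theorem IsTame.exists_equiv (h : IsTame ρ) (h' : IsTame ρ') {μ : Fin 4 → ℤ} {v : M} {w : N}
    (hv : IsHighest ρ μ v) (hw : IsHighest ρ' μ w) :
    ∃ e : M ≃ₗ[ℂ] N, Commutes ρ ρ' e.toLinearMap ∧ e v = w := by
  obtain ⟨f, hf, hfv⟩ := h.exists_commutes h' hv.mem hv.ne_zero hw.mem
  obtain ⟨f', hf', hfw⟩ := h'.exists_commutes h hw.mem hw.ne_zero hv.mem
  refine ⟨LinearEquiv.ofLinearMap f f' ?_ ?_, hf, hfv⟩
  · exact hw.eq_of_commutes (ρ' := ρ') (fun g x => by simp [hf' g, hf g]) (fun g x => rfl)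
      (by simp [hfv, hfw])
  · exact hv.eq_of_commutes (ρ' := ρ) (fun g x => by simp [hf' g, hf g]) (fun g x => rfl)
      (by simp [hfv, hfw])

/-- The space of equivariant maps. -/
def homSpace (ρ : Representation ℂ G4 M) (ρ' : Representation ℂ G4 N) :
    Submodule ℂ (M →ₗ[ℂ] N) where
  carrier := {f | Commutes ρ ρ' f}
  zero_mem' := fun g x => by simp
  add_mem' := fun ha hb g x => by simp [ha g x, hb g x]
  smul_mem' := fun c a ha g x => by simp [ha g x]

/-- Equivariant maps out of an irreducible representation correspond to highest weight vectors. -/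
theorem IsTame.finrank_homSpace (h : IsTame ρ) (h' : IsTame ρ') {μ : Fin 4 → ℤ} {v : M}
    (hv : IsHighest ρ μ v) :
    Module.finrank ℂ (homSpace ρ ρ') = Module.finrank ℂ (hwSpace ρ' μ) := by
  let ev : homSpace ρ ρ' →ₗ[ℂ] hwSpace ρ' μ :=
    { toFun := fun f => ⟨f.1 v, f.2.map_hwSpace hv.mem⟩
      map_add' := fun _ _ => rfl
      map_smul' := fun _ _ => rfl }
  refine (LinearEquiv.ofBijective ev ⟨fun f f' hff => ?_, fun w => ?_⟩).finrank_eq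
  · exact Subtype.ext (hv.eq_of_commutes f.2 f'.2 (congrArg Subtype.val hff))
  · obtain ⟨f, hf, hfv⟩ := h.exists_commutes h' hv.mem hv.ne_zero w.2
    exact ⟨⟨f, hf⟩, Subtype.ext hfv⟩

theorem Commutes.finrank_hwSpace_eq (e : M ≃ₗ[ℂ] N) (he : Commutes ρ ρ' e.toLinearMap)
    (μ : Fin 4 → ℤ) : Module.finrank ℂ (hwSpace ρ μ) = Module.finrank ℂ (hwSpace ρ' μ) := by
  refine (LinearEquiv.ofSubmodules e (hwSpace ρ μ) (hwSpace ρ' μ) ?_).finrank_eq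
  have he' : Commutes ρ' ρ e.symm.toLinearMap := fun g x => by
    have := he g (e.symm x)
    simp only [LinearEquiv.coe_coe, LinearEquiv.apply_symm_apply] at this ⊢
    rw [← this, LinearEquiv.symm_apply_apply]
  ext x
  constructor
  · rintro ⟨y, hy, rfl⟩; exact he.map_hwSpace hy
  · intro hx
    exact ⟨e.symm x, he'.map_hwSpace hx, by simp⟩

end Tame

/-! ### Simple reflections: highest weights are dominant -/

/-- The permutation matrix that exchanges the basis vectors `i` and `i + 1`. -/
def simpleRefl (i : Fin 3) : G4 where
  val := Matrix.of fun a b => if b = Equiv.swap i.castSucc i.succ a then 1 else 0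
  inv := Matrix.of fun a b => if b = Equiv.swap i.castSucc i.succ a then 1 else 0
  val_inv := by
    ext a b
    simp only [Matrix.mul_apply, Matrix.of_apply, ite_mul, one_mul, zero_mul,
      Finset.sum_ite_eq', Finset.mem_univ, if_true]
    simp [Matrix.one_apply, eq_comm]
  inv_val := by
    ext a b
    simp only [Matrix.mul_apply, Matrix.of_apply, ite_mul, one_mul, zero_mul,
      Finset.sum_ite_eq', Finset.mem_univ, if_true]
    simp [Matrix.one_apply, eq_comm]

theorem simpleRefl_apply (i : Fin 3) (a b : Fin 4) :
    (simpleRefl i : Matrix (Fin 4) (Fin 4) ℂ) a b =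
      if b = Equiv.swap i.castSucc i.succ a then 1 else 0 := rfl

theorem star_simpleRefl (i : Fin 3) : star (simpleRefl i) = simpleRefl i := by
  ext a b
  rw [Units.coe_star, Matrix.star_apply, simpleRefl_apply, simpleRefl_apply]
  have : a = Equiv.swap i.castSucc i.succ b ↔ b = Equiv.swap i.castSucc i.succ a := by
    constructor <;> rintro rfl <;> simp
  simp only [this]
  split_ifs <;> simp

theorem simpleRefl_mul_self (i : Fin 3) : simpleRefl i * simpleRefl i = 1 :=
  Units.ext (simpleRefl i).val_inv

/-- The elementary unitriangular matrix with entry `z` at `(i, i + 1)`. -/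
def simpleRoot (i : Fin 3) (z : ℂ) : G4 where
  val := Matrix.transvection i.castSucc i.succ z
  inv := Matrix.transvection i.castSucc i.succ (-z)
  val_inv := by
    rw [Matrix.transvection_mul_transvection_same _ _ Fin.castSucc_lt_succ.ne, add_neg_cancel,
      Matrix.transvection_zero]
  inv_val := by
    rw [Matrix.transvection_mul_transvection_same _ _ Fin.castSucc_lt_succ.ne, neg_add_cancel,
      Matrix.transvection_zero]

theorem isUnitri_simpleRoot (i : Fin 3) (z : ℂ) : IsUnitri (simpleRoot i z) := by
  intro a b hab
  change Matrix.transvection i.castSucc i.succ z a b = _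
  rw [Matrix.transvection, Matrix.add_apply, Matrix.single_apply, if_neg, add_zero]
  rintro ⟨rfl, rfl⟩
  exact absurd hab (not_le.2 Fin.castSucc_lt_succ)

/-- The torus element with entries `ε` and `-1/ε` at `i` and `i + 1`. -/
def simpleTorus (i : Fin 3) (ε : ℂˣ) : Fin 4 → ℂˣ :=
  Function.update (Function.update 1 i.castSucc ε) i.succ (-ε⁻¹)

theorem wchar_simpleTorus (i : Fin 3) (ε : ℂˣ) (μ : Fin 4 → ℤ) :
    wchar μ (simpleTorus i ε) = (-1) ^ μ i.succ * (ε : ℂ) ^ (μ i.castSucc - μ i.succ) := by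
  have h : (-(ε : ℂ)⁻¹) ^ μ i.succ = (-1) ^ μ i.succ * (ε : ℂ) ^ (-μ i.succ) := by
    rw [neg_eq_neg_one_mul, mul_zpow, _root_.inv_zpow, _root_.zpow_neg]
  rw [sub_eq_add_neg, zpow_add₀ ε.ne_zero, mul_left_comm, ← h, wchar]
  fin_cases i <;> simp [Fin.prod_univ_four, simpleTorus, Function.update_apply]

/-- In the big cell, elements of the form `[[ε, 1], [1, 0]]` approach a simple reflection. -/
theorem simpleRefl_approx (i : Fin 3) (ε : ℂˣ) (hε : star (ε : ℂ) = ε) :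
    ((star (simpleRoot i (ε : ℂ)⁻¹) * torus (simpleTorus i ε) * simpleRoot i (ε : ℂ)⁻¹ : G4) :
      Matrix (Fin 4) (Fin 4) ℂ) = (simpleRefl i : Matrix (Fin 4) (Fin 4) ℂ) +
        (ε : ℂ) • Matrix.single i.castSucc i.castSucc 1 := by
  have h0 : (ε : ℂ) ≠ 0 := ε.ne_zero
  have h1 : (starRingEnd ℂ) (ε : ℂ) = ε := hε
  rw [Units.val_mul, Units.val_mul, Units.coe_star, coe_torus]
  change star (Matrix.transvection i.castSucc i.succ (ε : ℂ)⁻¹) * _ *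
    Matrix.transvection i.castSucc i.succ (ε : ℂ)⁻¹ = _
  ext a b
  rw [Matrix.mul_apply]
  simp only [Matrix.mul_diagonal, Fin.sum_univ_four, Matrix.star_apply]
  fin_cases i <;> fin_cases a <;> fin_cases b <;>
    simp [Matrix.transvection, simpleRefl_apply, simpleTorus, h0, h1, Equiv.swap_apply_def]

section Inner

variable {E : Type} [NormedAddCommGroup E] [InnerProductSpace ℂ E] {ρ : Representation ℂ G4 E}

/-- The coefficient of a simple reflection at a highest weight vector is a limit of its values on
the big cell, along `ε = 1 / (n + 1)`. -/
theorem IsStarRep.tendsto_simpleRefl (h : IsStarRep ρ) {μ : Fin 4 → ℤ} {v : E}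
    (hv : v ∈ hwSpace ρ μ) (i : Fin 3) :
    Tendsto (fun n : ℕ => (-1) ^ μ i.succ * (1 / ((n : ℂ) + 1)) ^ (μ i.castSucc - μ i.succ) *
      ⟪v, v⟫_ℂ) atTop (𝓝 ⟪v, ρ (simpleRefl i) v⟫_ℂ) := by
  have hn : ∀ n : ℕ, (1 / ((n : ℂ) + 1)) ≠ 0 := fun n =>
    one_div_ne_zero (Nat.cast_add_one_ne_zero n)
  let ε : ℕ → ℂˣ := fun n => Units.mk0 _ (hn n)
  have hε : ∀ n, star (ε n : ℂ) = ε n := by intro n; simp [ε]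
  have h1 : Tendsto (fun n => star (simpleRoot i (ε n : ℂ)⁻¹) * torus (simpleTorus i (ε n)) *
      simpleRoot i (ε n : ℂ)⁻¹) atTop (𝓝 (simpleRefl i)) := by
    apply tendsto_units
    simp only [simpleRefl_approx i _ (hε _)]
    have h2 : Tendsto (fun n => (ε n : ℂ)) atTop (𝓝 0) :=
      tendsto_one_div_add_atTop_nhds_zero_nat
    have h3 := (tendsto_const_nhds (x := (simpleRefl i : Matrix (Fin 4) (Fin 4) ℂ))).add
      (h2.smul_const (Matrix.single i.castSucc i.castSucc (1 : ℂ)))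
    rwa [zero_smul, add_zero] at h3
  refine (((h.continuous_inner v v).tendsto _).comp h1).congr fun n => ?_
  rw [Function.comp_apply, h.inner_bigCell hv hv _ _ _ (isUnitri_simpleRoot _ _)
    (isUnitri_simpleRoot _ _), wchar_simpleTorus]
  rfl

/-- A highest weight is dominant: otherwise the coefficient of a simple reflection would be
infinite. -/
theorem IsStarRep.dominant (h : IsStarRep ρ) {μ : Fin 4 → ℤ} {v : E}
    (hv : v ∈ hwSpace ρ μ) (hv0 : v ≠ 0) : Antitone μ := by
  rw [Fin.antitone_iff_succ_le]
  intro i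
  by_contra hlt
  push Not at hlt
  have h1 := (h.tendsto_simpleRefl hv i).norm
  obtain ⟨k, hk⟩ := Int.eq_ofNat_of_zero_le (sub_nonneg.2 hlt.le)
  have hk0 : k ≠ 0 := by rintro rfl; simp at hk; omega
  have hvv : 0 < ‖⟪v, v⟫_ℂ‖ := norm_pos_iff.2 (inner_self_ne_zero.2 hv0)
  have h2 : ∀ n : ℕ, ‖(-1) ^ μ i.succ * (1 / ((n : ℂ) + 1)) ^ (μ i.castSucc - μ i.succ) *
      ⟪v, v⟫_ℂ‖ = ((n : ℝ) + 1) ^ k * ‖⟪v, v⟫_ℂ‖ := by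
    intro n
    have : μ i.castSucc - μ i.succ = -(k : ℤ) := by omega
    rw [this, norm_mul, norm_mul, norm_zpow, norm_zpow, norm_neg, norm_one, _root_.one_zpow, one_mul,
      one_div, norm_inv, _root_.inv_zpow, _root_.zpow_neg, inv_inv, zpow_natCast]
    norm_cast
  simp only [h2] at h1
  have h3 : Tendsto (fun n : ℕ => ((n : ℝ) + 1) ^ k * ‖⟪v, v⟫_ℂ‖) atTop atTop :=
    ((tendsto_pow_atTop hk0).comp (tendsto_natCast_atTop_atTop.atTop_add
      tendsto_const_nhds)).atTop_mul_const hvv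
  exact not_tendsto_nhds_of_tendsto_atTop h3 _ h1

/-- A simple reflection fixing the weight acts on a highest weight vector by a sign, because the
limit computing its coefficient is constant and the reflection is unitary. -/
theorem IsStarRep.simpleRefl_apply_eq (h : IsStarRep ρ) {μ : Fin 4 → ℤ} {v : E}
    (hv : v ∈ hwSpace ρ μ) (i : Fin 3) (hi : μ i.castSucc = μ i.succ) :
    ρ (simpleRefl i) v = (-1 : ℂ) ^ μ i.succ • v := by
  have h1 := h.tendsto_simpleRefl hv i
  simp only [hi, sub_self, zpow_zero, mul_one] at h1
  have h2 := tendsto_nhds_unique tendsto_const_nhds h1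
  set c : ℂ := (-1 : ℂ) ^ μ i.succ with hc
  have hcc : c * c = 1 := by
    rw [hc, ← mul_zpow]; simp
  have hconj : conj c = c := by rw [hc, map_zpow₀, map_neg, map_one]
  have h3 : ⟪ρ (simpleRefl i) v, v⟫_ℂ = c * ⟪v, v⟫_ℂ := by
    rw [h.inner_left, star_simpleRefl, h2]
  have h4 : ⟪ρ (simpleRefl i) v, ρ (simpleRefl i) v⟫_ℂ = ⟪v, v⟫_ℂ := by
    rw [h.inner_both, star_simpleRefl, simpleRefl_mul_self, map_one, Module.End.one_apply]
  rw [← sub_eq_zero, ← inner_self_eq_zero (𝕜 := ℂ), inner_sub_left, inner_sub_right,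
    inner_sub_right, h4, inner_smul_left, inner_smul_left, inner_smul_right, inner_smul_right,
    h3, ← h2, hconj]
  linear_combination (-⟪v, v⟫_ℂ) * hcc

end Inner

section Tame

variable {M N : Type} [AddCommGroup M] [Module ℂ M] [AddCommGroup N] [Module ℂ N]
  {ρ : Representation ℂ G4 M} {ρ' : Representation ℂ G4 N}

theorem IsTame.dominant (h : IsTame ρ) {μ : Fin 4 → ℤ} {v : M}
    (hv : v ∈ hwSpace ρ μ) (hv0 : v ≠ 0) : Antitone μ := by
  obtain ⟨c, hc⟩ := h.isStarRep
  let _ : NormedAddCommGroup M := c.toNormedAddCommGroup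
  let _ : InnerProductSpace ℂ M := InnerProductSpace.ofCore c.toCore
  exact hc.dominant hv hv0

theorem IsTame.simpleRefl_apply_eq (h : IsTame ρ) {μ : Fin 4 → ℤ} {v : M}
    (hv : v ∈ hwSpace ρ μ) (i : Fin 3) (hi : μ i.castSucc = μ i.succ) :
    ρ (simpleRefl i) v = (-1 : ℂ) ^ μ i.succ • v := by
  obtain ⟨c, hc⟩ := h.isStarRep
  let _ : NormedAddCommGroup M := c.toNormedAddCommGroup
  let _ : InnerProductSpace ℂ M := InnerProductSpace.ofCore c.toCore
  exact hc.simpleRefl_apply_eq hv i hi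

/-! ### Lowest weight forms -/

/-- `ζ` is the linear form `⟨v, ·⟩ / ⟨v, v⟩` attached to the highest weight vector `v` of an
irreducible representation: a lowest weight form that separates points up to translation, that is an
eigenvector of the simple reflections fixing the weight, and through which every lowest weight form
of the same weight factors. -/
structure IsLowestForm (ρ : Representation ℂ G4 M) (μ : Fin 4 → ℤ) (v : M)
    (ζ : Module.Dual ℂ M) : Prop where
  mem : ζ ∈ lwForms ρ μ
  apply_eq_one : ζ v = 1
  eq_zero : ∀ x, (∀ g, ζ (ρ g x) = 0) → x = 0
  simpleRefl_apply : ∀ i : Fin 3, μ i.castSucc = μ i.succ →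
    ∀ x, ζ (ρ (simpleRefl i) x) = (-1) ^ μ i.succ * ζ x
  exists_factor : ∀ {N : Type} [AddCommGroup N] [Module ℂ N] (ρ' : Representation ℂ G4 N),
    IsTame ρ' → ∀ ξ ∈ lwForms ρ' μ, ∃ q : N →ₗ[ℂ] M, Commutes ρ' ρ q ∧ ∀ x, ζ (q x) = ξ x

theorem IsTame.exists_isLowestForm (h : IsTame ρ) {μ : Fin 4 → ℤ} {v : M}
    (hv : IsHighest ρ μ v) : ∃ ζ, IsLowestForm ρ μ v ζ := by
  obtain ⟨c, hc⟩ := h.isStarRep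
  let _ : NormedAddCommGroup M := c.toNormedAddCommGroup
  let _ : InnerProductSpace ℂ M := InnerProductSpace.ofCore c.toCore
  have hvv : ⟪v, v⟫_ℂ ≠ 0 := inner_self_ne_zero.2 hv.ne_zero
  refine ⟨(⟪v, v⟫_ℂ)⁻¹ • innerₛₗ ℂ v, ⟨fun u hu x => ?_, fun t x => ?_⟩, ?_, fun x hx => ?_,
    fun i hi x => ?_, fun {N} _ _ ρ' h' ξ hξ => ?_⟩
  · simp only [LinearMap.smul_apply, innerₛₗ_apply_apply]
    rw [hc.inner_right, star_star, hv.mem.1 u hu]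
  · simp only [LinearMap.smul_apply, innerₛₗ_apply_apply, smul_eq_mul]
    rw [hc.inner_right, star_torus, hv.mem.2, inner_smul_left, ← RCLike.star_def, star_wchar,
      star_star]
    ring
  · exact inv_mul_cancel₀ hvv
  · have h1 : Submodule.span ℂ (Set.range fun g => ρ g v) ≤ LinearMap.ker (innerₛₗ ℂ x) := by
      rw [Submodule.span_le]
      rintro _ ⟨g, rfl⟩
      have := hx (star g)
      simp only [LinearMap.smul_apply, innerₛₗ_apply_apply, smul_eq_mul, mul_eq_zero, inv_eq_zero, hvv,
        false_or] at this
      rw [hc.inner_right, star_star] at this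
      simp only [SetLike.mem_coe, LinearMap.mem_ker, innerₛₗ_apply_apply]
      rw [← inner_conj_symm, this, map_zero]
    rw [hv.span_eq] at h1
    exact inner_self_eq_zero.1 (h1 (x := x) trivial)
  · simp only [LinearMap.smul_apply, innerₛₗ_apply_apply, smul_eq_mul]
    rw [hc.inner_right, star_simpleRefl, hc.simpleRefl_apply_eq hv.mem i hi, inner_smul_left,
      map_zpow₀, map_neg, map_one]
    ring
  · obtain ⟨c', hc'⟩ := h'.isStarRep
    let _ : NormedAddCommGroup N := c'.toNormedAddCommGroup
    let _ : InnerProductSpace ℂ N := InnerProductSpace.ofCore c'.toCore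
    have := h.finite
    have := h'.finite
    let p' : N := (InnerProductSpace.toDual ℂ N).symm (LinearMap.toContinuousLinearMap ξ)
    have hp' : ∀ x, ⟪p', x⟫_ℂ = ξ x := fun x => by
      rw [InnerProductSpace.toDual_symm_apply]; rfl
    have hp'mem : p' ∈ hwSpace ρ' μ := by
      refine ⟨fun u hu => ext_inner_right ℂ fun x => ?_, fun t => ext_inner_right ℂ fun x => ?_⟩
      · rw [hc'.inner_left, hp', hp', hξ.1 u hu]
      · rw [hc'.inner_left, star_torus, hp', hξ.2, inner_smul_left, hp', ← RCLike.star_def,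
          star_wchar]
    obtain ⟨j, hj, hjv⟩ := h.exists_commutes h' hv.mem hv.ne_zero hp'mem
    refine ⟨⟪v, v⟫_ℂ • j.adjoint, fun g x => ?_, fun x => ?_⟩
    · rw [LinearMap.smul_apply, LinearMap.smul_apply, map_smul]
      congr 1
      refine ext_inner_left ℂ fun y => ?_
      rw [LinearMap.adjoint_inner_right, hc'.inner_right, ← hj, hc.inner_right,
        LinearMap.adjoint_inner_right]
    · simp only [LinearMap.smul_apply, innerₛₗ_apply_apply, smul_eq_mul, map_smul]
      rw [LinearMap.adjoint_inner_right, hjv, hp', mul_inv_cancel_left₀ hvv]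

/-! ### Dual representations -/

/-- The permutation matrix that reverses the order of the basis. -/
def longElt : G4 where
  val := Matrix.of fun a b => if b = Fin.rev a then 1 else 0
  inv := Matrix.of fun a b => if b = Fin.rev a then 1 else 0
  val_inv := by
    ext a b
    simp only [Matrix.mul_apply, Matrix.of_apply, ite_mul, one_mul, zero_mul,
      Finset.sum_ite_eq', Finset.mem_univ, if_true]
    simp [Matrix.one_apply, eq_comm]
  inv_val := by
    ext a b
    simp only [Matrix.mul_apply, Matrix.of_apply, ite_mul, one_mul, zero_mul,
      Finset.sum_ite_eq', Finset.mem_univ, if_true]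
    simp [Matrix.one_apply, eq_comm]

theorem longElt_mul_apply (g : G4) (a b : Fin 4) :
    ((longElt * g * longElt : G4) : Matrix (Fin 4) (Fin 4) ℂ) a b =
      (g : Matrix (Fin 4) (Fin 4) ℂ) a.rev b.rev := by
  have h : (longElt : Matrix (Fin 4) (Fin 4) ℂ) =
    Matrix.of fun a b => if b = Fin.rev a then 1 else 0 := rfl
  have h' : ∀ k : Fin 4, b = k.rev ↔ k = b.rev := fun k => by
    constructor <;> rintro rfl <;> simp
  rw [Units.val_mul, Units.val_mul, h, Matrix.mul_apply]
  simp [Matrix.mul_apply, h']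

theorem longElt_mul_self : longElt * longElt = 1 := Units.ext longElt.val_inv

theorem mul_longElt (g : G4) : g * longElt = longElt * (longElt * g * longElt) := by
  rw [← mul_assoc, ← mul_assoc, longElt_mul_self, one_mul]

/-- The dual of an irreducible representation is irreducible. Its highest weight vector is the
linear form `⟨w v, ·⟩`, where `w` reverses the order of the basis of `ℂ⁴`. -/
theorem IsTame.dual_isHighest (h : IsTame ρ) {μ : Fin 4 → ℤ} {v : M} (hv : IsHighest ρ μ v) :
    ∃ ξ, IsHighest ρ.dual (fun k => -μ k.rev) ξ := by
  obtain ⟨c, hc⟩ := h.isStarRep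
  let _ : NormedAddCommGroup M := c.toNormedAddCommGroup
  let _ : InnerProductSpace ℂ M := InnerProductSpace.ofCore c.toCore
  have := h.finite
  have hdual : ∀ (g : G4) (w : M), ρ.dual g (innerₛₗ ℂ w) = innerₛₗ ℂ (ρ (star g⁻¹) w) := by
    intro g w
    ext x
    rw [Representation.dual_apply, Module.Dual.transpose_apply, LinearMap.comp_apply,
      innerₛₗ_apply_apply, innerₛₗ_apply_apply, hc.inner_right]
  refine ⟨innerₛₗ ℂ (ρ longElt v), ⟨fun u hu => ?_, fun t => ?_⟩, fun h0 => ?_, ?_⟩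
  · rw [hdual, ← Module.End.mul_apply, ← map_mul, mul_longElt, map_mul, Module.End.mul_apply,
      hv.mem.1]
    intro a b hab
    rw [longElt_mul_apply, Units.coe_star, Matrix.star_apply, hu.inv _ _ (Fin.rev_le_rev.2 hab)]
    simp [Matrix.one_apply, eq_comm]
  · have h1 : longElt * star (torus t)⁻¹ * longElt = torus (fun k => star (t k.rev)⁻¹) := by
      ext a b
      rw [longElt_mul_apply, ← map_inv, star_torus, coe_torus, coe_torus]
      simp [Matrix.diagonal_apply]
    have h2 : wchar μ (fun k => star (t k.rev)⁻¹) = star (wchar (fun k => -μ k.rev) t) := by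
      simp only [wchar, star_prod]
      refine Fintype.prod_equiv Fin.revPerm _ _ fun k => ?_
      simp
    rw [hdual, ← Module.End.mul_apply, ← map_mul, mul_longElt, map_mul, Module.End.mul_apply, h1,
      hv.mem.2, h2, map_smul]
    ext x
    simp
  · have h1 : ⟪ρ longElt v, ρ longElt v⟫_ℂ = 0 := LinearMap.congr_fun h0 _
    have h2 := congrArg (ρ longElt) (inner_self_eq_zero.1 h1)
    rw [← Module.End.mul_apply, ← map_mul, longElt_mul_self, map_one, map_zero] at h2
    exact hv.ne_zero h2
  · set S := Submodule.span ℂ (Set.range fun g => ρ.dual g (innerₛₗ ℂ (ρ longElt v)))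
    rw [← Subspace.dualCoannihilator_dualAnnihilator_eq (W := S)]
    have : S.dualCoannihilator = ⊥ := by
      rw [eq_bot_iff]
      intro x hx
      rw [Submodule.mem_dualCoannihilator] at hx
      have h1 : Submodule.span ℂ (Set.range fun g => ρ g v) ≤ LinearMap.ker (innerₛₗ ℂ x) := by
        rw [Submodule.span_le]
        rintro _ ⟨g, rfl⟩
        have h2 := hx _ (Submodule.subset_span ⟨(star (g * longElt))⁻¹, rfl⟩)
        simp only [hdual, inv_inv, star_star, innerₛₗ_apply_apply] at h2
        rw [← Module.End.mul_apply, ← map_mul, mul_assoc, longElt_mul_self, mul_one] at h2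
        simp only [SetLike.mem_coe, LinearMap.mem_ker, innerₛₗ_apply_apply]
        rw [← inner_conj_symm, h2, map_zero]
      rw [hv.span_eq] at h1
      exact inner_self_eq_zero.1 (h1 (x := x) trivial)
    rw [this, Submodule.dualAnnihilator_bot]

/-! ### Decomposition into irreducible representations -/

/-- A tame representation is the direct sum of irreducible ones, an irreducible representation of
highest weight `ν` occurring as often as there are independent highest weight vectors of weight
`ν`. -/
theorem IsTame.exists_decomposition (h : IsTame ρ) {I : Type} [DecidableEq I] (wt : I → Fin 4 → ℤ)
    (hwt : Function.Injective wt) (hall : ∀ μ, Antitone μ → ∃ i, wt i = μ)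
    (S : I → Type) [∀ i, AddCommGroup (S i)] [∀ i, Module ℂ (S i)]
    (σ : ∀ i, Representation ℂ G4 (S i)) (hσ : ∀ i, IsTame (σ i))
    (w : ∀ i, S i) (hw : ∀ i, IsHighest (σ i) (wt i) (w i)) :
    ∃ e : (DirectSum I fun i => Fin (Module.finrank ℂ (hwSpace ρ (wt i))) → S i) ≃ₗ[ℂ] M,
      ∀ g i (x : Fin (Module.finrank ℂ (hwSpace ρ (wt i))) → S i),
        e (DirectSum.lof ℂ I _ i fun k => σ i g (x k)) = ρ g (e (DirectSum.lof ℂ I _ i x)) := by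
  obtain ⟨c, hc⟩ := h.isStarRep
  let _ : NormedAddCommGroup M := c.toNormedAddCommGroup
  let _ : InnerProductSpace ℂ M := InnerProductSpace.ofCore c.toCore
  have := h.finite
  let b : ∀ i, OrthonormalBasis (Fin (Module.finrank ℂ (hwSpace ρ (wt i)))) ℂ (hwSpace ρ (wt i)) :=
    fun i => stdOrthonormalBasis ℂ (hwSpace ρ (wt i))
  have hf : ∀ i k, ∃ f : S i →ₗ[ℂ] M, Commutes (σ i) ρ f ∧ f (w i) = b i k := fun i k =>
    (hσ i).exists_commutes h (hw i).mem (hw i).ne_zero (b i k).2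
  choose f hfc hfw using hf
  have hinj : ∀ i k, Function.Injective (f i k) := fun i k =>
    (hσ i).injective_of_commutes (hw i) (hfc i k) (by
      rw [hfw]
      exact fun h0 => (b i).orthonormal.ne_zero k (Subtype.ext h0))
  -- the images of the summands are orthogonal, because the highest weight vectors are
  have horth : ∀ i k i' k', (⟨i, k⟩ : Sigma fun i => Fin (Module.finrank ℂ (hwSpace ρ (wt i)))) ≠
      ⟨i', k'⟩ → ∀ x y, ⟪f i k x, f i' k' y⟫_ℂ = 0 := by
    intro i k i' k' hne x y
    have h0 : ⟪(b i k : M), (b i' k' : M)⟫_ℂ = 0 := by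
      by_cases hi : i = i'
      · subst hi
        exact (b i).orthonormal.2 fun hk => hne (by rw [hk])
      · exact hc.inner_eq_zero (b i' k').2 (b i k).2 fun h => hi (hwt h.symm)
    have h1 : ∀ g g', ⟪f i k (σ i g (w i)), f i' k' (σ i' g' (w i'))⟫_ℂ = 0 := by
      intro g g'
      rw [hfc, hfc, hfw, hfw, hc.inner_both]
      exact hc.inner_orbit_eq_zero (b i' k').2 (b i k).2 h0 _
    have hx : x ∈ Submodule.span ℂ (Set.range fun g => σ i g (w i)) := by
      rw [(hw i).span_eq]; trivial
    have hy : y ∈ Submodule.span ℂ (Set.range fun g => σ i' g (w i')) := by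
      rw [(hw i').span_eq]; trivial
    induction hx using Submodule.span_induction with
    | zero => simp
    | add a a' _ _ ha ha' => rw [map_add, inner_add_left, ha, ha', add_zero]
    | smul r a _ ha => rw [map_smul, inner_smul_left, ha, mul_zero]
    | mem a ha =>
      obtain ⟨g, rfl⟩ := ha
      induction hy using Submodule.span_induction with
      | zero => simp
      | add a a' _ _ ha ha' => rw [map_add, inner_add_right, ha, ha', add_zero]
      | smul r a _ ha => rw [map_smul, inner_smul_right, ha, mul_zero]
      | mem a ha => obtain ⟨g', rfl⟩ := ha; exact h1 g g'
  let e₀ : (DirectSum I fun i => Fin (Module.finrank ℂ (hwSpace ρ (wt i))) → S i) →ₗ[ℂ] M :=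
    DirectSum.toModule ℂ I M fun i => ∑ k, f i k ∘ₗ LinearMap.proj k
  have he₀ : ∀ i x, e₀ (DirectSum.lof ℂ I _ i x) = ∑ k, f i k (x k) := by
    intro i x; simp [e₀]
  have hcomp : ∀ i k y x, ⟪f i k y, e₀ x⟫_ℂ = ⟪f i k y, f i k (x i k)⟫_ℂ := by
    intro i k y x
    induction x using DirectSum.induction_on with
    | zero => simp
    | add a a' ha ha' => rw [map_add, inner_add_right, ha, ha', DirectSum.add_apply, Pi.add_apply,
        map_add, inner_add_right]
    | of i' a =>
      have h1 : DirectSum.of (fun i => Fin (Module.finrank ℂ (hwSpace ρ (wt i))) → S i) i' a =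
        DirectSum.lof ℂ I _ i' a := rfl
      rw [h1, he₀, inner_sum]
      by_cases hi : i = i'
      · subst hi
        rw [DirectSum.lof_apply, Finset.sum_eq_single k]
        · intro k' _ hk
          exact horth _ _ _ _ (fun h => hk (by simpa [eq_comm] using h)) _ _
        · simp
      · rw [← h1, DirectSum.of_eq_of_ne _ _ _ hi, Pi.zero_apply, map_zero, inner_zero_right]
        exact Finset.sum_eq_zero fun k' _ => horth _ _ _ _
          (fun h => hi (congrArg Sigma.fst h)) _ _
  have hinj₀ : Function.Injective e₀ := by
    rw [← LinearMap.ker_eq_bot, eq_bot_iff]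
    intro x hx
    rw [LinearMap.mem_ker] at hx
    refine DFinsupp.ext fun i => funext fun k => hinj i k ?_
    have h1 := hcomp i k (x i k) x
    rw [hx, inner_zero_right] at h1
    rw [inner_self_eq_zero.1 h1.symm]
    simp
  have hinv : ∀ g x, ∃ y, ρ g (e₀ x) = e₀ y := by
    intro g x
    induction x using DirectSum.induction_on with
    | zero => exact ⟨0, by simp⟩
    | add a a' ha ha' =>
      obtain ⟨y, hy⟩ := ha
      obtain ⟨y', hy'⟩ := ha'
      exact ⟨y + y', by rw [map_add, map_add, hy, hy', map_add]⟩
    | of i a =>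
      refine ⟨DirectSum.lof ℂ I _ i fun k => σ i g (a k), ?_⟩
      rw [he₀]
      refine (congrArg (ρ g) (he₀ i a)).trans ?_
      rw [map_sum]
      exact Finset.sum_congr rfl fun k _ => (hfc i k g (a k)).symm
  have hsurj : LinearMap.range e₀ = ⊤ := by
    rw [← Submodule.orthogonal_eq_bot_iff]
    by_contra hne
    obtain ⟨ν, y, hy, hy0, hyν⟩ := h.exists_hw _ (hc.orthogonal_invariant (by
      rintro g _ ⟨x, rfl⟩
      obtain ⟨z, hz⟩ := hinv g x
      exact ⟨z, hz.symm⟩)) hne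
    obtain ⟨i, rfl⟩ := hall ν (h.dominant hyν hy0)
    have hmem : y ∈ LinearMap.range e₀ := by
      have h1 := (b i).sum_repr ⟨y, hyν⟩
      have h2 : y = ∑ k, (b i).repr ⟨y, hyν⟩ k • (b i k : M) := by
        conv_lhs => rw [show y = ((⟨y, hyν⟩ : hwSpace ρ (wt i)) : M) from rfl, ← h1]
        simp
      rw [h2]
      refine Submodule.sum_mem _ fun k _ => Submodule.smul_mem _ _
        ⟨DirectSum.lof ℂ I _ i (Pi.single k (w i)), ?_⟩
      rw [he₀, Finset.sum_eq_single k, Pi.single_eq_same, hfw]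
      · intro k' _ hk
        rw [Pi.single_eq_of_ne hk, map_zero]
      · simp
    exact hy0 (inner_self_eq_zero.1 ((Submodule.mem_orthogonal _ _).1 hy _ hmem))
  refine ⟨LinearEquiv.ofBijective e₀ ⟨hinj₀, LinearMap.range_eq_top.1 hsurj⟩, fun g i x => ?_⟩
  refine (he₀ i _).trans ?_
  refine Eq.trans ?_ (congrArg (ρ g) (he₀ i x)).symm
  rw [map_sum]
  exact Finset.sum_congr rfl fun k _ => hfc i k g (x k)

end Tame

/-! ### Constructions of tame representations -/

section Closure

variable {M N : Type} [AddCommGroup M] [Module ℂ M] [AddCommGroup N] [Module ℂ N]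
  {ρ : Representation ℂ G4 M} {ρ' : Representation ℂ G4 N}

theorem IsTame.of_equiv (h : IsTame ρ) (e : M ≃ₗ[ℂ] N) (he : Commutes ρ ρ' e.toLinearMap) :
    IsTame ρ' := by
  obtain ⟨ι, _, b, wt, hs, ht, hc⟩ := h.exists_basis
  have he' : ∀ g x, ρ' g (e x) = e (ρ g x) := fun g x => (he g x).symm
  refine ⟨ι, inferInstance, b.map e, wt, fun g i j => ?_, fun t i => ?_, fun i j => ?_⟩
  · simpa [he'] using hs g i j
  · simp [he', ht]
  · simpa [he'] using hc i j

theorem IsTame.tprod (h : IsTame ρ) (h' : IsTame ρ') : IsTame (ρ.tprod ρ') := by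
  obtain ⟨ι, _, b, wt, hs, ht, hc⟩ := h.exists_basis
  obtain ⟨ι', _, b', wt', hs', ht', hc'⟩ := h'.exists_basis
  refine ⟨ι × ι', inferInstance, b.tensorProduct b', fun i => wt i.1 + wt' i.2,
    fun g ⟨i, i'⟩ ⟨j, j'⟩ => ?_, fun t i => ?_, fun ⟨i, i'⟩ ⟨j, j'⟩ => ?_⟩
  · simp only [Module.Basis.tensorProduct_apply', Representation.tprod_apply,
      TensorProduct.map_tmul, Module.Basis.tensorProduct_repr_tmul_apply, smul_eq_mul, hs g,
      hs' g, star_mul']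
  · simp only [Module.Basis.tensorProduct_apply', Representation.tprod_apply,
      TensorProduct.map_tmul, ht, ht', TensorProduct.smul_tmul_smul, wchar_add]
  · simp only [Module.Basis.tensorProduct_apply', Representation.tprod_apply,
      TensorProduct.map_tmul, Module.Basis.tensorProduct_repr_tmul_apply, smul_eq_mul]
    exact (hc' _ _).mul (hc _ _)

theorem IsTame.dual (h : IsTame ρ) : IsTame ρ.dual := by
  classical
  obtain ⟨ι, _, b, wt, hs, ht, hc⟩ := h.exists_basis
  have hrepr : ∀ g i j, b.dualBasis.repr (ρ.dual g (b.dualBasis j)) i =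
      b.repr (ρ g⁻¹ (b i)) j := by
    intro g i j
    simp [Module.Basis.dualBasis_repr, Module.Dual.transpose_apply]
  refine ⟨ι, inferInstance, b.dualBasis, fun i => -wt i, fun g i j => ?_, fun t i => ?_,
    fun i j => ?_⟩
  · rw [hrepr, hrepr, ← star_inv, hs]
  · refine b.dualBasis.ext_elem fun j => ?_
    rw [hrepr, ← map_inv, ht, wchar_inv, wchar_neg]
    rcases eq_or_ne i j with rfl | hij
    · simp
    · simp [hij]
  · simp only [hrepr]
    exact (hc j i).comp continuous_inv

theorem IsTame.linHom (h : IsTame ρ) (h' : IsTame ρ') : IsTame (ρ.linHom ρ') := by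
  have := h.finite
  have := h'.finite
  refine (h.dual.tprod h').of_equiv (dualTensorHomEquiv ℂ M N) fun g x => ?_
  have := LinearMap.congr_fun (Representation.dualTensorHom_comm ρ ρ' g) x
  simpa using this

/-- A subrepresentation of a tame representation is tame: an orthonormal basis of eigenvectors of
the self-adjoint operator `diag(7,5,3,2)` consists of weight vectors. -/
theorem IsTame.subrepresentation (h : IsTame ρ) (W : Submodule ℂ M)
    (hW : ∀ g, W ≤ W.comap (ρ g)) : IsTame (ρ.subrepresentation W hW) := by
  obtain ⟨ι, _, b, wt, -, ht, -⟩ := h.exists_basis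
  obtain ⟨c, hc⟩ := h.isStarRep
  let _ : NormedAddCommGroup M := c.toNormedAddCommGroup
  let _ : InnerProductSpace ℂ M := InnerProductSpace.ofCore c.toCore
  have := h.finite
  have hsub : ∀ g (x : W), (ρ.subrepresentation W hW g x : M) = ρ g x := fun g x => rfl
  have hreal : star primeTorus = primeTorus := by
    funext k; ext; fin_cases k <;> simp [primeTorus]
  have hsymm : (ρ.subrepresentation W hW (torus primeTorus)).IsSymmetric := by
    intro x y
    rw [Submodule.coe_inner, Submodule.coe_inner, hsub, hsub, hc.inner_left, star_torus, hreal]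
  have htorus : ∀ t x i, b.repr (ρ (torus t) x) i = wchar (wt i) t * b.repr x i := by
    intro t x i
    refine (dual_apply_eq_sum b (b.coord i ∘ₗ ρ (torus t)) x).trans ?_
    rw [Finset.sum_eq_single i]
    · simp [ht, mul_comm]
    · intro j _ hj; simp [ht, hj.symm]
    · simp
  set e := hsymm.eigenvectorBasis rfl with he
  -- eigenvectors of `diag(7,5,3,2)` are weight vectors
  have hwt : ∀ i, ∃ μ, ∀ t, ρ (torus t) (e i) = wchar μ t • (e i : M) := by
    intro i
    have h1 : ρ (torus primeTorus) (e i) = (hsymm.eigenvalues rfl i : ℂ) • (e i : M) :=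
      congrArg Subtype.val (hsymm.apply_eigenvectorBasis rfl i)
    have h2 : ∀ j, b.repr (e i : M) j ≠ 0 →
        (primeValue (wt j) : ℂ) = (hsymm.eigenvalues rfl i : ℂ) := by
      intro j hj
      have h3 := congrArg (fun x => b.repr x j) h1
      simp only [htorus, wchar_primeTorus, map_smul, Finsupp.smul_apply, smul_eq_mul] at h3
      exact mul_right_cancel₀ hj h3
    have h0 : (e i : M) ≠ 0 := fun h0 => e.orthonormal.ne_zero i (Subtype.ext h0)
    obtain ⟨j, hj⟩ : ∃ j, b.repr (e i : M) j ≠ 0 := by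
      by_contra hall
      push Not at hall
      exact h0 (b.ext_elem fun j => by simp [hall])
    refine ⟨wt j, fun t => b.ext_elem fun k => ?_⟩
    rw [htorus, map_smul, Finsupp.smul_apply, smul_eq_mul]
    by_cases hk : b.repr (e i : M) k = 0
    · rw [hk, mul_zero, mul_zero]
    · have h4 := (h2 k hk).trans (h2 j hj).symm
      rw [show wt k = wt j from primeValue_injective (by exact_mod_cast h4)]
  choose wt' hwt' using hwt
  have hcoef : ∀ g i j, e.toBasis.repr (ρ.subrepresentation W hW g (e.toBasis j)) i =
      ⟪(e i : M), ρ g (e j)⟫_ℂ := by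
    intro g i j
    rw [OrthonormalBasis.coe_toBasis_repr_apply, OrthonormalBasis.repr_apply_apply,
      OrthonormalBasis.coe_toBasis, Submodule.coe_inner, hsub]
  refine ⟨_, inferInstance, e.toBasis, wt', fun g i j => ?_, fun t i => ?_, fun i j => ?_⟩
  · rw [hcoef, hcoef, hc.inner_right, star_star, RCLike.star_def, inner_conj_symm]
  · apply Subtype.ext
    rw [hsub, OrthonormalBasis.coe_toBasis, hwt']
    rfl
  · simp only [hcoef]
    exact hc.continuous_inner _ _

/-- The representation is one-dimensional, and `g` acts on it by `det(g) ^ k`. -/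
structure IsDetPow (ρ : Representation ℂ G4 M) (k : ℤ) : Prop where
  finrank_eq : Module.finrank ℂ M = 1
  apply_eq : ∀ g x, ρ g x = (g : Matrix (Fin 4) (Fin 4) ℂ).det ^ k • x

theorem det_ne_zero' (g : G4) : (g : Matrix (Fin 4) (Fin 4) ℂ).det ≠ 0 :=
  ((Matrix.isUnit_iff_isUnit_det _).1 g.isUnit).ne_zero

theorem det_inv' (g : G4) : ((g⁻¹ : G4) : Matrix (Fin 4) (Fin 4) ℂ).det =
    (g : Matrix (Fin 4) (Fin 4) ℂ).det⁻¹ := by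
  rw [Matrix.coe_units_inv, Matrix.det_nonsing_inv, Ring.inverse_eq_inv']

theorem IsUnitri.det {u : G4} (h : IsUnitri u) : (u : Matrix (Fin 4) (Fin 4) ℂ).det = 1 := by
  rw [Matrix.det_of_isUpperTriangular]
  · exact Finset.prod_eq_one fun i _ => by rw [h i i le_rfl, Matrix.one_apply_eq]
  · intro i j hij
    rw [h i j (le_of_lt hij)]
    exact Matrix.one_apply_ne (ne_of_gt hij)

theorem det_torus_zpow (t : Fin 4 → ℂˣ) (k : ℤ) :
    (torus t : Matrix (Fin 4) (Fin 4) ℂ).det ^ k = wchar (fun _ => k) t := by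
  rw [coe_torus, Matrix.det_diagonal, wchar, Finset.prod_zpow]

theorem IsDetPow.tprod {k l : ℤ} (h : IsDetPow ρ k) (h' : IsDetPow ρ' l) :
    IsDetPow (ρ.tprod ρ') (k + l) := by
  refine ⟨by rw [Module.finrank_tensorProduct, h.finrank_eq, h'.finrank_eq], fun g x => ?_⟩
  induction x with
  | zero => simp
  | add x y hx hy => rw [map_add, hx, hy, smul_add]
  | tmul x y =>
    rw [Representation.tprod_apply, TensorProduct.map_tmul, h.apply_eq, h'.apply_eq,
      TensorProduct.smul_tmul_smul, zpow_add₀ (det_ne_zero' g)]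

theorem IsDetPow.dual {k : ℤ} (h : IsDetPow ρ k) : IsDetPow ρ.dual (-k) := by
  refine ⟨by rw [Subspace.dual_finrank_eq, h.finrank_eq], fun g ξ => ?_⟩
  ext x
  rw [Representation.dual_apply, Module.Dual.transpose_apply, LinearMap.comp_apply, h.apply_eq,
    map_smul, LinearMap.smul_apply, det_inv', _root_.inv_zpow, _root_.zpow_neg]

theorem IsDetPow.isTame {k : ℤ} (h : IsDetPow ρ k) : IsTame ρ := by
  have := Module.finite_of_finrank_eq_succ h.finrank_eq
  let b := Module.finBasisOfFinrankEq ℂ M h.finrank_eq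
  have hb : ∀ g i j, b.repr (ρ g (b j)) i = (g : Matrix (Fin 4) (Fin 4) ℂ).det ^ k := by
    intro g i j
    rw [h.apply_eq, Subsingleton.elim i j]
    simp
  refine ⟨Fin 1, inferInstance, b, fun _ _ => k, fun g i j => ?_, fun t i => ?_, fun i j => ?_⟩
  · rw [hb, hb, Units.coe_star, Matrix.star_eq_conjTranspose, Matrix.det_conjTranspose,
      star_zpow₀]
  · rw [h.apply_eq, det_torus_zpow]
  · simp only [hb]
    exact (Units.continuous_val.matrix_det).zpow₀ k fun g => Or.inl (det_ne_zero' g)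

/-- Tensoring with a power of the determinant translates highest weights. -/
theorem IsDetPow.tmul_mem_hwSpace {k : ℤ} (h : IsDetPow ρ' k) {μ : Fin 4 → ℤ} {v : M}
    (hv : v ∈ hwSpace ρ μ) (ℓ : N) : v ⊗ₜ[ℂ] ℓ ∈ hwSpace (ρ.tprod ρ') (μ + fun _ => k) := by
  refine ⟨fun u hu => ?_, fun t => ?_⟩
  · rw [Representation.tprod_apply, TensorProduct.map_tmul, hv.1 u hu, h.apply_eq, hu.det,
      _root_.one_zpow, one_smul]
  · rw [Representation.tprod_apply, TensorProduct.map_tmul, hv.2, h.apply_eq, det_torus_zpow,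
      TensorProduct.smul_tmul_smul, wchar_add]

theorem tmul_mem_hwSpace {μ ν : Fin 4 → ℤ} {v : M} {w : N}
    (hv : v ∈ hwSpace ρ μ) (hw : w ∈ hwSpace ρ' ν) :
    v ⊗ₜ[ℂ] w ∈ hwSpace (ρ.tprod ρ') (μ + ν) := by
  refine ⟨fun u hu => ?_, fun t => ?_⟩
  · rw [Representation.tprod_apply, TensorProduct.map_tmul, hv.1 u hu, hw.1 u hu]
  · rw [Representation.tprod_apply, TensorProduct.map_tmul, hv.2, hw.2,
      TensorProduct.smul_tmul_smul, wchar_add]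

/-- Tensoring with a nonzero vector `ℓ` of a one-dimensional representation changes the action only
by scalars. -/
theorem IsDetPow.exists_equiv {k : ℤ} (h : IsDetPow ρ' k) :
    ∃ (ℓ : N) (e : M ≃ₗ[ℂ] M ⊗[ℂ] N), ℓ ≠ 0 ∧ (∀ x, e x = x ⊗ₜ ℓ) ∧
      ∀ g x, ρ.tprod ρ' g (e x) = (g : Matrix (Fin 4) (Fin 4) ℂ).det ^ k • e (ρ g x) := by
  have := Module.finite_of_finrank_eq_succ h.finrank_eq
  let b := Module.finBasisOfFinrankEq ℂ N h.finrank_eq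
  let e₁ : N ≃ₗ[ℂ] ℂ := b.equivFun.trans (LinearEquiv.funUnique (Fin 1) ℂ ℂ)
  have he₁ : e₁.symm 1 = b 0 := by
    rw [LinearEquiv.symm_apply_eq]
    simp [e₁]
  have he : ∀ x : M, ((TensorProduct.rid ℂ M).symm.trans
      (TensorProduct.congr (LinearEquiv.refl ℂ M) e₁.symm)) x = x ⊗ₜ b 0 := by
    intro x; simp [he₁]
  refine ⟨b 0, _, b.ne_zero 0, he, fun g x => ?_⟩
  rw [he, he, Representation.tprod_apply, TensorProduct.map_tmul, h.apply_eq,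
    TensorProduct.tmul_smul]

theorem IsHighest.tprod_isDetPow {μ : Fin 4 → ℤ} {v : M} (hv : IsHighest ρ μ v) {k : ℤ}
    (h : IsDetPow ρ' k) : ∃ w, IsHighest (ρ.tprod ρ') (μ + fun _ => k) w := by
  obtain ⟨ℓ, e, hℓ, he, heg⟩ := h.exists_equiv (ρ := ρ)
  refine ⟨e v, he v ▸ h.tmul_mem_hwSpace hv.mem ℓ, fun h0 => hv.ne_zero (by simpa using h0), ?_⟩
  rw [eq_top_iff, ← LinearEquiv.range e, LinearMap.range_eq_map, ← hv.span_eq,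
    Submodule.map_span, Submodule.span_le]
  rintro _ ⟨_, ⟨g, rfl⟩, rfl⟩
  have h1 := heg g v
  have h2 : e (ρ g v) = ((g : Matrix (Fin 4) (Fin 4) ℂ).det ^ k)⁻¹ • ρ.tprod ρ' g (e v) := by
    rw [h1, smul_smul, inv_mul_cancel₀ (zpow_ne_zero _ (det_ne_zero' g)), one_smul]
  simp only [LinearEquiv.coe_coe]
  rw [h2]
  exact Submodule.smul_mem _ _ (Submodule.subset_span ⟨g, rfl⟩)

theorem IsDetPow.finrank_hwSpace {k : ℤ} (h : IsDetPow ρ' k) (μ : Fin 4 → ℤ) :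
    Module.finrank ℂ (hwSpace (ρ.tprod ρ') (μ + fun _ => k)) =
      Module.finrank ℂ (hwSpace ρ μ) := by
  obtain ⟨ℓ, e, hℓ, he, heg⟩ := h.exists_equiv (ρ := ρ)
  symm
  refine (LinearEquiv.ofSubmodules e _ _ ?_).finrank_eq
  ext y
  constructor
  · rintro ⟨x, hx, rfl⟩
    change e x ∈ _
    rw [he]; exact h.tmul_mem_hwSpace hx ℓ
  · intro hy
    obtain ⟨x, rfl⟩ := e.surjective y
    refine ⟨x, ⟨fun u hu => e.injective ?_, fun t => e.injective ?_⟩, rfl⟩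
    · have := hy.1 u hu
      rwa [heg, hu.det, _root_.one_zpow, one_smul] at this
    · have := hy.2 t
      rw [heg, det_torus_zpow, wchar_add, mul_comm, mul_smul] at this
      rw [map_smul]
      exact smul_right_injective _ (wchar_ne_zero (fun _ => k) t) this

end Closure

/-! ### The representations on the values of functors -/

/-- Invertible matrices as automorphisms of `ℂ⁴`. -/
def stdEquiv : G4 ≃* ((Fin 4 → ℂ) ≃ₗ[ℂ] (Fin 4 → ℂ)) :=
  Matrix.GeneralLinearGroup.toLin.trans (LinearMap.GeneralLinearGroup.generalLinearEquiv ℂ _)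

/-- The standard representation on `ℂ⁴`. -/
def stdRep : Representation ℂ G4 (Fin 4 → ℂ) where
  toFun g := (stdEquiv g).toLinearMap
  map_one' := by rw [map_one]; rfl
  map_mul' g g' := by rw [map_mul]; rfl

theorem stdRep_apply (g : G4) (x : Fin 4 → ℂ) :
    stdRep g x = (g : Matrix (Fin 4) (Fin 4) ℂ).mulVec x := rfl

theorem isTame_stdRep : IsTame stdRep := by
  refine ⟨Fin 4, inferInstance, Pi.basisFun ℂ (Fin 4), fun i => Pi.single i 1,
    fun g i j => ?_, fun t i => ?_, fun i j => ?_⟩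
  · simp [stdRep_apply, Matrix.star_apply]
  · ext k
    simp only [stdRep_apply, coe_torus, Pi.basisFun_apply, Matrix.mulVec_diagonal, wchar,
      Pi.smul_apply, smul_eq_mul]
    rw [Finset.prod_eq_single i (by intro j _ hj; simp [hj]) (by simp)]
    by_cases hk : k = i
    · subst hk; simp
    · simp [hk]
  · simp only [stdRep_apply, Pi.basisFun_apply, Matrix.mulVec_single_one, Pi.basisFun_repr]
    exact Units.continuous_val.matrix_elem i j

namespace VectFunctor

/-- The representation of `GL₄(ℂ)` on `F(ℂ⁴)`. -/
def rep (F : VectFunctor) : Representation ℂ G4 (F.obj (Fin 4 → ℂ)) where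
  toFun g := (F.map (stdEquiv g)).toLinearMap
  map_one' := by
    rw [map_one]
    exact congrArg LinearEquiv.toLinearMap (F.map_refl _)
  map_mul' g g' := by
    rw [map_mul]
    exact congrArg LinearEquiv.toLinearMap (F.map_trans (stdEquiv g') (stdEquiv g))

theorem rep_apply (F : VectFunctor) (g : G4) (x : F.obj (Fin 4 → ℂ)) :
    F.rep g x = F.map (stdEquiv g) x := rfl

theorem map_symm (F : VectFunctor) {E E' : Type} [AddCommGroup E] [Module ℂ E] [AddCommGroup E']
    [Module ℂ E'] (e : E ≃ₗ[ℂ] E') : F.map e.symm = (F.map e).symm := by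
  ext x
  rw [LinearEquiv.eq_symm_apply, ← LinearEquiv.trans_apply, ← F.map_trans,
    LinearEquiv.symm_trans_self, F.map_refl]
  rfl

theorem rep_dual (F : VectFunctor) : F.dual.rep = F.rep.dual := by
  refine MonoidHom.ext fun g => LinearMap.ext fun (ξ : Module.Dual ℂ _) => LinearMap.ext fun x => ?_
  change ξ ((F.map (stdEquiv g)).symm x) = ξ (F.map (stdEquiv g⁻¹) x)
  rw [← F.map_symm, map_inv]
  rfl

/-- `F ⊗ F^∨` is the representation on endomorphisms by conjugation. -/
theorem finrank_hwSpace_endo (F : VectFunctor) (hF : IsTame F.rep) (μ : Fin 4 → ℤ) :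
    Module.finrank ℂ (hwSpace F.endo.rep μ) =
      Module.finrank ℂ (hwSpace (F.rep.linHom F.rep) μ) := by
  have := hF.finite
  let e : (F.obj (Fin 4 → ℂ) ⊗[ℂ] Module.Dual ℂ (F.obj (Fin 4 → ℂ))) ≃ₗ[ℂ]
      (F.obj (Fin 4 → ℂ) →ₗ[ℂ] F.obj (Fin 4 → ℂ)) :=
    (TensorProduct.comm ℂ _ _).trans (dualTensorHomEquiv ℂ _ _)
  have he : Commutes (F.rep.tprod F.rep.dual) (F.rep.linHom F.rep) e.toLinearMap := by
    intro g x
    induction x with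
    | zero => simp
    | add x y hx hy => rw [map_add, map_add, hx, hy, map_add, map_add]
    | tmul x ξ =>
      have := LinearMap.congr_fun (Representation.dualTensorHom_comm F.rep F.rep g) (ξ ⊗ₜ x)
      simpa [e] using this
  refine Commutes.finrank_hwSpace_eq (ρ := F.endo.rep) e (fun g x => ?_) μ
  have hd : F.dual.rep g = F.rep.dual g := congrArg (fun σ => σ g) F.rep_dual
  have hx : F.endo.rep g x = (F.rep.tprod F.rep.dual) g x :=
    congrArg (fun f => TensorProduct.map (F.rep g) f x) hd
  exact (congrArg e hx).trans (he g x)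

theorem isDetPow_trivial : IsDetPow trivial.rep 0 :=
  ⟨Module.finrank_self ℂ, fun g x => by rw [zpow_zero, one_smul]; rfl⟩

theorem isDetPow_det : IsDetPow det.rep 1 := by
  refine ⟨?_, fun g x => ?_⟩
  · change Module.finrank ℂ (⋀[ℂ]^4 (Fin 4 → ℂ)) = 1
    rw [exteriorPower.finrank_eq]
    simp
  · rw [zpow_one]
    change exteriorPower.map 4 (stdEquiv g).toLinearMap x = _
    have : exteriorPower.map 4 (stdEquiv g).toLinearMap =
        (g : Matrix (Fin 4) (Fin 4) ℂ).det • LinearMap.id := by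
      refine exteriorPower.linearMap_ext (AlternatingMap.ext fun v => ?_)
      rw [← sub_eq_zero, ← Module.forall_dual_apply_eq_zero_iff ℂ]
      intro ψ
      have h1 := (ψ.compAlternatingMap (exteriorPower.ιMulti ℂ 4)).eq_smul_basis_det
        (Pi.basisFun ℂ (Fin 4))
      have h2 : ∀ w, ψ (exteriorPower.ιMulti ℂ 4 w) =
          ψ (exteriorPower.ιMulti ℂ 4 (Pi.basisFun ℂ (Fin 4))) * (Pi.basisFun ℂ (Fin 4)).det w :=
        fun w => congrArg (fun f => f w) h1
      have h3 : LinearMap.det (stdEquiv g).toLinearMap =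
          (g : Matrix (Fin 4) (Fin 4) ℂ).det := LinearMap.det_toLin' _
      simp only [LinearMap.compAlternatingMap_apply, exteriorPower.map_apply_ιMulti,
        LinearMap.smul_apply, LinearMap.id_apply, map_sub, map_smul, smul_eq_mul]
      rw [h2 v, h2, Module.Basis.det_comp, h3]
      ring
    rw [this]; rfl

theorem isDetPow_detInv (d : ℕ) : IsDetPow (detInv d).rep (-(d : ℤ)) := by
  induction d with
  | zero => exact isDetPow_trivial
  | succ d ih =>
    have h : IsDetPow det.dual.rep (-1) := by rw [rep_dual]; exact isDetPow_det.dual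
    have := ih.tprod h
    rw [show -((d + 1 : ℕ) : ℤ) = -(d : ℤ) + -1 by push_cast; ring]
    exact this

/-- Multiplicities are dimensions of spaces of equivariant maps. -/
theorem mult_eq (F G : VectFunctor) : mult G F = Module.finrank ℂ (homSpace G.rep F.rep) := by
  have h : equivariantMaps G F = homSpace G.rep F.rep := by
    ext f
    constructor
    · intro hf g x; exact hf (stdEquiv g) x
    · intro hf g x
      have := hf (stdEquiv.symm g) x
      rwa [rep_apply, rep_apply, MulEquiv.apply_symm_apply] at this
  rw [mult, h]

end VectFunctor

/-! ### Schur functors give irreducible representations -/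

section Words

variable {B : Type} [Fintype B]

/-- The diagonal action of `GL₄(ℂ)` on tensors. -/
def piRep (B : Type) : Representation ℂ G4 (⨂[ℂ] _ : B, (Fin 4 → ℂ)) where
  toFun g := PiTensorProduct.map fun _ => stdRep g
  map_one' := by rw [map_one]; exact PiTensorProduct.map_id
  map_mul' g g' := by rw [map_mul]; exact PiTensorProduct.map_comp _ _

/-- The basis of tensors indexed by words `B → Fin 4`. -/
def wordBasis (B : Type) [Fintype B] : Module.Basis (B → Fin 4) ℂ (⨂[ℂ] _ : B, (Fin 4 → ℂ)) :=
  Basis.piTensorProduct fun _ => Pi.basisFun ℂ (Fin 4)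

theorem wordBasis_apply (I : B → Fin 4) :
    wordBasis B I = PiTensorProduct.tprod ℂ fun b => (Pi.single (I b) 1 : Fin 4 → ℂ) := by
  simp [wordBasis]

theorem piRep_repr (g : G4) (I J : B → Fin 4) :
    (wordBasis B).repr (piRep B g (wordBasis B J)) I =
      ∏ b, (g : Matrix (Fin 4) (Fin 4) ℂ) (I b) (J b) := by
  rw [wordBasis_apply]
  change (wordBasis B).repr (PiTensorProduct.map _ (PiTensorProduct.tprod ℂ _)) I = _
  rw [PiTensorProduct.map_tprod, wordBasis, Basis.piTensorProduct_repr_tprod_apply]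
  simp [stdRep_apply]

/-- The weight of a word: the number of times each letter occurs. -/
def wordWt (I : B → Fin 4) : Fin 4 → ℤ := fun k => ∑ b, if I b = k then 1 else 0

theorem wchar_wordWt (I : B → Fin 4) (t : Fin 4 → ℂˣ) :
    wchar (wordWt I) t = ∏ b, (t (I b) : ℂ) := by
  have h : ∀ (k : Fin 4) (s : Finset B), (t k : ℂ) ^ (∑ b ∈ s, if I b = k then (1 : ℤ) else 0) =
      ∏ b ∈ s, if I b = k then (t k : ℂ) else 1 := by
    classical
    intro k s
    induction s using Finset.induction_on with
    | empty => simp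
    | insert a s ha ih =>
      rw [Finset.sum_insert ha, Finset.prod_insert ha, zpow_add₀ (t k).ne_zero, ih]
      split_ifs <;> simp
  simp only [wchar, wordWt, h]
  rw [Finset.prod_comm]
  simp

theorem piRep_torus (t : Fin 4 → ℂˣ) (I : B → Fin 4) :
    piRep B (torus t) (wordBasis B I) = wchar (wordWt I) t • wordBasis B I := by
  refine (wordBasis B).ext_elem fun J => ?_
  rw [piRep_repr, map_smul, Finsupp.smul_apply, Module.Basis.repr_self, wchar_wordWt]
  by_cases h : I = J
  · subst h; simp
  · rw [Finsupp.single_eq_of_ne (Ne.symm h), smul_zero]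
    obtain ⟨b, hb⟩ := Function.ne_iff.1 h
    exact Finset.prod_eq_zero (Finset.mem_univ b) (by simp [Ne.symm hb])

theorem piRep_star (g : G4) (I J : B → Fin 4) :
    (wordBasis B).repr (piRep B (star g) (wordBasis B J)) I =
      star ((wordBasis B).repr (piRep B g (wordBasis B I)) J) := by
  rw [piRep_repr, piRep_repr, star_prod]
  rfl

theorem isTame_piRep : IsTame (piRep B) := by
  classical
  refine ⟨B → Fin 4, inferInstance, wordBasis B, wordWt, piRep_star, piRep_torus, fun I J => ?_⟩
  simp only [piRep_repr]
  exact continuous_finsetProd _ fun b _ => Units.continuous_val.matrix_elem _ _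

theorem piRep_torus_repr (t : Fin 4 → ℂˣ) (w : ⨂[ℂ] _ : B, (Fin 4 → ℂ)) (I : B → Fin 4) :
    (wordBasis B).repr (piRep B (torus t) w) I = wchar (wordWt I) t * (wordBasis B).repr w I := by
  classical
  refine (dual_apply_eq_sum (wordBasis B) ((wordBasis B).coord I ∘ₗ piRep B (torus t)) w).trans ?_
  rw [Finset.sum_eq_single I]
  · simp [piRep_torus, mul_comm]
  · intro j _ hj; simp [piRep_torus, hj.symm]
  · simp

theorem wordWt_eq_of_mem {ν : Fin 4 → ℤ} {w : ⨂[ℂ] _ : B, (Fin 4 → ℂ)}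
    (hw : ∀ t, piRep B (torus t) w = wchar ν t • w) {I : B → Fin 4}
    (hI : (wordBasis B).repr w I ≠ 0) : wordWt I = ν := by
  classical
  refine wchar_injective fun t => ?_
  have h1 := congrArg (fun x => (wordBasis B).repr x I) (hw t)
  simp only [map_smul, Finsupp.smul_apply, smul_eq_mul] at h1
  rw [piRep_torus_repr] at h1
  exact mul_right_cancel₀ hI h1

/-- Words with the same letters in each row differ by a permutation that preserves the rows. -/
theorem exists_perm_of_fibers (r : B → Fin 4) (I J : B → Fin 4)
    (h : ∀ i j, ∑ b, (if (I b, r b) = (i, j) then 1 else 0 : ℕ) =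
      ∑ b, (if (J b, r b) = (i, j) then 1 else 0)) :
    ∃ p : Equiv.Perm B, (∀ b, r (p b) = r b) ∧ ∀ b, I (p b) = J b := by
  classical
  have h1 : ∀ c : Fin 4 × Fin 4, Nonempty ({b // (J b, r b) = c} ≃ {b // (I b, r b) = c}) := by
    rintro ⟨i, j⟩
    refine ⟨Fintype.equivOfCardEq ?_⟩
    rw [Fintype.card_subtype, Fintype.card_subtype, Finset.card_filter, Finset.card_filter]
    exact (h i j).symm
  let p := Equiv.ofFiberEquiv (f := fun b => (J b, r b)) (g := fun b => (I b, r b))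
    fun c => Classical.choice (h1 c)
  have hp : ∀ b, (I (p b), r (p b)) = (J b, r b) := fun b =>
    Equiv.ofFiberEquiv_map (f := fun b => (J b, r b)) (g := fun b => (I b, r b)) _ b
  exact ⟨p, fun b => (Prod.mk.inj (hp b)).2, fun b => (Prod.mk.inj (hp b)).1⟩

/-- Polarization: a tensor that is symmetric within each of the four rows `r⁻¹(j)` and orthogonal
to all tensors `⨂ g e_{r(b)}` vanishes. -/
theorem eq_zero_of_rowSymmetric [DecidableEq B] (r : B → Fin 4) (c : (B → Fin 4) → ℂ)
    (hc : ∀ p : Equiv.Perm B, (∀ b, r (p b) = r b) → ∀ I, c (I ∘ p) = c I)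
    (h : ∀ g : G4, ∑ I, c I * ∏ b, (g : Matrix (Fin 4) (Fin 4) ℂ) (I b) (r b) = 0) : c = 0 := by
  let m : (B → Fin 4) → (Fin 4 × Fin 4 →₀ ℕ) := fun I => ∑ b, Finsupp.single (I b, r b) 1
  let P : MvPolynomial (Fin 4 × Fin 4) ℂ := ∑ I, MvPolynomial.monomial (m I) (c I)
  have hm : ∀ (x : Fin 4 × Fin 4 → ℂ) I, (m I).prod (fun i k => x i ^ k) = ∏ b, x (I b, r b) := by
    intro x I
    rw [← Finsupp.prod_finsetSum_index (by simp) (fun a b₁ b₂ => pow_add _ _ _)]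
    simp
  have hP0 : P = 0 := by
    have h1 : P * (Matrix.mvPolynomialX (Fin 4) (Fin 4) ℂ).det = 0 := by
      refine MvPolynomial.funext fun x => ?_
      have hX : (Matrix.mvPolynomialX (Fin 4) (Fin 4) ℂ).map (MvPolynomial.eval x) =
          Matrix.of fun i j => x (i, j) := by
        ext i j
        simp
      rw [map_mul, map_zero, RingHom.map_det, RingHom.mapMatrix_apply, hX]
      by_cases hdet : (Matrix.of fun i j => x (i, j)).det = 0
      · rw [hdet, mul_zero]
      · have h2 := h (Matrix.GeneralLinearGroup.mkOfDetNeZero _ hdet)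
        have h3 : MvPolynomial.eval x P = ∑ I, c I * ∏ b, x (I b, r b) := by
          simp only [P, map_sum, MvPolynomial.eval_monomial, hm]
        rw [h3, show ∑ I, c I * ∏ b, x (I b, r b) = 0 from h2, zero_mul]
    exact (mul_eq_zero.1 h1).resolve_right (Matrix.det_mvPolynomialX_ne_zero _ _)
  funext I
  have h1 := congrArg (MvPolynomial.coeff (m I)) hP0
  simp only [P, MvPolynomial.coeff_sum, MvPolynomial.coeff_monomial, MvPolynomial.coeff_zero] at h1
  have h2 : ∀ J, m J = m I → c J = c I := by
    intro J hJ
    obtain ⟨p, hp, hpI⟩ := exists_perm_of_fibers r I J fun i j => by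
      have := DFunLike.congr_fun hJ (i, j)
      simp only [m, Finsupp.finsetSum_apply, Finsupp.single_apply] at this
      exact this.symm
    rw [← hc p hp I]
    congr 1
    exact funext fun b => (hpI b).symm
  rw [← Finset.sum_filter, Finset.sum_congr rfl fun J hJ => h2 J (Finset.mem_filter.1 hJ).2,
    Finset.sum_const, nsmul_eq_mul] at h1
  refine (mul_eq_zero.1 h1).resolve_left ?_
  exact Nat.cast_ne_zero.2 (Finset.card_pos.2 ⟨I, by simp⟩).ne'

end Words

section Young

variable (κ : Fin 4 → ℕ)

theorem permuteFactors_repr (σ : Equiv.Perm (Boxes κ)) (x : ⨂[ℂ] _ : Boxes κ, (Fin 4 → ℂ))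
    (I : Boxes κ → Fin 4) :
    (wordBasis (Boxes κ)).repr (permuteFactors κ _ σ x) I =
      (wordBasis (Boxes κ)).repr x (I ∘ σ) := by
  classical
  have : (wordBasis (Boxes κ)).coord I ∘ₗ permuteFactors κ _ σ =
      (wordBasis (Boxes κ)).coord (I ∘ σ) := by
    refine (wordBasis (Boxes κ)).ext fun J => ?_
    have h1 : permuteFactors κ _ σ (wordBasis (Boxes κ) J) =
        wordBasis (Boxes κ) (J ∘ σ.symm) := by
      rw [wordBasis_apply, wordBasis_apply]
      exact PiTensorProduct.reindex_tprod _ _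
    rw [LinearMap.comp_apply, h1, Module.Basis.coord_apply, Module.Basis.coord_apply,
      Module.Basis.repr_self, Module.Basis.repr_self, Finsupp.single_apply, Finsupp.single_apply]
    congr 1
    rw [eq_iff_iff]
    constructor
    · rintro rfl; ext b; simp
    · rintro rfl; ext b; simp
  exact LinearMap.congr_fun this x

open Classical in
theorem rowSymmetrizer_repr (x : ⨂[ℂ] _ : Boxes κ, (Fin 4 → ℂ)) (I : Boxes κ → Fin 4) :
    (wordBasis (Boxes κ)).repr (rowSymmetrizer κ _ x) I =
      ∑ p : Equiv.Perm (Boxes κ) with ∀ x, (p x).1 = x.1,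
        (wordBasis (Boxes κ)).repr x (I ∘ p) := by
  simp only [rowSymmetrizer, LinearMap.sum_apply, map_sum, Finsupp.finsetSum_apply,
    permuteFactors_repr]

open Classical in
theorem columnAntisymmetrizer_repr (x : ⨂[ℂ] _ : Boxes κ, (Fin 4 → ℂ)) (I : Boxes κ → Fin 4) :
    (wordBasis (Boxes κ)).repr (columnAntisymmetrizer κ _ x) I =
      ∑ q : Equiv.Perm (Boxes κ) with ∀ x, ((q x).2 : ℕ) = (x.2 : ℕ),
        ((Equiv.Perm.sign q : ℤ) : ℂ) * (wordBasis (Boxes κ)).repr x (I ∘ q) := by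
  simp only [columnAntisymmetrizer, LinearMap.sum_apply, LinearMap.smul_apply, map_sum, map_smul,
    Finsupp.finsetSum_apply, Finsupp.smul_apply, smul_eq_mul, permuteFactors_repr]

theorem columnAntisymmetrizer_repr_eq_zero (x : ⨂[ℂ] _ : Boxes κ, (Fin 4 → ℂ))
    (I : Boxes κ → Fin 4) {a b : Boxes κ} (hab : a ≠ b) (hcol : (a.2 : ℕ) = (b.2 : ℕ))
    (hI : I a = I b) : (wordBasis (Boxes κ)).repr (columnAntisymmetrizer κ _ x) I = 0 := by
  classical
  rw [columnAntisymmetrizer_repr]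
  have hIs : I ∘ Equiv.swap a b = I := by
    funext c
    simp only [Function.comp_apply, Equiv.swap_apply_def]
    split_ifs with h h' <;> simp [*]
  have hswap : ∀ c : Boxes κ, ((Equiv.swap a b c).2 : ℕ) = (c.2 : ℕ) := by
    intro c
    by_cases hca : c = a
    · rw [hca, Equiv.swap_apply_left, hcol]
    · by_cases hcb : c = b
      · rw [hcb, Equiv.swap_apply_right, hcol]
      · rw [Equiv.swap_apply_of_ne_of_ne hca hcb]
  -- left multiplication by the transposition pairs terms of opposite sign
  refine Finset.sum_involution (fun q _ => Equiv.swap a b * q) (fun q _ => ?_) (fun q _ _ h => ?_)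
    (fun q hq => ?_) (fun q _ => ?_)
  · have h1 : I ∘ ⇑(Equiv.swap a b * q) = I ∘ q := by
      rw [Equiv.Perm.coe_mul, ← Function.comp_assoc, hIs]
    rw [h1, Equiv.Perm.sign_mul, Equiv.Perm.sign_swap hab]
    simp
  · have h1 := congrArg Equiv.Perm.sign h
    rw [Equiv.Perm.sign_mul, Equiv.Perm.sign_swap hab] at h1
    rcases Int.units_eq_one_or (Equiv.Perm.sign q) with h2 | h2 <;> rw [h2] at h1 <;> simp at h1
  · simp only [Finset.mem_filter, Finset.mem_univ, true_and] at hq ⊢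
    intro c
    rw [Equiv.Perm.mul_apply, hswap, hq]
  · rw [← mul_assoc, Equiv.swap_mul_self, one_mul]

/-- A filling of a Young diagram with distinct letters in each column uses the letters `≤ k` at
most as often as there are boxes in the rows `≤ k`. -/
theorem card_le_of_injOn_columns (hκ : Antitone κ) (I : Boxes κ → Fin 4)
    (hI : ∀ a b : Boxes κ, (a.2 : ℕ) = (b.2 : ℕ) → I a = I b → a = b) (k : Fin 4) :
    (Finset.univ.filter fun b => I b ≤ k).card ≤
      (Finset.univ.filter fun b : Boxes κ => b.1 ≤ k).card := by
  classical
  have hmem : ∀ b : Boxes κ, (b.2 : ℕ) ∈ Finset.range (κ 0) := fun b =>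
    Finset.mem_range.2 (b.2.2.trans_le (hκ (Fin.zero_le _)))
  rw [Finset.card_eq_sum_card_fiberwise (f := fun b : Boxes κ => (b.2 : ℕ)) fun b _ => hmem b,
    Finset.card_eq_sum_card_fiberwise (f := fun b : Boxes κ => (b.2 : ℕ)) fun b _ => hmem b]
  refine Finset.sum_le_sum fun j _ => ?_
  by_cases hall : ∀ b : Boxes κ, (b.2 : ℕ) = j → b.1 ≤ k
  · refine Finset.card_le_card fun b hb => ?_
    simp only [Finset.mem_filter, Finset.mem_univ, true_and] at hb ⊢
    exact ⟨hall b hb.2, hb.2⟩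
  · push Not at hall
    obtain ⟨b₀, hb₀, hk⟩ := hall
    have h1 : ({b ∈ {b : Boxes κ | I b ≤ k} | (b.2 : ℕ) = j} : Finset (Boxes κ)).card ≤
        (Finset.univ.filter fun i : Fin 4 => i ≤ k).card := by
      refine Finset.card_le_card_of_injOn I (fun b hb => ?_) fun a ha b hb hab => ?_
      · simp only [Finset.coe_filter, Finset.mem_filter, Finset.mem_univ, true_and,
          Set.mem_ofPred_eq] at hb ⊢
        exact hb.1
      · simp only [Finset.coe_filter, Finset.mem_filter, Finset.mem_univ, true_and,
          Set.mem_ofPred_eq] at ha hb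
        exact hI a b (ha.2.trans hb.2.symm) hab
    refine h1.trans ?_
    have hlt : ∀ i : Fin 4, i ≤ k → j < κ i := fun i hi => by
      rw [← hb₀]; exact b₀.2.2.trans_le (hκ (hi.trans hk.le))
    refine Finset.card_le_card_of_injOn
      (fun i => if h : i ≤ k then (⟨i, ⟨j, hlt i h⟩⟩ : Boxes κ) else b₀) (fun i hi => ?_)
      fun a ha b hb hab => ?_
    · simp only [Finset.coe_filter, Finset.mem_filter, Finset.mem_univ, true_and,
        Set.mem_ofPred_eq] at hi ⊢
      rw [dif_pos hi]
      exact ⟨hi, rfl⟩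
    · simp only [Finset.coe_filter, Finset.mem_univ, true_and, Set.mem_ofPred_eq] at ha hb
      simp only [dif_pos ha, dif_pos hb] at hab
      exact congrArg Sigma.fst hab

theorem sum_wordWt {B : Type} [Fintype B] (I : B → Fin 4) (k : Fin 4) :
    ∑ i with i ≤ k, wordWt I i = ((Finset.univ.filter fun b => I b ≤ k).card : ℤ) := by
  simp only [wordWt]
  rw [Finset.sum_comm, Finset.card_filter]
  push_cast
  refine Finset.sum_congr rfl fun b _ => ?_
  rw [Finset.sum_ite_eq]
  simp

theorem wordWt_comp {B : Type} [Fintype B] (I : B → Fin 4) (p : Equiv.Perm B) :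
    wordWt (I ∘ p) = wordWt I := by
  funext k
  exact Equiv.sum_comp p fun b => if I b = k then (1 : ℤ) else 0

/-- The word that fills each box with the number of its row. -/
def rowWord : Boxes κ → Fin 4 := fun b => b.1

theorem wordWt_rowWord : wordWt (rowWord κ) = fun i => (κ i : ℤ) := by
  funext i
  simp only [wordWt, rowWord]
  rw [Fintype.sum_sigma, Finset.sum_eq_single i]
  · simp
  · intro j _ hj; simp [hj]
  · simp

/-- The weights of `Σ_κ` are dominated by `κ`. -/
theorem weight_le_of_mem_range (hκ : Antitone κ) {w : ⨂[ℂ] _ : Boxes κ, (Fin 4 → ℂ)}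
    (hw : w ∈ LinearMap.range (youngSymmetrizer κ (Fin 4 → ℂ))) {I : Boxes κ → Fin 4}
    (hI : (wordBasis (Boxes κ)).repr w I ≠ 0) (k : Fin 4) :
    (Finset.univ.filter fun b => I b ≤ k).card ≤
      (Finset.univ.filter fun b : Boxes κ => b.1 ≤ k).card := by
  classical
  obtain ⟨x, rfl⟩ := hw
  rw [youngSymmetrizer, LinearMap.comp_apply, rowSymmetrizer_repr] at hI
  obtain ⟨p, hp, hne⟩ := Finset.exists_ne_zero_of_sum_ne_zero hI
  have h1 := card_le_of_injOn_columns κ hκ (I ∘ p) (fun a b hab hIab => by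
    by_contra h
    exact hne (columnAntisymmetrizer_repr_eq_zero κ x _ h hab hIab)) k
  have h2 := sum_wordWt (I ∘ p) k
  rw [wordWt_comp, sum_wordWt] at h2
  exact_mod_cast (Nat.cast_injective h2).le.trans h1

theorem rowSymmetrizer_repr_comp (x : ⨂[ℂ] _ : Boxes κ, (Fin 4 → ℂ)) (I : Boxes κ → Fin 4)
    (p : Equiv.Perm (Boxes κ)) (hp : ∀ b, (p b).1 = b.1) :
    (wordBasis (Boxes κ)).repr (rowSymmetrizer κ _ x) (I ∘ p) =
      (wordBasis (Boxes κ)).repr (rowSymmetrizer κ _ x) I := by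
  classical
  rw [rowSymmetrizer_repr, rowSymmetrizer_repr]
  refine Finset.sum_bij (fun q _ => p * q) (fun q hq => ?_) (fun q _ q' _ h => mul_left_cancel h)
    (fun q hq => ⟨p⁻¹ * q, ?_, by simp⟩) (fun q _ => ?_)
  · simp only [Finset.mem_filter, Finset.mem_univ, true_and] at hq ⊢
    intro b; rw [Equiv.Perm.mul_apply, hp, hq]
  · simp only [Finset.mem_filter, Finset.mem_univ, true_and] at hq ⊢
    intro b
    rw [Equiv.Perm.mul_apply, ← hp (p⁻¹ (q b)), show p (p⁻¹ (q b)) = q b from p.apply_symm_apply _, hq]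
  · rw [Equiv.Perm.coe_mul, Function.comp_assoc]

/-- A highest weight vector of `Σ_κ` has weight `κ` and a nonzero coefficient at the word of row
numbers. -/
theorem hw_of_mem_range (hκ : Antitone κ) {w : ⨂[ℂ] _ : Boxes κ, (Fin 4 → ℂ)}
    (hw : w ∈ LinearMap.range (youngSymmetrizer κ (Fin 4 → ℂ))) {ν : Fin 4 → ℤ}
    (hν : w ∈ hwSpace (piRep (Boxes κ)) ν) (hw0 : w ≠ 0) :
    ν = (fun i => (κ i : ℤ)) ∧ (wordBasis (Boxes κ)).repr w (rowWord κ) ≠ 0 := by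
  classical
  set b := wordBasis (Boxes κ) with hb
  let f : G4 → ℂ := fun g => ∑ I, conj (b.repr w I) * b.repr (piRep _ g (b (rowWord κ))) I
  have hf : ∃ u t, IsUnitri u ∧ f (torus t * u) ≠ 0 := by
    by_contra hall
    push Not at hall
    apply hw0
    have hf0 : f = fun _ => 0 := by
      refine eq_of_eqOn_bigCell ?_ continuous_const fun u u' t hu hu' => ?_
      · exact continuous_finsetSum _ fun I _ => continuous_const.mul
          (isTame_piRep.continuous_coeff (b.coord I) _)
      · have h1 := basisCore_inner_left b piRep_star u w (piRep _ (torus t * u') (b (rowWord κ)))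
        rw [hν.1 u hu, ← Module.End.mul_apply, ← map_mul, ← mul_assoc] at h1
        exact h1.symm.trans (hall u' t hu')
    have hc := eq_zero_of_rowSymmetric (rowWord κ) (fun I => conj (b.repr w I))
      (fun p hp I => by
        obtain ⟨x, rfl⟩ := hw
        rw [youngSymmetrizer, LinearMap.comp_apply, rowSymmetrizer_repr_comp κ _ I p hp])
      (fun g => by simpa only [f, hb, piRep_repr] using congr_fun hf0 g)
    refine b.ext_elem fun I => ?_
    simpa using congr_fun hc I
  obtain ⟨u, t, hu, hne⟩ := hf
  obtain ⟨I, -, hI⟩ := Finset.exists_ne_zero_of_sum_ne_zero hne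
  have hIw : b.repr w I ≠ 0 := fun h => by simp [h] at hI
  have hle : ∀ c, I c ≤ rowWord κ c := by
    intro c
    by_contra hlt
    push Not at hlt
    refine right_ne_zero_of_mul hI ?_
    rw [hb, piRep_repr]
    refine Finset.prod_eq_zero (Finset.mem_univ c) ?_
    rw [Units.val_mul, coe_torus, Matrix.diagonal_mul, hu _ _ hlt.le, Matrix.one_apply_ne hlt.ne',
      mul_zero]
  have heq : I = rowWord κ := by
    funext c
    refine le_antisymm (hle c) ?_
    have h1 := weight_le_of_mem_range κ hκ hw hIw (I c)
    have h2 := Finset.eq_of_subset_of_card_le (s := Finset.univ.filter fun b : Boxes κ => b.1 ≤ I c)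
      (t := Finset.univ.filter fun b => I b ≤ I c) (fun a ha => by
        simp only [Finset.mem_filter, Finset.mem_univ, true_and] at ha ⊢
        exact (hle a).trans ha) h1
    have h3 : c ∈ Finset.univ.filter fun b => I b ≤ I c := by simp
    rw [← h2] at h3
    exact (Finset.mem_filter.1 h3).2
  subst heq
  exact ⟨by rw [← wordWt_eq_of_mem hν.2 hIw, wordWt_rowWord], hIw⟩

/-- The coefficient of the Young symmetrizer of the word of row numbers at that same word is
positive. -/
theorem range_youngSymmetrizer_ne_bot :
    LinearMap.range (youngSymmetrizer κ (Fin 4 → ℂ)) ≠ ⊥ := by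
  classical
  intro h0
  have h1 : youngSymmetrizer κ _ (wordBasis (Boxes κ) (rowWord κ)) = 0 := by
    have : youngSymmetrizer κ _ (wordBasis (Boxes κ) (rowWord κ)) ∈ (⊥ : Submodule ℂ _) :=
      h0 ▸ LinearMap.mem_range_self _ _
    exact this
  have h2 := congrArg (fun x => (wordBasis (Boxes κ)).repr x (rowWord κ)) h1
  simp only [youngSymmetrizer, LinearMap.comp_apply, rowSymmetrizer_repr, map_zero,
    Finsupp.coe_zero, Pi.zero_apply] at h2
  have h3 : ∀ p ∈ Finset.univ.filter fun p : Equiv.Perm (Boxes κ) => ∀ x, (p x).1 = x.1,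
      (wordBasis (Boxes κ)).repr (columnAntisymmetrizer κ _ (wordBasis (Boxes κ) (rowWord κ)))
        (rowWord κ ∘ p) = 1 := by
    intro p hp
    have hp' : rowWord κ ∘ p = rowWord κ := funext fun b => (Finset.mem_filter.1 hp).2 b
    rw [hp', columnAntisymmetrizer_repr, Finset.sum_eq_single 1]
    · simp
    · intro q hq hq1
      rw [Module.Basis.repr_self, Finsupp.single_eq_of_ne, mul_zero]
      intro h
      apply hq1
      ext1 c
      have h4 : (q c).1 = c.1 := congr_fun h c
      have h5 := (Finset.mem_filter.1 hq).2 c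
      rw [Equiv.Perm.one_apply]
      rcases hqc : q c with ⟨i, j⟩
      rcases c with ⟨i', j'⟩
      rw [hqc] at h4 h5
      obtain rfl : i = i' := h4
      obtain rfl : j = j' := Fin.ext h5
      rfl
    · simp
  rw [Finset.sum_congr rfl h3, Finset.sum_const, nsmul_eq_mul, mul_one, Nat.cast_eq_zero,
    Finset.card_eq_zero] at h2
  exact Finset.notMem_empty (1 : Equiv.Perm (Boxes κ)) (h2 ▸ by simp)

namespace VectFunctor

theorem isTame_schurPartition : IsTame (schurPartition κ).rep := by
  have hW : ∀ g, LinearMap.range (youngSymmetrizer κ (Fin 4 → ℂ)) ≤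
      (LinearMap.range (youngSymmetrizer κ (Fin 4 → ℂ))).comap (piRep (Boxes κ) g) :=
    fun g x hx => ((schurPartition κ).rep g ⟨x, hx⟩).2
  exact (isTame_piRep.subrepresentation _ hW).of_equiv
    (LinearEquiv.refl ℂ (LinearMap.range (youngSymmetrizer κ (Fin 4 → ℂ)))) fun g x => rfl

theorem mem_hwSpace_coe {ν : Fin 4 → ℤ} {x : (schurPartition κ).obj (Fin 4 → ℂ)}
    (hx : x ∈ hwSpace (schurPartition κ).rep ν) : x.1 ∈ hwSpace (piRep (Boxes κ)) ν :=
  ⟨fun u hu => congrArg Subtype.val (hx.1 u hu), fun t => congrArg Subtype.val (hx.2 t)⟩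

/-- The Schur functor `Σ_κ` gives the irreducible representation of highest weight `κ`. -/
theorem exists_isHighest_schurPartition (hκ : Antitone κ) :
    ∃ v, IsHighest (schurPartition κ).rep (fun i => (κ i : ℤ)) v := by
  have hne : (⊤ : Submodule ℂ ((schurPartition κ).obj (Fin 4 → ℂ))) ≠ ⊥ := by
    intro h0
    apply range_youngSymmetrizer_ne_bot κ
    rw [eq_bot_iff]
    intro x hx
    have h1 : ∀ y : (schurPartition κ).obj (Fin 4 → ℂ), y = 0 := fun y => by
      have hy : y ∈ (⊤ : Submodule ℂ ((schurPartition κ).obj (Fin 4 → ℂ))) := Submodule.mem_top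
      rwa [h0, Submodule.mem_bot] at hy
    exact congrArg Subtype.val (h1 ⟨x, hx⟩)
  obtain ⟨ν, v, -, hv0, hv⟩ := (isTame_schurPartition κ).exists_hw ⊤ (fun _ _ _ => Submodule.mem_top) hne
  obtain ⟨rfl, hv1⟩ := hw_of_mem_range κ hκ v.2 (mem_hwSpace_coe κ hv) fun h => hv0 (Subtype.ext h)
  refine ⟨v, (isTame_schurPartition κ).isHighest hv hv0 fun ν w hw => ?_⟩
  set b := wordBasis (Boxes κ)
  by_cases hw0 : w = 0
  · exact ⟨0, by rw [hw0, zero_smul]⟩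
  obtain ⟨rfl, -⟩ := hw_of_mem_range κ hκ w.2 (mem_hwSpace_coe κ hw) fun h => hw0 (Subtype.ext h)
  refine ⟨b.repr w.1 (rowWord κ) / b.repr v.1 (rowWord κ), ?_⟩
  rw [← sub_eq_zero]
  by_contra hne0
  have hmem := Submodule.sub_mem _ hw (Submodule.smul_mem _
    (b.repr w.1 (rowWord κ) / b.repr v.1 (rowWord κ)) hv)
  refine (hw_of_mem_range κ hκ (w - _ • v).2 (mem_hwSpace_coe κ hmem)
    fun h => hne0 (Subtype.ext h)).2 ?_
  change b.repr (w.1 - _ • v.1) (rowWord κ) = 0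
  rw [map_sub, map_smul, Finsupp.sub_apply, Finsupp.smul_apply, smul_eq_mul,
    div_mul_cancel₀ _ hv1, sub_self]

/-- The weight `(ν₀, …, ν₃)` is the partition `ν + d` translated by `-d`, `d = max(0, -ν₃)`. -/
theorem exists_isHighest_schur {ν : Fin 4 → ℤ} (hν : Antitone ν) :
    ∃ v, IsHighest (schur ν).rep ν v := by
  have hκ : Antitone fun i => (ν i + ((-ν 3).toNat : ℤ)).toNat := fun i j hij =>
    Int.toNat_le_toNat (by have := hν hij; omega)
  obtain ⟨v, hv⟩ := exists_isHighest_schurPartition _ hκ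
  obtain ⟨w, hw⟩ := hv.tprod_isDetPow (isDetPow_detInv (-ν 3).toNat)
  refine ⟨w, ?_⟩
  have hwt : ((fun i => (((ν i + ((-ν 3).toNat : ℤ)).toNat : ℕ) : ℤ)) +
      fun _ => -((-ν 3).toNat : ℤ)) = ν := by
    funext i
    have : ν 3 ≤ ν i := hν (Fin.le_last i)
    simp only [Pi.add_apply]
    omega
  rw [hwt] at hw
  exact hw

theorem isTame_schur (ν : Fin 4 → ℤ) : IsTame (schur ν).rep := by
  have := (isTame_schurPartition fun i => (ν i + ((-ν 3).toNat : ℤ)).toNat).tprod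
    (isDetPow_detInv (-ν 3).toNat).isTame
  exact this

end VectFunctor

end Young

/-! ### Lower bounds for multiplicities -/

section Coefficients

variable {M N : Type} [AddCommGroup M] [Module ℂ M] [AddCommGroup N] [Module ℂ N]
  {ρ : Representation ℂ G4 M} {ρ' : Representation ℂ G4 N}

/-- A function of the form `g ↦ ξ (φ (g p))`, for a representation `P` with a highest weight vector
`p` and a lowest weight form `ξ` of weight `κ`, and a highest weight vector `φ` of weight `μ` in
`End P`. -/
def IsEndCoeff (κ μ : Fin 4 → ℤ) (f : G4 → ℂ) : Prop :=
  ∃ (P : Type) (_ : AddCommGroup P) (_ : Module ℂ P) (π : Representation ℂ G4 P) (p : P)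
    (ξ : Module.Dual ℂ P) (φ : P →ₗ[ℂ] P), IsTame π ∧ p ∈ hwSpace π κ ∧ ξ ∈ lwForms π κ ∧
      φ ∈ hwSpace (π.linHom π) μ ∧ ∀ g, f g = ξ (φ (π g p))

/-- Highest weight endomorphisms, with the inverse cleared from the conjugation action. -/
theorem linHom_mem_hwSpace_iff {μ : Fin 4 → ℤ} {φ : M →ₗ[ℂ] N} :
    φ ∈ hwSpace (ρ.linHom ρ') μ ↔ (∀ u, IsUnitri u → ∀ x, φ (ρ u x) = ρ' u (φ x)) ∧
      ∀ t x, ρ' (torus t) (φ x) = wchar μ t • φ (ρ (torus t) x) := by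
  constructor
  · rintro ⟨h1, h2⟩
    refine ⟨fun u hu x => ?_, fun t x => ?_⟩
    · have := LinearMap.congr_fun (h1 u hu) (ρ u x)
      simpa using this.symm
    · have := LinearMap.congr_fun (h2 t) (ρ (torus t) x)
      simpa using this
  · rintro ⟨h1, h2⟩
    refine ⟨fun u hu => ?_, fun t => ?_⟩
    · ext x
      simp [← h1 u hu]
    · ext x
      simp only [Representation.linHom_apply, LinearMap.comp_apply, h2, LinearMap.smul_apply]
      simp

/-- The functions `g ↦ ξ (φ (g p))` of all representations `P` come from highest weight vectors in
the endomorphisms of the irreducible representation `M`. -/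
theorem IsLowestForm.exists_of_isEndCoeff (h : IsTame ρ) {κ μ : Fin 4 → ℤ} {v : M}
    (hv : IsHighest ρ κ v) {ζ : Module.Dual ℂ M} (hζ : IsLowestForm ρ κ v ζ) {f : G4 → ℂ}
    (hf : IsEndCoeff κ μ f) :
    ∃ φ ∈ hwSpace (ρ.linHom ρ) μ, ∀ g, ζ (φ (ρ g v)) = f g := by
  obtain ⟨P, _, _, π, p, ξ, φ, hπ, hp, hξ, hφ, hf⟩ := hf
  obtain ⟨j, hj, hjv⟩ := h.exists_commutes hπ hv.mem hv.ne_zero hp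
  obtain ⟨q, hq, hqζ⟩ := hζ.exists_factor π hπ ξ hξ
  rw [linHom_mem_hwSpace_iff] at hφ
  refine ⟨q ∘ₗ φ ∘ₗ j, linHom_mem_hwSpace_iff.2 ⟨fun u hu x => ?_, fun t x => ?_⟩, fun g => ?_⟩
  · simp only [LinearMap.comp_apply]
    rw [hj, hφ.1 u hu, hq]
  · simp only [LinearMap.comp_apply]
    rw [hj, ← hq, hφ.2, map_smul]
  · simp only [LinearMap.comp_apply]
    rw [hj, hjv, hqζ, hf]

theorem IsEndCoeff.mul {κ κ' μ μ' : Fin 4 → ℤ} {f f' : G4 → ℂ} (h : IsEndCoeff κ μ f)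
    (h' : IsEndCoeff κ' μ' f') : IsEndCoeff (κ + κ') (μ + μ') (f * f') := by
  obtain ⟨P, _, _, π, p, ξ, φ, hπ, hp, hξ, hφ, hf⟩ := h
  obtain ⟨P', _, _, π', p', ξ', φ', hπ', hp', hξ', hφ', hf'⟩ := h'
  rw [linHom_mem_hwSpace_iff] at hφ hφ'
  refine ⟨P ⊗[ℂ] P', inferInstance, inferInstance, π.tprod π', p ⊗ₜ p',
    LinearMap.mul' ℂ ℂ ∘ₗ TensorProduct.map ξ ξ', TensorProduct.map φ φ', hπ.tprod hπ',
    tmul_mem_hwSpace hp hp', ⟨fun u hu x => ?_, fun t x => ?_⟩,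
    linHom_mem_hwSpace_iff.2 ⟨fun u hu x => ?_, fun t x => ?_⟩, fun g => ?_⟩
  · induction x with
    | zero => simp
    | add x y hx hy => simp only [map_add, hx, hy]
    | tmul x y => simp [hξ.1 u hu, hξ'.1 u hu]
  · induction x with
    | zero => simp
    | add x y hx hy => simp only [map_add, hx, hy, mul_add]
    | tmul x y => simp [hξ.2, hξ'.2, wchar_add, mul_mul_mul_comm]
  · induction x with
    | zero => simp
    | add x y hx hy => simp only [map_add, hx, hy]
    | tmul x y => simp [hφ.1 u hu, hφ'.1 u hu]
  · induction x with
    | zero => simp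
    | add x y hx hy => simp only [map_add, hx, hy, smul_add]
    | tmul x y =>
      simp only [Representation.tprod_apply, TensorProduct.map_tmul, hφ.2, hφ'.2,
        TensorProduct.smul_tmul_smul, wchar_add]
  · simp [hf, hf']

/-- The constant function `1` on lower unitriangular matrices is the coefficient of the identity of
an irreducible representation. -/
theorem exists_isEndCoeff_zero {κ : Fin 4 → ℤ} (hκ : Antitone κ) :
    ∃ f, IsEndCoeff κ 0 f ∧ ∀ u, IsUnitri u → f (star u) = 1 := by
  obtain ⟨v, hv⟩ := VectFunctor.exists_isHighest_schur hκ
  have h := VectFunctor.isTame_schur κ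
  obtain ⟨ζ, hζ⟩ := h.exists_isLowestForm hv
  refine ⟨fun g => ζ ((VectFunctor.schur κ).rep g v), ⟨_, _, _, (VectFunctor.schur κ).rep, v, ζ,
    LinearMap.id, h, hv.mem, hζ.mem, linHom_mem_hwSpace_iff.2 ⟨fun _ _ _ => rfl, fun t x => ?_⟩,
    fun g => rfl⟩, fun u hu => ?_⟩
  · simp
  · simp only
    rw [hζ.mem.1 u hu, hζ.apply_eq_one]

end Coefficients

/-! ### Explicit representations -/

theorem IsUnitri.entries {u : G4} (hu : IsUnitri u) :
    (u : Matrix (Fin 4) (Fin 4) ℂ) 0 0 = 1 ∧ (u : Matrix (Fin 4) (Fin 4) ℂ) 1 1 = 1 ∧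
      (u : Matrix (Fin 4) (Fin 4) ℂ) 2 2 = 1 ∧ (u : Matrix (Fin 4) (Fin 4) ℂ) 3 3 = 1 ∧
      (u : Matrix (Fin 4) (Fin 4) ℂ) 1 0 = 0 ∧ (u : Matrix (Fin 4) (Fin 4) ℂ) 2 0 = 0 ∧
      (u : Matrix (Fin 4) (Fin 4) ℂ) 3 0 = 0 ∧ (u : Matrix (Fin 4) (Fin 4) ℂ) 2 1 = 0 ∧
      (u : Matrix (Fin 4) (Fin 4) ℂ) 3 1 = 0 ∧ (u : Matrix (Fin 4) (Fin 4) ℂ) 3 2 = 0 := by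
  refine ⟨?_, ?_, ?_, ?_, ?_, ?_, ?_, ?_, ?_, ?_⟩ <;> rw [hu _ _ (by decide)] <;> rfl

/-- The coefficient of the endomorphism `E₀₃` of `ℂ⁴`. -/
theorem isEndCoeff_std : IsEndCoeff ![1, 0, 0, 0] ![1, 0, 0, -1]
    fun g => (g : Matrix (Fin 4) (Fin 4) ℂ) 3 0 := by
  refine ⟨_, _, _, stdRep, Pi.single 0 1, LinearMap.proj 0,
    LinearMap.toSpanSingleton ℂ _ (Pi.single 0 1) ∘ₗ LinearMap.proj 3, isTame_stdRep,
    ⟨fun u hu => ?_, fun t => ?_⟩, ⟨fun u hu x => ?_, fun t x => ?_⟩,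
    linHom_mem_hwSpace_iff.2 ⟨fun u hu x => ?_, fun t x => ?_⟩, fun g => ?_⟩
  all_goals try obtain ⟨h00, h11, h22, h33, h10, h20, h30, h21, h31, h32⟩ := hu.entries
  · ext i
    fin_cases i <;> simp [stdRep_apply, *]
  · ext i
    fin_cases i <;> simp [stdRep_apply, wchar, Fin.prod_univ_four, Matrix.diagonal]
  · simp [stdRep_apply, Matrix.mulVec, dotProduct, Fin.sum_univ_four, Matrix.star_apply, *]
  · simp [stdRep_apply, Matrix.mulVec_diagonal, wchar, Fin.prod_univ_four]
  · ext i
    fin_cases i <;>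
    simp [stdRep_apply, Matrix.mulVec, dotProduct, Fin.sum_univ_four, *]
  · ext i
    have := (t 3).ne_zero
    fin_cases i <;>
    simp [stdRep_apply, Matrix.mulVec_diagonal, wchar, Fin.prod_univ_four]
    field_simp
  · simp [stdRep_apply]

/-- The coefficient of the transpose of `E₀₃` on the dual of `ℂ⁴`. -/
theorem isEndCoeff_dual : IsEndCoeff ![0, 0, 0, -1] ![1, 0, 0, -1]
    fun g => ((g⁻¹ : G4) : Matrix (Fin 4) (Fin 4) ℂ) 3 0 := by
  have h0 : ∀ u : G4, IsUnitri u → stdRep u (Pi.single 0 1) = Pi.single 0 1 := fun u hu => by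
    obtain ⟨h00, h11, h22, h33, h10, h20, h30, h21, h31, h32⟩ := hu.entries
    ext i
    fin_cases i <;> simp [stdRep_apply, *]
  have h3 : ∀ u : G4, IsUnitri u → stdRep (star u) (Pi.single 3 1) = Pi.single 3 1 := fun u hu => by
    obtain ⟨h00, h11, h22, h33, h10, h20, h30, h21, h31, h32⟩ := hu.entries
    ext i
    fin_cases i <;> simp [stdRep_apply, Matrix.star_apply, *]
  have ht : ∀ t i, stdRep (torus t) (Pi.single i 1) = (t i : ℂ) • Pi.single i 1 := fun t i => by
    ext k
    by_cases hk : k = i <;> simp [stdRep_apply, hk]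
  have hd : ∀ g ξ x, stdRep.dual g ξ x = ξ (stdRep g⁻¹ x) := fun g ξ x => rfl
  have hu3 : ∀ u : G4, IsUnitri u →
      stdRep.dual u (LinearMap.proj 3 : (Fin 4 → ℂ) →ₗ[ℂ] ℂ) = LinearMap.proj 3 := fun u hu => by
    ext i
    rw [LinearMap.comp_apply, hd]
    have h := hu.inv 3 i (Fin.le_last i)
    simp only [stdRep_apply, LinearMap.single_apply, LinearMap.proj_apply,
      Matrix.mulVec_single_one, Matrix.col_apply, h, LinearMap.comp_apply, Matrix.one_apply,
      Pi.single_apply]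
  have ht3 : ∀ t, stdRep.dual (torus t) (LinearMap.proj 3 : (Fin 4 → ℂ) →ₗ[ℂ] ℂ) =
      (t 3 : ℂ)⁻¹ • LinearMap.proj 3 := fun t => by
    ext i
    rw [LinearMap.comp_apply, hd, ← map_inv, LinearMap.single_apply, ht]
    by_cases hi : 3 = i
    · subst hi; simp
    · simp [hi]
  refine ⟨_, _, _, stdRep.dual, LinearMap.proj 3, Module.Dual.eval ℂ _ (Pi.single 3 1),
    LinearMap.toSpanSingleton ℂ _ (LinearMap.proj 3) ∘ₗ Module.Dual.eval ℂ _ (Pi.single 0 1),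
    isTame_stdRep.dual, ⟨hu3, fun t => ?_⟩, ⟨fun u hu x => ?_, fun t x => ?_⟩,
    linHom_mem_hwSpace_iff.2 ⟨fun u hu x => ?_, fun t x => ?_⟩, fun g => ?_⟩
  · rw [ht3]
    simp [wchar, Fin.prod_univ_four]
  · rw [Module.Dual.eval_apply, Module.Dual.eval_apply, hd, ← star_inv, h3 _ hu.inv]
  · rw [Module.Dual.eval_apply, Module.Dual.eval_apply, hd, ← map_inv, ht]
    simp [wchar, Fin.prod_univ_four]
  · simp only [LinearMap.comp_apply, Module.Dual.eval_apply, LinearMap.toSpanSingleton_apply,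
      map_smul]
    rw [hu3 u hu, hd, h0 _ hu.inv]
  · simp only [LinearMap.comp_apply, Module.Dual.eval_apply, LinearMap.toSpanSingleton_apply,
      map_smul]
    rw [ht3, hd, ← map_inv, ht, map_smul, smul_smul, smul_smul]
    congr 1
    simp [wchar, Fin.prod_univ_four]
    field_simp
  · simp [stdRep_apply, Module.Dual.transpose_apply]

/-- The action `y ↦ det(g)ᵏ g y gᵀ` on matrices. -/
def matRep (k : ℤ) : Representation ℂ G4 (Matrix (Fin 4) (Fin 4) ℂ) where
  toFun g :=
    { toFun := fun y => (g : Matrix (Fin 4) (Fin 4) ℂ).det ^ k • ((g : Matrix (Fin 4) (Fin 4) ℂ) *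
        y * (g : Matrix (Fin 4) (Fin 4) ℂ)ᵀ)
      map_add' := fun y z => by rw [mul_add, add_mul, smul_add]
      map_smul' := fun a y => by
        rw [Matrix.mul_smul, Matrix.smul_mul, smul_comm, RingHom.id_apply] }
  map_one' := by ext y; simp
  map_mul' g g' := by
    refine LinearMap.ext fun y => ?_
    simp [Matrix.transpose_mul, mul_zpow, Matrix.mul_assoc, smul_smul, mul_comm]

theorem matRep_apply (k : ℤ) (g : G4) (y : Matrix (Fin 4) (Fin 4) ℂ) :
    matRep k g y = (g : Matrix (Fin 4) (Fin 4) ℂ).det ^ k • ((g : Matrix (Fin 4) (Fin 4) ℂ) *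
        y * (g : Matrix (Fin 4) (Fin 4) ℂ)ᵀ) := rfl

theorem matRep_single_apply (k : ℤ) (g : G4) (i j a b : Fin 4) :
    matRep k g (Matrix.single i j 1) a b = (g : Matrix (Fin 4) (Fin 4) ℂ).det ^ k *
      ((g : Matrix (Fin 4) (Fin 4) ℂ) a i * (g : Matrix (Fin 4) (Fin 4) ℂ) b j) := by
  rw [matRep_apply, Matrix.smul_apply, smul_eq_mul, Matrix.mul_apply]
  congr 1
  rw [Finset.sum_eq_single j]
  · simp
  · intro c _ hc; simp [Matrix.mul_apply, Ne.symm hc]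
  · simp

theorem matRep_torus_single (k : ℤ) (t : Fin 4 → ℂˣ) (i j : Fin 4) :
    matRep k (torus t) (Matrix.single i j 1) =
      wchar ((Pi.single i 1 + Pi.single j 1) + fun _ => k) t • Matrix.single i j 1 := by
  have h : ∀ i, wchar (Pi.single i 1) t = t i := fun i => by
    rw [wchar, Finset.prod_eq_single i (by intro j _ hj; simp [hj]) (by simp)]
    simp
  rw [wchar_add, wchar_add, ← det_torus_zpow, h, h]
  ext a b
  rw [matRep_single_apply, Matrix.smul_apply, coe_torus, Matrix.diagonal_apply,
    Matrix.diagonal_apply, Matrix.single_apply, smul_eq_mul]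
  split_ifs <;> simp_all
  ring

theorem isTame_matRep (k : ℤ) : IsTame (matRep k) := by
  refine ⟨Fin 4 × Fin 4, inferInstance, Matrix.stdBasis ℂ (Fin 4) (Fin 4),
    fun ij => (Pi.single ij.1 1 + Pi.single ij.2 1) + fun _ => k,
    fun g i j => ?_, fun t i => ?_, fun i j => ?_⟩
  · have hrepr : ∀ y ij, (Matrix.stdBasis ℂ (Fin 4) (Fin 4)).repr y ij = y ij.1 ij.2 := fun _ _ => rfl
    rw [hrepr, hrepr, Matrix.stdBasis_eq_single, Matrix.stdBasis_eq_single, matRep_single_apply,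
      matRep_single_apply, Units.coe_star, Matrix.star_eq_conjTranspose, Matrix.det_conjTranspose]
    simp
  · rw [Matrix.stdBasis_eq_single, matRep_torus_single]
  · have hrepr : ∀ y ij, (Matrix.stdBasis ℂ (Fin 4) (Fin 4)).repr y ij = y ij.1 ij.2 := fun _ _ => rfl
    have hj : Matrix.stdBasis ℂ (Fin 4) (Fin 4) j = Matrix.single j.1 j.2 1 :=
      Matrix.stdBasis_eq_single ..
    simp only [hrepr, hj, matRep_single_apply]
    exact (Units.continuous_val.matrix_det.zpow₀ k fun g => Or.inl (det_ne_zero' g)).mul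
      ((Units.continuous_val.matrix_elem _ _).mul (Units.continuous_val.matrix_elem _ _))

/-- The matrix `E₀₁ - E₁₀`: the highest weight vector `e₀ ∧ e₁` of `⋀² ℂ⁴`, as an alternating
matrix. -/
def altMat : Matrix (Fin 4) (Fin 4) ℂ := Matrix.single 0 1 1 - Matrix.single 1 0 1

theorem matRep_altMat (k : ℤ) (g : G4) (a b : Fin 4) : matRep k g altMat a b =
    (g : Matrix (Fin 4) (Fin 4) ℂ).det ^ k *
      ((g : Matrix (Fin 4) (Fin 4) ℂ) a 0 * (g : Matrix (Fin 4) (Fin 4) ℂ) b 1 -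
        (g : Matrix (Fin 4) (Fin 4) ℂ) a 1 * (g : Matrix (Fin 4) (Fin 4) ℂ) b 0) := by
  rw [altMat, map_sub, Matrix.sub_apply, matRep_single_apply, matRep_single_apply, mul_sub]

theorem altMat_mem_hwSpace (k : ℤ) :
    altMat ∈ hwSpace (matRep k) (![1, 1, 0, 0] + fun _ => k) := by
  refine ⟨fun u hu => ?_, fun t => ?_⟩
  · obtain ⟨h00, h11, h22, h33, h10, h20, h30, h21, h31, h32⟩ := hu.entries
    ext a b
    rw [matRep_altMat, hu.det]
    fin_cases a <;> fin_cases b <;> simp [altMat, *]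
  · rw [altMat, map_sub, matRep_torus_single, matRep_torus_single,
      add_comm (Pi.single 1 1 : Fin 4 → ℤ), ← smul_sub]
    congr 3
    ext i
    fin_cases i <;> simp

/-- The linear form `y ↦ y_ab - y_ba` on matrices. -/
def altForm (a b : Fin 4) : Module.Dual ℂ (Matrix (Fin 4) (Fin 4) ℂ) where
  toFun y := y a b - y b a
  map_add' y z := by simp only [Matrix.add_apply]; ring
  map_smul' c y := by simp only [Matrix.smul_apply, smul_eq_mul, RingHom.id_apply]; ring

theorem altForm_mem_lwForms : altForm 0 1 ∈ lwForms (matRep 0) ![1, 1, 0, 0] := by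
  refine ⟨fun u hu y => ?_, fun t y => ?_⟩
  · obtain ⟨h00, h11, h22, h33, h10, h20, h30, h21, h31, h32⟩ := hu.entries
    simp [altForm, matRep_apply, Matrix.mul_apply, Fin.sum_univ_four, Matrix.star_apply, *]
    ring
  · simp [altForm, matRep_apply, Matrix.mul_apply, Matrix.diagonal_apply, wchar,
      Fin.prod_univ_four]
    ring

/-- The coefficient of left multiplication by `E₀₃`, followed by the form `y ↦ y₀₁ - y₁₀`. -/
theorem isEndCoeff_alt : IsEndCoeff ![1, 1, 0, 0] ![1, 0, 0, -1] fun g =>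
    (g : Matrix (Fin 4) (Fin 4) ℂ) 3 0 * (g : Matrix (Fin 4) (Fin 4) ℂ) 1 1 -
      (g : Matrix (Fin 4) (Fin 4) ℂ) 3 1 * (g : Matrix (Fin 4) (Fin 4) ℂ) 1 0 := by
  have h0 : ((![1, 1, 0, 0] : Fin 4 → ℤ) + fun _ => 0) = ![1, 1, 0, 0] := add_zero _
  refine ⟨_, _, _, matRep 0, altMat, altForm 0 1,
    LinearMap.mulLeft ℂ (Matrix.single 0 3 1), isTame_matRep 0, h0 ▸ altMat_mem_hwSpace 0,
    altForm_mem_lwForms,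
    linHom_mem_hwSpace_iff.2 ⟨fun u hu y => ?_, fun t y => ?_⟩, fun g => ?_⟩
  · obtain ⟨h00, h11, h22, h33, h10, h20, h30, h21, h31, h32⟩ := hu.entries
    have hy : ∀ y : Matrix (Fin 4) (Fin 4) ℂ, Matrix.single 0 3 1 * ((u : Matrix (Fin 4) (Fin 4) ℂ) * y) =
        (u : Matrix (Fin 4) (Fin 4) ℂ) * (Matrix.single 0 3 1 * y) := fun y => by
      rw [← Matrix.mul_assoc, ← Matrix.mul_assoc]
      congr 1
      ext a b
      fin_cases a <;> fin_cases b <;> simp [Matrix.mul_apply, Fin.sum_univ_four, *]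
    simp only [matRep_apply, LinearMap.mulLeft_apply, zpow_zero, one_smul]
    rw [Matrix.mul_assoc, Matrix.mul_assoc, hy, ← Matrix.mul_assoc, ← Matrix.mul_assoc]
    simp only [Matrix.mul_assoc]
  · have hy : ∀ y : Matrix (Fin 4) (Fin 4) ℂ, Matrix.single 0 3 (1 : ℂ) * ((torus t : Matrix (Fin 4) (Fin 4) ℂ) * y) =
        ((t 3 : ℂ) / (t 0 : ℂ)) •
          ((torus t : Matrix (Fin 4) (Fin 4) ℂ) * (Matrix.single 0 3 1 * y)) := fun y => by
      rw [← Matrix.mul_assoc, ← Matrix.mul_assoc, ← Matrix.smul_mul]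
      congr 1
      have := (t 0).ne_zero
      ext a b
      fin_cases a <;> fin_cases b <;>
        simp [Matrix.mul_apply, Matrix.diagonal_apply]
    simp only [matRep_apply, LinearMap.mulLeft_apply, zpow_zero, one_smul]
    rw [Matrix.mul_assoc, Matrix.mul_assoc, Matrix.mul_assoc, hy, smul_smul]
    have := (t 0).ne_zero
    have := (t 3).ne_zero
    simp [wchar, Fin.prod_univ_four]
    field_simp
    simp
  · have : ∀ y a b, (Matrix.single 0 3 1 * y : Matrix (Fin 4) (Fin 4) ℂ) a b =
      if a = 0 then y 3 b else 0 := fun y a b => by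
      simp [Matrix.mul_apply, Matrix.single_apply, ite_and, eq_comm]
    simp only [altForm, LinearMap.mulLeft_apply, LinearMap.coe_mk, AddHom.coe_mk, this,
      matRep_altMat]
    simp

/-- On alternating matrices, the highest weight endomorphism `y ↦ (y₂₃ - y₃₂) (E₀₁ - E₁₀)`. -/
theorem alt_mem_hwSpace : LinearMap.toSpanSingleton ℂ _ altMat ∘ₗ altForm 2 3 ∈
    hwSpace ((matRep 0).linHom (matRep 0)) ![1, 1, -1, -1] := by
  have h0 : ((![1, 1, 0, 0] : Fin 4 → ℤ) + fun _ => 0) = ![1, 1, 0, 0] := add_zero _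
  have hX : altMat ∈ hwSpace (matRep 0) ![1, 1, 0, 0] := h0 ▸ altMat_mem_hwSpace 0
  refine linHom_mem_hwSpace_iff.2 ⟨fun u hu y => ?_, fun t y => ?_⟩
  · simp only [LinearMap.comp_apply, LinearMap.toSpanSingleton_apply, map_smul]
    rw [hX.1 u hu]
    congr 1
    obtain ⟨h00, h11, h22, h33, h10, h20, h30, h21, h31, h32⟩ := hu.entries
    simp [altForm, matRep_apply, Matrix.mul_apply, Fin.sum_univ_four, *]
    ring
  · simp only [LinearMap.comp_apply, LinearMap.toSpanSingleton_apply, map_smul]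
    rw [hX.2, smul_smul, smul_smul]
    congr 1
    have := (t 2).ne_zero
    have := (t 3).ne_zero
    simp [altForm, matRep_apply, Matrix.mul_apply, Matrix.diagonal_apply, wchar, Fin.prod_univ_four]
    field_simp

/-- The coefficient of `y ↦ (y₂₃ - y₃₂) (E₀₁ - E₁₀)` on alternating matrices. -/
theorem isEndCoeff_alt_alt : IsEndCoeff ![1, 1, 0, 0] ![1, 1, -1, -1] fun g =>
    4 * ((g : Matrix (Fin 4) (Fin 4) ℂ) 2 0 * (g : Matrix (Fin 4) (Fin 4) ℂ) 3 1 -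
      (g : Matrix (Fin 4) (Fin 4) ℂ) 2 1 * (g : Matrix (Fin 4) (Fin 4) ℂ) 3 0) := by
  have h0 : ((![1, 1, 0, 0] : Fin 4 → ℤ) + fun _ => 0) = ![1, 1, 0, 0] := add_zero _
  refine ⟨_, _, _, matRep 0, altMat, altForm 0 1, _, isTame_matRep 0, h0 ▸ altMat_mem_hwSpace 0,
    altForm_mem_lwForms, alt_mem_hwSpace, fun g => ?_⟩
  simp only [LinearMap.comp_apply, LinearMap.toSpanSingleton_apply, map_smul]
  simp only [altForm, LinearMap.coe_mk, AddHom.coe_mk, matRep_altMat]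
  simp [altMat]
  ring

/-- The conjugation action on matrices. -/
def adRep : Representation ℂ G4 (Matrix (Fin 4) (Fin 4) ℂ) where
  toFun g := LinearMap.mulLeftRight ℂ ((g : Matrix (Fin 4) (Fin 4) ℂ), ((g⁻¹ : G4) : Matrix _ _ ℂ))
  map_one' := by ext y; simp
  map_mul' g g' := by
    refine LinearMap.ext fun y => ?_
    simp [Matrix.mul_assoc]

theorem adRep_apply (g : G4) (y : Matrix (Fin 4) (Fin 4) ℂ) :
    adRep g y = (g : Matrix (Fin 4) (Fin 4) ℂ) * y * ((g⁻¹ : G4) : Matrix _ _ ℂ) := by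
  simp [adRep]

theorem isTame_adRep : IsTame adRep := by
  refine (isTame_stdRep.linHom isTame_stdRep).of_equiv LinearMap.toMatrix' fun g x => ?_
  have h : ∀ g, stdRep g = Matrix.toLin' (g : Matrix (Fin 4) (Fin 4) ℂ) := fun g => rfl
  simp only [LinearEquiv.coe_coe, Representation.linHom_apply, h, LinearMap.toMatrix'_comp,
    LinearMap.toMatrix'_toLin', adRep_apply, Matrix.mul_assoc]

/-- The endomorphism `y ↦ (E₀₁ - E₁₀) yᵀ (E₂₃ - E₃₂)` of the space of matrices. -/
def altSandwich : Matrix (Fin 4) (Fin 4) ℂ →ₗ[ℂ] Matrix (Fin 4) (Fin 4) ℂ where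
  toFun y := altMat * yᵀ * (Matrix.single 2 3 1 - Matrix.single 3 2 1)
  map_add' y z := by rw [Matrix.transpose_add, Matrix.mul_add, Matrix.add_mul]
  map_smul' c y := by
    rw [Matrix.transpose_smul, Matrix.mul_smul, Matrix.smul_mul, RingHom.id_apply]

/-- The map `y ↦ (E₀₁ - E₁₀) yᵀ (E₂₃ - E₃₂)` commutes up to the factor `b / a` with every `g` that
multiplies the bivector `E₀₁ - E₁₀` by `a` and the alternating form `E₂₃ - E₃₂` by `b`. -/
theorem altSandwich_adRep (g : G4) (a b : ℂ)
    (ha : (g : Matrix (Fin 4) (Fin 4) ℂ) * altMat * (g : Matrix (Fin 4) (Fin 4) ℂ)ᵀ = a • altMat)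
    (hb : (g : Matrix (Fin 4) (Fin 4) ℂ)ᵀ * (Matrix.single 2 3 1 - Matrix.single 3 2 1) *
      (g : Matrix (Fin 4) (Fin 4) ℂ) = b • (Matrix.single 2 3 1 - Matrix.single 3 2 1))
    (y : Matrix (Fin 4) (Fin 4) ℂ) :
    a • altSandwich (adRep g y) = b • adRep g (altSandwich y) := by
  have h1 : a • (altMat * ((g⁻¹ : G4) : Matrix (Fin 4) (Fin 4) ℂ)ᵀ) =
      (g : Matrix (Fin 4) (Fin 4) ℂ) * altMat := by
    rw [← Matrix.smul_mul, ← ha, Matrix.mul_assoc, ← Matrix.transpose_mul, ← Units.val_mul,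
      inv_mul_cancel, Units.val_one, Matrix.transpose_one, Matrix.mul_one]
  have h2 : (g : Matrix (Fin 4) (Fin 4) ℂ)ᵀ * (Matrix.single 2 3 1 - Matrix.single 3 2 1) =
      b • ((Matrix.single 2 3 1 - Matrix.single 3 2 1) *
        ((g⁻¹ : G4) : Matrix (Fin 4) (Fin 4) ℂ)) := by
    rw [← Matrix.smul_mul, ← hb, Matrix.mul_assoc _ (g : Matrix (Fin 4) (Fin 4) ℂ), ← Units.val_mul,
      mul_inv_cancel, Units.val_one, Matrix.mul_one]
  simp only [altSandwich, LinearMap.coe_mk, AddHom.coe_mk, adRep_apply, Matrix.transpose_mul]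
  calc _ = a • (altMat * ((g⁻¹ : G4) : Matrix (Fin 4) (Fin 4) ℂ)ᵀ) * (yᵀ *
        ((g : Matrix (Fin 4) (Fin 4) ℂ)ᵀ * (Matrix.single 2 3 1 - Matrix.single 3 2 1))) := by
        simp only [Matrix.mul_assoc, Matrix.smul_mul]
    _ = _ := by
        rw [h1, h2]
        simp only [Matrix.mul_assoc, Matrix.mul_smul]

/-- The coefficient of `y ↦ (E₀₁ - E₁₀) yᵀ (E₂₃ - E₃₂)` in the adjoint representation. -/
theorem isEndCoeff_ad : IsEndCoeff ![1, 0, 0, -1] ![1, 1, -1, -1] fun g =>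
    (g : Matrix (Fin 4) (Fin 4) ℂ) 2 0 * ((g⁻¹ : G4) : Matrix (Fin 4) (Fin 4) ℂ) 3 1 := by
  have htinv : ∀ t : Fin 4 → ℂˣ, (((torus t)⁻¹ : G4) : Matrix (Fin 4) (Fin 4) ℂ) =
      Matrix.diagonal fun k => (t k : ℂ)⁻¹ := fun t => by
    rw [← map_inv, coe_torus]
    simp
  refine ⟨_, _, _, adRep, Matrix.single 0 3 1,
    Matrix.entryLinearMap ℂ ℂ 0 3, altSandwich,
    isTame_adRep, ⟨fun u hu => ?_, fun t => ?_⟩, ⟨fun u hu x => ?_, fun t x => ?_⟩,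
    linHom_mem_hwSpace_iff.2 ⟨fun u hu y => ?_, fun t y => ?_⟩, fun g => ?_⟩
  · obtain ⟨h00, h11, h22, h33, h10, h20, h30, h21, h31, h32⟩ := hu.entries
    obtain ⟨k00, k11, k22, k33, k10, k20, k30, k21, k31, k32⟩ := hu.inv.entries
    ext a b
    rw [adRep_apply]
    fin_cases a <;> fin_cases b <;>
      simp [Matrix.mul_apply, Fin.sum_univ_four, *, -Matrix.coe_units_inv]
  · ext a b
    rw [adRep_apply, htinv]
    fin_cases a <;> fin_cases b <;>
      simp [Matrix.mul_apply, Matrix.diagonal_apply, wchar, Fin.prod_univ_four]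
  · obtain ⟨h00, h11, h22, h33, h10, h20, h30, h21, h31, h32⟩ := hu.entries
    obtain ⟨k00, k11, k22, k33, k10, k20, k30, k21, k31, k32⟩ := hu.inv.entries
    simp only [Matrix.entryLinearMap_apply, adRep_apply, ← star_inv]
    simp [Matrix.mul_apply, Fin.sum_univ_four, Matrix.star_apply, *, -Matrix.coe_units_inv]
  · simp only [Matrix.entryLinearMap_apply, adRep_apply, htinv]
    simp [Matrix.mul_apply, Matrix.diagonal_apply, wchar, Fin.prod_univ_four]
    ring
  · obtain ⟨h00, h11, h22, h33, h10, h20, h30, h21, h31, h32⟩ := hu.entries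
    have h := altSandwich_adRep u 1 1 ?_ ?_ y
    · simpa using h
    · ext a b
      fin_cases a <;> fin_cases b <;>
        simp [altMat, Matrix.mul_apply, Fin.sum_univ_four, *]
    · ext a b
      fin_cases a <;> fin_cases b <;>
        simp [Matrix.mul_apply, Fin.sum_univ_four, *]
  · have h := altSandwich_adRep (torus t) (t 0 * t 1) (t 2 * t 3) ?_ ?_ y
    · have h2 := (t 2).ne_zero
      have h3 := (t 3).ne_zero
      have : wchar ![1, 1, -1, -1] t = ((t 2 : ℂ) * t 3)⁻¹ * ((t 0 : ℂ) * t 1) := by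
        simp [wchar, Fin.prod_univ_four]
        ring
      rw [this, mul_smul, h, smul_smul, inv_mul_cancel₀ (mul_ne_zero h2 h3), one_smul]
    · ext a b
      rw [coe_torus, Matrix.diagonal_transpose, Matrix.mul_diagonal, Matrix.diagonal_mul]
      fin_cases a <;> fin_cases b <;> simp [altMat] <;> ring
    · ext a b
      rw [coe_torus, Matrix.diagonal_transpose, Matrix.mul_diagonal, Matrix.diagonal_mul]
      fin_cases a <;> fin_cases b <;> simp <;> ring
  · simp only [Matrix.entryLinearMap_apply, LinearMap.coe_mk, AddHom.coe_mk, altSandwich, adRep_apply]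
    simp [altMat, Matrix.mul_apply, Fin.sum_univ_four, Matrix.sub_apply, -Matrix.coe_units_inv]
    exact mul_comm _ _

/-! ### Lower unitriangular test matrices -/

/-- The lower unitriangular matrix with blocks `1`, `0`, `((x, y), (z, w))`, `1`. -/
def lowerBlock (x y z w : ℂ) : G4 where
  val := !![1, 0, 0, 0; 0, 1, 0, 0; x, y, 1, 0; z, w, 0, 1]
  inv := !![1, 0, 0, 0; 0, 1, 0, 0; -x, -y, 1, 0; -z, -w, 0, 1]
  val_inv := by
    ext a b
    fin_cases a <;> fin_cases b <;> simp [Matrix.mul_apply, Fin.sum_univ_four]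
  inv_val := by
    ext a b
    fin_cases a <;> fin_cases b <;> simp [Matrix.mul_apply, Fin.sum_univ_four]

theorem coe_lowerBlock (x y z w : ℂ) : (lowerBlock x y z w : Matrix (Fin 4) (Fin 4) ℂ) =
    !![1, 0, 0, 0; 0, 1, 0, 0; x, y, 1, 0; z, w, 0, 1] := rfl

theorem lowerBlock_inv (x y z w : ℂ) :
    (lowerBlock x y z w)⁻¹ = lowerBlock (-x) (-y) (-z) (-w) := by
  rw [inv_eq_iff_mul_eq_one]
  ext a b
  fin_cases a <;> fin_cases b <;> simp [coe_lowerBlock, Matrix.mul_apply, Fin.sum_univ_four]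

theorem exists_star_eq_lowerBlock (x y z w : ℂ) :
    ∃ u, IsUnitri u ∧ star u = lowerBlock x y z w := by
  refine ⟨star (lowerBlock x y z w), fun i j hij => ?_, star_star _⟩
  rw [Units.coe_star, coe_lowerBlock, Matrix.star_apply]
  fin_cases i <;> fin_cases j <;> first | simp at hij; done | simp

/-- For a dominant weight `κ` the irreducible representation of highest weight `κ` has a highest
weight endomorphism of weight `(k, 0, 0, -k)` as long as `k ≤ κ₀ - κ₃`: one reduces to the standard
representation, its dual, and the alternating matrices. -/
theorem exists_isEndCoeff_theta (k : ℕ) (κ : Fin 4 → ℤ) (hκ : Antitone κ) (hk : k ≤ κ 0 - κ 3) :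
    ∃ f, IsEndCoeff κ ![k, 0, 0, -k] f ∧ f (lowerBlock 0 0 1 0) ≠ 0 := by
  induction k generalizing κ with
  | zero =>
    obtain ⟨f, hf, hf1⟩ := exists_isEndCoeff_zero hκ
    obtain ⟨u, hu, hu'⟩ := exists_star_eq_lowerBlock 0 0 1 0
    refine ⟨f, ?_, by rw [← hu', hf1 u hu]; exact one_ne_zero⟩
    convert hf using 1
    ext i
    fin_cases i <;> simp
  | succ k ih =>
    have h01 : κ 1 ≤ κ 0 := hκ (by decide)
    have h12 : κ 2 ≤ κ 1 := hκ (by decide)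
    have h23 : κ 3 ≤ κ 2 := hκ (by decide)
    push_cast at hk
    have step : ∀ (ω : Fin 4 → ℤ) f₀, IsEndCoeff ω ![1, 0, 0, -1] f₀ →
        f₀ (lowerBlock 0 0 1 0) ≠ 0 → Antitone (κ - ω) → ω 0 - ω 3 = 1 →
        ∃ f, IsEndCoeff κ ![((k + 1 : ℕ) : ℤ), 0, 0, -((k + 1 : ℕ) : ℤ)] f ∧
          f (lowerBlock 0 0 1 0) ≠ 0 := by
      intro ω f₀ hf₀ hne hanti hω
      obtain ⟨f, hf, hfne⟩ := ih (κ - ω) hanti (by simp only [Pi.sub_apply]; omega)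
      refine ⟨f * f₀, ?_, mul_ne_zero hfne hne⟩
      convert hf.mul hf₀ using 1
      · rw [sub_add_cancel]
      · ext i
        fin_cases i <;> simp
        ring
    have hanti : ∀ ω : Fin 4 → ℤ, (κ - ω) 1 ≤ (κ - ω) 0 → (κ - ω) 2 ≤ (κ - ω) 1 →
        (κ - ω) 3 ≤ (κ - ω) 2 → Antitone (κ - ω) := fun ω h1 h2 h3 => by
      rw [Fin.antitone_iff_succ_le]
      intro i
      fin_cases i
      exacts [h1, h2, h3]
    -- subtract a fundamental weight at the first descent of `κ`, so that `κ` stays dominant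
    by_cases h1 : κ 1 < κ 0
    · refine step _ _ isEndCoeff_std ?_ (hanti _ ?_ ?_ ?_) ?_
      · simp [coe_lowerBlock]
      all_goals simp; try omega
    · by_cases h2 : κ 2 < κ 1
      · refine step _ _ isEndCoeff_alt ?_ (hanti _ ?_ ?_ ?_) ?_
        · simp [coe_lowerBlock]
        all_goals simp; try omega
      · refine step _ _ isEndCoeff_dual ?_ (hanti _ ?_ ?_ ?_) ?_
        · simp only [lowerBlock_inv]; simp [coe_lowerBlock]
        all_goals simp; try omega

/-! ### Upper bounds for multiplicities -/

/-- The alternating matrix `Eᵢⱼ - Eⱼᵢ`. -/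
def altBasis (i j : Fin 4) : Matrix (Fin 4) (Fin 4) ℂ := Matrix.single i j 1 - Matrix.single j i 1

/-- The Plücker coordinates of the plane spanned by the first two columns. -/
def pluecker (g : G4) (i j : Fin 4) : ℂ :=
  (g : Matrix (Fin 4) (Fin 4) ℂ) i 0 * (g : Matrix (Fin 4) (Fin 4) ℂ) j 1 -
    (g : Matrix (Fin 4) (Fin 4) ℂ) i 1 * (g : Matrix (Fin 4) (Fin 4) ℂ) j 0

theorem pluecker_relation (g : G4) : pluecker g 0 2 * pluecker g 1 3 =
    pluecker g 0 1 * pluecker g 2 3 + pluecker g 0 3 * pluecker g 1 2 := by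
  simp only [pluecker]; ring

theorem matRep_altMat_eq_sum (k : ℤ) (g : G4) : matRep k g altMat =
    (g : Matrix (Fin 4) (Fin 4) ℂ).det ^ k •
      (pluecker g 0 1 • altBasis 0 1 + pluecker g 0 2 • altBasis 0 2 +
        pluecker g 0 3 • altBasis 0 3 + pluecker g 1 2 • altBasis 1 2 +
        pluecker g 1 3 • altBasis 1 3 + pluecker g 2 3 • altBasis 2 3) := by
  ext a b
  rw [matRep_altMat, Matrix.smul_apply, smul_eq_mul]
  congr 1
  fin_cases a <;> fin_cases b <;> simp [altBasis, pluecker] <;> ring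

theorem matRep_torus_altBasis (k : ℤ) (t : Fin 4 → ℂˣ) (i j : Fin 4) :
    matRep k (torus t) (altBasis i j) =
      wchar ((Pi.single i 1 + Pi.single j 1) + fun _ => k) t • altBasis i j := by
  rw [altBasis, map_sub, matRep_torus_single, matRep_torus_single,
    add_comm (Pi.single j 1 : Fin 4 → ℤ), smul_sub]

theorem det_simpleRefl (i : Fin 3) : (simpleRefl i : Matrix (Fin 4) (Fin 4) ℂ).det = -1 := by
  have h : (simpleRefl i : Matrix (Fin 4) (Fin 4) ℂ) =
      (Equiv.swap i.castSucc i.succ).toPEquiv.toMatrix := by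
    ext a b
    rw [simpleRefl_apply, PEquiv.toMatrix_apply]
    simp [eq_comm]
  rw [h, Matrix.det_permutation, Equiv.Perm.sign_swap (Fin.castSucc_lt_succ).ne]
  simp

theorem matRep_simpleRefl_altBasis (k : ℤ) (i : Fin 3) (a b : Fin 4) :
    matRep k (simpleRefl i) (altBasis a b) = (-1 : ℂ) ^ k •
      altBasis (Equiv.swap i.castSucc i.succ a) (Equiv.swap i.castSucc i.succ b) := by
  have h : ∀ a b, matRep k (simpleRefl i) (Matrix.single a b 1) = (-1 : ℂ) ^ k •
      Matrix.single (Equiv.swap i.castSucc i.succ a) (Equiv.swap i.castSucc i.succ b) 1 := by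
    intro a b
    ext p q
    have hσ : ∀ x y, x = Equiv.swap i.castSucc i.succ y ↔ Equiv.swap i.castSucc i.succ x = y :=
      fun x y => by constructor <;> rintro rfl <;> simp
    rw [matRep_single_apply, det_simpleRefl, simpleRefl_apply, simpleRefl_apply, Matrix.smul_apply,
      Matrix.single_apply, smul_eq_mul]
    simp only [hσ]
    split_ifs <;> simp_all
  rw [altBasis, map_sub, h, h, ← smul_sub, altBasis]

section Endomorphisms

variable {M : Type} [AddCommGroup M] [Module ℂ M] {ρ : Representation ℂ G4 M} {κ : Fin 4 → ℤ}
  {v : M} {ζ : Module.Dual ℂ M}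

/-- An endomorphism all of whose conjugates have vanishing matrix coefficient at the highest weight
vector is zero: the function `k ↦ ζ (l φ l⁻¹ k v)` is determined by its values on lower
unitriangular matrices. -/
theorem IsLowestForm.endomorphism_eq_zero (h : IsTame ρ) (hv : IsHighest ρ κ v)
    (hζ : IsLowestForm ρ κ v ζ) {φ : M →ₗ[ℂ] M} (hφ : ∀ g, ζ (ρ g (φ (ρ g⁻¹ v))) = 0) : φ = 0 := by
  have key : ∀ l k, ζ (ρ l (φ (ρ l⁻¹ (ρ k v)))) = 0 := by
    intro l
    have := eq_of_eqOn_bigCell (f := fun k => (ζ ∘ₗ ρ l ∘ₗ φ ∘ₗ ρ l⁻¹) (ρ k v)) (f' := fun _ => 0)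
      (h.continuous_coeff _ _) continuous_const fun u u' t hu hu' => ?_
    · exact congr_fun this
    · simp only [LinearMap.comp_apply]
      have h1 := hφ ((star u)⁻¹ * l)
      rw [map_mul, Module.End.mul_apply, ← star_inv, hζ.mem.1 _ hu.inv, _root_.mul_inv_rev, star_inv,
        inv_inv] at h1
      rw [map_mul, map_mul, Module.End.mul_apply, Module.End.mul_apply, hv.mem.1 u' hu', hv.mem.2,
        map_smul, map_smul, map_smul, map_smul, map_smul, ← Module.End.mul_apply (ρ l⁻¹), ← map_mul,
        h1, smul_zero]
  refine LinearMap.ext_on_range hv.span_eq fun g => ?_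
  rw [LinearMap.zero_apply]
  refine hζ.eq_zero _ fun l => ?_
  have := key l (l * g)
  rwa [← Module.End.mul_apply (ρ l⁻¹), ← map_mul, inv_mul_cancel_left] at this

/-- A highest weight endomorphism of weight `(1, 1, -1, -1)` is the image of the tensor square of
`e₀ ∧ e₁`. Its matrix coefficient is therefore a quadratic form in the Plücker coordinates that is
invariant under the torus. This leaves the products of complementary coordinates, three of them with
one Plücker relation, hence two parameters. If `κ₁ = κ₂` or `κ₂ = κ₃`, invariance under the
corresponding simple reflection kills one of them. -/
theorem IsLowestForm.exists_params (h : IsTame ρ) (hv : IsHighest ρ κ v)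
    (hζ : IsLowestForm ρ κ v ζ) {φ : M →ₗ[ℂ] M} (hφ : φ ∈ hwSpace (ρ.linHom ρ) ![1, 1, -1, -1]) :
    ∃ a b : ℂ, (∀ g : G4, ζ (ρ g (φ (ρ g⁻¹ v))) = (g : Matrix (Fin 4) (Fin 4) ℂ).det⁻¹ *
        (pluecker g 0 1 * pluecker g 2 3 * a + pluecker g 0 3 * pluecker g 1 2 * b)) ∧
      (κ 1 = κ 2 → a = 0) ∧ (κ 2 = κ 3 → b = 0) := by
  have hn : altMat ⊗ₜ[ℂ] altMat ∈ hwSpace ((matRep 0).tprod (matRep (-1))) ![1, 1, -1, -1] := by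
    have := tmul_mem_hwSpace (altMat_mem_hwSpace 0) (altMat_mem_hwSpace (-1))
    have hw : ((![1, 1, 0, 0] : Fin 4 → ℤ) + fun _ => 0) + (![1, 1, 0, 0] + fun _ => -1) =
        ![1, 1, -1, -1] := by
      ext i
      fin_cases i <;> rfl
    rwa [hw] at this
  have hn0 : altMat ⊗ₜ[ℂ] altMat ≠ 0 := by
    intro h0
    have h1 := congrArg (LinearMap.mul' ℂ ℂ ∘ₗ TensorProduct.map (Matrix.entryLinearMap ℂ ℂ 0 1)
      (Matrix.entryLinearMap ℂ ℂ 0 1)) h0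
    simp [altMat] at h1
  obtain ⟨Φ, hΦ, hΦn⟩ := ((isTame_matRep 0).tprod (isTame_matRep (-1))).exists_commutes
    (h.linHom h) hn hn0 hφ
  let c : Module.Dual ℂ (Matrix (Fin 4) (Fin 4) ℂ ⊗[ℂ] Matrix (Fin 4) (Fin 4) ℂ) :=
    ζ ∘ₗ LinearMap.applyₗ v ∘ₗ Φ
  have hc : ∀ g w, c ((matRep 0).tprod (matRep (-1)) g w) = ζ (ρ g (Φ w (ρ g⁻¹ v))) := by
    intro g w
    change ζ (Φ _ v) = _
    rw [hΦ]; rfl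
  have hcT : ∀ t w, c ((matRep 0).tprod (matRep (-1)) (torus t) w) = c w := by
    intro t w
    rw [hc, hζ.mem.2, ← map_inv, hv.mem.2, map_smul, map_smul, smul_eq_mul, wchar_inv,
      mul_inv_cancel_left₀ (wchar_ne_zero _ _)]
    rfl
  have hcS : ∀ i : Fin 3, κ i.castSucc = κ i.succ → ∀ w,
      c ((matRep 0).tprod (matRep (-1)) (simpleRefl i) w) = c w := by
    intro i hi w
    have hinv : (simpleRefl i)⁻¹ = simpleRefl i := inv_eq_of_mul_eq_one_left (simpleRefl_mul_self i)
    rw [hc, hζ.simpleRefl_apply i hi, hinv, h.simpleRefl_apply_eq hv.mem i hi, map_smul, map_smul,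
      smul_eq_mul, ← mul_assoc, ← mul_zpow]
    simp [c]
  -- the coefficients of the quadratic form, which vanish off the weight `(1, 1, 1, 1)`
  let B : Fin 4 → Fin 4 → Fin 4 → Fin 4 → ℂ := fun i j k l => c (altBasis i j ⊗ₜ altBasis k l)
  have hB0 : ∀ i j k l, (Pi.single i 1 + Pi.single j 1 + (Pi.single k 1 + Pi.single l 1) :
      Fin 4 → ℤ) ≠ (fun _ => 1) → B i j k l = 0 := by
    intro i j k l hne
    by_contra hB
    apply hne
    have h1 : (Pi.single i 1 + Pi.single j 1 + fun _ => 0) +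
        (Pi.single k 1 + Pi.single l 1 + fun _ => -1) = (0 : Fin 4 → ℤ) := by
      refine wchar_injective fun t => ?_
      have h2 := hcT t (altBasis i j ⊗ₜ altBasis k l)
      rw [Representation.tprod_apply, TensorProduct.map_tmul, matRep_torus_altBasis,
        matRep_torus_altBasis, TensorProduct.smul_tmul_smul, map_smul, smul_eq_mul,
        ← wchar_add] at h2
      rw [wchar_zero]
      exact mul_right_cancel₀ hB (h2.trans (one_mul _).symm)
    ext x
    have h2 := congr_fun h1 x
    simp only [Pi.add_apply, Pi.zero_apply] at h2 ⊢
    omega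
  have hBS : ∀ i : Fin 3, κ i.castSucc = κ i.succ → ∀ p q r s,
      B (Equiv.swap i.castSucc i.succ p) (Equiv.swap i.castSucc i.succ q)
        (Equiv.swap i.castSucc i.succ r) (Equiv.swap i.castSucc i.succ s) = - B p q r s := by
    intro i hi p q r s
    have h2 := hcS i hi (altBasis p q ⊗ₜ altBasis r s)
    rw [Representation.tprod_apply, TensorProduct.map_tmul, matRep_simpleRefl_altBasis,
      matRep_simpleRefl_altBasis, TensorProduct.smul_tmul_smul, map_smul, smul_eq_mul] at h2
    simp only [B, ← h2]
    simp
  -- the Plücker relation eliminates the product of the coordinates `02` and `13`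
  refine ⟨B 0 1 2 3 + B 2 3 0 1 + (B 0 2 1 3 + B 1 3 0 2),
    B 0 2 1 3 + B 1 3 0 2 + (B 0 3 1 2 + B 1 2 0 3), fun g => ?_, fun hκ => ?_, fun hκ => ?_⟩
  · rw [← hΦn, ← hc, Representation.tprod_apply, TensorProduct.map_tmul, matRep_altMat_eq_sum,
      matRep_altMat_eq_sum]
    have hcB : ∀ i j k l, c (altBasis i j ⊗ₜ altBasis k l) = B i j k l := fun _ _ _ _ => rfl
    simp only [zpow_zero, one_smul, TensorProduct.tmul_smul, TensorProduct.add_tmul,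
      TensorProduct.tmul_add, TensorProduct.smul_tmul, map_add, map_smul, smul_eq_mul, hcB]
    -- 30 of the 36 coefficients have the wrong weight
    rw [hB0 0 1 0 1 (by decide), hB0 0 1 0 2 (by decide), hB0 0 1 0 3 (by decide),
      hB0 0 1 1 2 (by decide), hB0 0 1 1 3 (by decide), hB0 0 2 0 1 (by decide),
      hB0 0 2 0 2 (by decide), hB0 0 2 0 3 (by decide), hB0 0 2 1 2 (by decide),
      hB0 0 2 2 3 (by decide), hB0 0 3 0 1 (by decide), hB0 0 3 0 2 (by decide),
      hB0 0 3 0 3 (by decide), hB0 0 3 1 3 (by decide), hB0 0 3 2 3 (by decide),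
      hB0 1 2 0 1 (by decide), hB0 1 2 0 2 (by decide), hB0 1 2 1 2 (by decide),
      hB0 1 2 1 3 (by decide), hB0 1 2 2 3 (by decide), hB0 1 3 0 1 (by decide),
      hB0 1 3 0 3 (by decide), hB0 1 3 1 2 (by decide), hB0 1 3 1 3 (by decide),
      hB0 1 3 2 3 (by decide), hB0 2 3 0 2 (by decide), hB0 2 3 0 3 (by decide),
      hB0 2 3 1 2 (by decide), hB0 2 3 1 3 (by decide), hB0 2 3 2 3 (by decide), _root_.zpow_neg,
      zpow_one]
    linear_combination (g : Matrix (Fin 4) (Fin 4) ℂ).det⁻¹ * (B 0 2 1 3 + B 1 3 0 2) *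
      pluecker_relation g
  · have h1 : B 0 2 1 3 = - B 0 1 2 3 := hBS 1 hκ 0 1 2 3
    have h2 : B 1 3 0 2 = - B 2 3 0 1 := hBS 1 hκ 2 3 0 1
    rw [h1, h2]; ring
  · have h1 : B 0 3 1 2 = - B 0 2 1 3 := hBS 2 hκ 0 2 1 3
    have h2 : B 1 2 0 3 = - B 1 3 0 2 := hBS 2 hκ 1 3 0 2
    rw [h1, h2]; ring

end Endomorphisms

/-! ### Multiplicities in the endomorphisms of an irreducible representation -/

/-- The one-dimensional representation `det ^ k` on `ℂ`. -/
def detRep (k : ℤ) : Representation ℂ G4 ℂ where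
  toFun g := (g : Matrix (Fin 4) (Fin 4) ℂ).det ^ k • LinearMap.id
  map_one' := by simp; rfl
  map_mul' g g' := by
    ext
    simp [mul_zpow, mul_comm]

theorem isDetPow_detRep (k : ℤ) : IsDetPow (detRep k) k :=
  ⟨Module.finrank_self ℂ, fun _ _ => rfl⟩

section Multiplicities

variable {M : Type} [AddCommGroup M] [Module ℂ M] {ρ : Representation ℂ G4 M} {κ : Fin 4 → ℤ}
  {v : M}

/-- Schur's lemma. -/
theorem IsHighest.finrank_hwSpace_linHom_zero (h : IsTame ρ) (hv : IsHighest ρ κ v) :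
    Module.finrank ℂ (hwSpace (ρ.linHom ρ) 0) = 1 := by
  have hid : LinearMap.id ∈ hwSpace (ρ.linHom ρ) 0 :=
    linHom_mem_hwSpace_iff.2 ⟨fun _ _ _ => rfl, fun t x => by simp⟩
  refine finrank_eq_one (⟨LinearMap.id, hid⟩ : hwSpace (ρ.linHom ρ) 0) (fun h0 => hv.ne_zero ?_) ?_
  · exact LinearMap.congr_fun (congrArg Subtype.val h0) v
  · rintro ⟨φ, hφ⟩
    have hφ' := linHom_mem_hwSpace_iff.1 hφ
    have hφv : ∃ a : ℂ, φ v = a • v := by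
      by_cases h0 : φ v = 0
      · exact ⟨0, by rw [h0, zero_smul]⟩
      · refine (h.eq_smul_of_mem_hwSpace hv (ν := κ) ⟨fun u hu => ?_, fun t => ?_⟩ h0).2
        · rw [← hφ'.1 u hu, hv.mem.1 u hu]
        · rw [hφ'.2, hv.mem.2, wchar_zero, one_smul, map_smul]
    obtain ⟨a, ha⟩ := hφv
    -- `φ - a` is invariant under the group and kills `v`
    obtain ⟨f, hf, hf1⟩ := (isDetPow_detRep 0).isTame.exists_commutes (h.linHom h)
      (p := (1 : ℂ)) (μ := 0) (w := φ) ⟨fun _ _ => by simp [detRep], fun t => by simp [detRep]⟩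
      one_ne_zero hφ
    have hφG : Commutes ρ ρ φ := fun g x => by
      have h1 : f 1 = ρ.linHom ρ g (f 1) := by simpa [detRep] using hf g 1
      rw [hf1] at h1
      have h2 := LinearMap.congr_fun h1 (ρ g x)
      simpa using h2
    refine ⟨a, Subtype.ext ?_⟩
    exact (hv.eq_of_commutes hφG (f' := a • LinearMap.id) (fun g x => by simp) ha).symm

/-- The coefficients of a highest weight endomorphism of weight `(1, 1, -1, -1)` at two lower
unitriangular matrices determine it, and take all values not excluded by the simple reflections. The
hypothesis `h01` ensures that `κ` minus the highest weight of the adjoint representation is dominant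
when `κ₂ > κ₃`, where that representation provides the endomorphism. -/
theorem IsHighest.finrank_hwSpace_linHom_alt (h : IsTame ρ) (hv : IsHighest ρ κ v)
    (hκ : Antitone κ) (h01 : κ 3 < κ 2 → κ 1 < κ 0) :
    Module.finrank ℂ (hwSpace (ρ.linHom ρ) ![1, 1, -1, -1]) =
      (if κ 2 < κ 1 then 1 else 0) + (if κ 3 < κ 2 then 1 else 0) := by
  obtain ⟨ζ, hζ⟩ := h.exists_isLowestForm hv
  let H := hwSpace (ρ.linHom ρ) ![1, 1, -1, -1]
  let ev : G4 → H →ₗ[ℂ] ℂ := fun g => ζ ∘ₗ LinearMap.applyₗ (ρ g v) ∘ₗ H.subtype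
  -- In terms of the parameters of the quadratic form, `α` and `β` are `-a` and `-b`: the first two
  -- columns of `lowerBlock 0 1 1 0` have Plücker coordinates with `p₀₁ p₂₃ = -1` and `p₀₃ p₁₂ = 0`,
  -- those of `lowerBlock 1 0 0 1` have `p₀₁ p₂₃ = 1` and `p₀₃ p₁₂ = -1`.
  let α : H →ₗ[ℂ] ℂ := ev (lowerBlock 0 (-1) (-1) 0)
  let β : H →ₗ[ℂ] ℂ := ev (lowerBlock 0 (-1) (-1) 0) + ev (lowerBlock (-1) 0 0 (-1))
  have hev : ∀ x y z w (φ : H), ev (lowerBlock (-x) (-y) (-z) (-w)) φ =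
      ζ (ρ (lowerBlock x y z w) (φ.1 (ρ (lowerBlock x y z w)⁻¹ v))) := by
    intro x y z w φ
    obtain ⟨u, hu, hu'⟩ := exists_star_eq_lowerBlock x y z w
    rw [lowerBlock_inv, ← hu', hζ.mem.1 u hu]
    rfl
  have hdet : ∀ x y z w, (lowerBlock x y z w : Matrix (Fin 4) (Fin 4) ℂ).det = 1 := by
    intro x y z w
    obtain ⟨u, hu, hu'⟩ := exists_star_eq_lowerBlock x y z w
    rw [← hu', Units.coe_star, Matrix.star_eq_conjTranspose, Matrix.det_conjTranspose, hu.det,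
      star_one]
  have hα : ∀ φ : H, κ 1 = κ 2 → α φ = 0 := by
    intro φ hκ'
    obtain ⟨a, b, hab, ha, hb⟩ := hζ.exists_params h hv φ.2
    have h1 := hev 0 1 1 0 φ
    rw [hab, hdet] at h1
    simp [pluecker, coe_lowerBlock, ha hκ'] at h1
    simpa [α] using h1
  have hβ : ∀ φ : H, κ 2 = κ 3 → β φ = 0 := by
    intro φ hκ'
    obtain ⟨a, b, hab, ha, hb⟩ := hζ.exists_params h hv φ.2
    have h1 := hev 0 1 1 0 φ
    have h2 := hev 1 0 0 1 φ
    rw [hab, hdet] at h1 h2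
    simp [pluecker, coe_lowerBlock, hb hκ'] at h1 h2
    simp [β, h1, h2]
  have hinj : ∀ φ : H, α φ = 0 → β φ = 0 → φ = 0 := by
    intro φ h1 h2
    obtain ⟨a, b, hab, ha, hb⟩ := hζ.exists_params h hv φ.2
    have h3 := hev 0 1 1 0 φ
    have h4 := hev 1 0 0 1 φ
    rw [hab, hdet] at h3 h4
    simp [pluecker, coe_lowerBlock] at h3 h4
    simp [α] at h1
    simp [β, h1] at h2
    rw [h1] at h3
    rw [h2] at h4
    have ha0 : a = 0 := by linear_combination h3
    have hb0 : b = 0 := by linear_combination h4 + h3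
    refine Subtype.ext (hζ.endomorphism_eq_zero h hv fun g => ?_)
    rw [hab, ha0, hb0]
    ring
  have hex : ∀ ω f₀, IsEndCoeff ω ![1, 1, -1, -1] f₀ → Antitone (κ - ω) →
      ∃ φ : H, ∀ x y z w, ev (lowerBlock x y z w) φ = f₀ (lowerBlock x y z w) := by
    intro ω f₀ hf₀ hanti
    obtain ⟨f₁, hf₁, hf₁'⟩ := exists_isEndCoeff_zero hanti
    have h1 := hf₁.mul hf₀
    rw [sub_add_cancel, zero_add] at h1
    obtain ⟨φ, hφ, hφf⟩ := hζ.exists_of_isEndCoeff h hv h1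
    refine ⟨⟨φ, hφ⟩, fun x y z w => ?_⟩
    obtain ⟨u, hu, hu'⟩ := exists_star_eq_lowerBlock x y z w
    refine (hφf _).trans ?_
    rw [Pi.mul_apply, ← hu', hf₁' u hu, one_mul]
  have hanti : ∀ ω : Fin 4 → ℤ, (κ - ω) 1 ≤ (κ - ω) 0 → (κ - ω) 2 ≤ (κ - ω) 1 →
      (κ - ω) 3 ≤ (κ - ω) 2 → Antitone (κ - ω) := fun ω h1 h2 h3 => by
    rw [Fin.antitone_iff_succ_le]
    intro i
    fin_cases i
    exacts [h1, h2, h3]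
  have k01 : κ 1 ≤ κ 0 := hκ (by decide)
  have k12 : κ 2 ≤ κ 1 := hκ (by decide)
  have k23 : κ 3 ≤ κ 2 := hκ (by decide)
  have hexα : κ 2 < κ 1 → ∃ φ : H, α φ = -4 ∧ β φ = 0 := by
    intro hlt
    obtain ⟨φ, hφ⟩ := hex _ _ isEndCoeff_alt_alt (hanti _ (by simp; omega) (by simp; omega)
      (by simp; omega))
    refine ⟨φ, ?_, ?_⟩
    · simp only [α]; rw [hφ]; simp [coe_lowerBlock]
    · simp only [β, LinearMap.add_apply]; rw [hφ, hφ]; simp [coe_lowerBlock]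
  have hexβ : κ 3 < κ 2 → ∃ φ : H, α φ = 0 ∧ β φ = -1 := by
    intro hlt
    have := h01 hlt
    obtain ⟨φ, hφ⟩ := hex _ _ isEndCoeff_ad (hanti _ (by simp; omega) (by simp; omega)
      (by simp; omega))
    refine ⟨φ, ?_, ?_⟩
    · simp only [α]; rw [hφ, lowerBlock_inv]; simp [coe_lowerBlock]
    · simp only [β, LinearMap.add_apply]; rw [hφ, hφ, lowerBlock_inv, lowerBlock_inv]
      simp [coe_lowerBlock]
  by_cases h1 : κ 2 < κ 1
  · obtain ⟨φ, hφα, hφβ⟩ := hexα h1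
    by_cases h2 : κ 3 < κ 2
    · obtain ⟨ψ, hψα, hψβ⟩ := hexβ h2
      have e : H ≃ₗ[ℂ] ℂ × ℂ := LinearEquiv.ofBijective (α.prod β) ⟨?_, fun x => ?_⟩
      · rw [if_pos h1, if_pos h2]
        simpa using e.finrank_eq
      · rw [← LinearMap.ker_eq_bot, LinearMap.ker_eq_bot']
        intro x hx
        exact hinj x (Prod.mk.inj hx).1 (Prod.mk.inj hx).2
      · refine ⟨(-x.1 / 4) • φ + (-x.2) • ψ, ?_⟩
        ext <;> simp [hφα, hφβ, hψα, hψβ]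
    · have e : H ≃ₗ[ℂ] ℂ := LinearEquiv.ofBijective α ⟨?_, fun x => ⟨(-x / 4) • φ, ?_⟩⟩
      · rw [if_pos h1, if_neg h2]
        simpa using e.finrank_eq
      · rw [← LinearMap.ker_eq_bot, LinearMap.ker_eq_bot']
        exact fun x hx => hinj x hx (hβ x (by omega))
      · simp [hφα]
  · by_cases h2 : κ 3 < κ 2
    · obtain ⟨ψ, hψα, hψβ⟩ := hexβ h2
      have e : H ≃ₗ[ℂ] ℂ := LinearEquiv.ofBijective β ⟨?_, fun x => ⟨(-x) • ψ, ?_⟩⟩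
      · rw [if_neg h1, if_pos h2]
        simpa using e.finrank_eq
      · rw [← LinearMap.ker_eq_bot, LinearMap.ker_eq_bot']
        exact fun x hx => hinj x (hα x (by omega)) hx
      · simp [hψβ]
    · rw [if_neg h1, if_neg h2]
      have : Subsingleton H :=
        ⟨fun x y => by
          rw [hinj x (hα x (by omega)) (hβ x (by omega)),
            hinj y (hα y (by omega)) (hβ y (by omega))]⟩
      exact Module.finrank_zero_of_subsingleton

/-- The existence half for the weight `(2, 0, 0, -2)`. -/
theorem IsHighest.one_le_finrank_hwSpace_linHom_theta (h : IsTame ρ) (hv : IsHighest ρ κ v)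
    (hκ : Antitone κ) (h2 : 2 ≤ κ 0 - κ 3) :
    1 ≤ Module.finrank ℂ (hwSpace (ρ.linHom ρ) ![2, 0, 0, -2]) := by
  obtain ⟨ζ, hζ⟩ := h.exists_isLowestForm hv
  obtain ⟨f, hf, hfne⟩ := exists_isEndCoeff_theta 2 κ hκ (by exact_mod_cast h2)
  obtain ⟨φ, hφ, hφf⟩ := hζ.exists_of_isEndCoeff h hv hf
  have hfin := (h.linHom h).finite
  have : Nontrivial (hwSpace (ρ.linHom ρ) ![2, 0, 0, -2]) := by
    refine ⟨⟨φ, by exact_mod_cast hφ⟩, 0, fun h0 => hfne ?_⟩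
    have h1 : φ = 0 := congrArg Subtype.val h0
    rw [← hφf, h1, LinearMap.zero_apply, map_zero]
  exact Module.finrank_pos

/-- If only the weights `0` and `1` of the first coordinate occur in `M`, an endomorphism cannot
raise that weight by two. -/
theorem finrank_hwSpace_linHom_theta_eq_zero (t : Fin 4 → ℂˣ) (ht : (t 0 : ℂ) = 2)
    (ht3 : t 3 = 1)
    (hM : ∀ x, ρ (torus t) (ρ (torus t) x) - (3 : ℂ) • ρ (torus t) x + (2 : ℂ) • x = 0) :
    Module.finrank ℂ (hwSpace (ρ.linHom ρ) ![2, 0, 0, -2]) = 0 := by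
  have hall : ∀ φ ∈ hwSpace (ρ.linHom ρ) ![2, 0, 0, -2], φ = 0 := by
    intro φ hφ
    have h1 : ∀ x, ρ (torus t) (φ x) = (4 : ℂ) • φ (ρ (torus t) x) := by
      intro x
      rw [(linHom_mem_hwSpace_iff.1 hφ).2]
      congr 1
      simp [wchar, Fin.prod_univ_four, ht, ht3]
      norm_num
    ext x
    have h2 := hM (φ x)
    have h3 := congrArg φ (hM x)
    have h4 := hM (φ (ρ (torus t) x))
    have h5 := congrArg φ (hM (ρ (torus t) x))
    simp only [h1, map_smul, map_add, map_sub, map_zero] at h2 h3 h4 h5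
    -- `φ x`, `φ (t x)`, `φ (t² x)`, `φ (t³ x)` satisfy four independent linear relations
    rw [LinearMap.zero_apply]
    linear_combination (norm := module) (13 / 42 : ℂ) • h2 + (4 / 21 : ℂ) • h3 - (1 / 7 : ℂ) • h4 +
      (16 / 7 : ℂ) • h5
  have : Subsingleton (hwSpace (ρ.linHom ρ) ![2, 0, 0, -2]) :=
    ⟨fun x y => Subtype.ext ((hall _ x.2).trans (hall _ y.2).symm)⟩
  exact Module.finrank_zero_of_subsingleton

/-- The tensor product of `M` with the irreducible representation whose highest weight is that of
`M^∨ ⊗ det ^ d` is `End M ⊗ det ^ d`. -/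
theorem IsHighest.finrank_hwSpace_tprod_dual {N : Type} [AddCommGroup N] [Module ℂ N]
    {ρ' : Representation ℂ G4 N} (h : IsTame ρ) (hv : IsHighest ρ κ v) (h' : IsTame ρ') {w : N}
    {d : ℤ} (hw : IsHighest ρ' (fun k => d - κ k.rev) w) (μ : Fin 4 → ℤ) :
    Module.finrank ℂ (hwSpace (ρ.tprod ρ') (μ + fun _ => d)) =
      Module.finrank ℂ (hwSpace (ρ.tprod ρ.dual) μ) := by
  obtain ⟨ξ, hξ⟩ := h.dual_isHighest hv
  obtain ⟨w', hw'⟩ := hξ.tprod_isDetPow (isDetPow_detRep d)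
  have hwt : ((fun k : Fin 4 => -κ k.rev) + fun _ => d) = fun k => d - κ k.rev := by
    ext k
    simp only [Pi.add_apply]
    ring
  rw [hwt] at hw'
  obtain ⟨e, he, -⟩ := h'.exists_equiv (h.dual.tprod (isDetPow_detRep d).isTame) hw hw'
  rw [← (isDetPow_detRep d).finrank_hwSpace (ρ := ρ.tprod ρ.dual)]
  refine Commutes.finrank_hwSpace_eq ((TensorProduct.congr (LinearEquiv.refl ℂ M) e).trans
    (TensorProduct.assoc ℂ _ _ _).symm) (fun g x => ?_) _
  have he' : ∀ x, e (ρ' g x) = ρ.dual.tprod (detRep d) g (e x) := he g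
  induction x with
  | zero => simp
  | add x y hx hy => simp only [map_add, hx, hy]
  | tmul x y =>
    simp only [LinearEquiv.coe_coe, LinearEquiv.trans_apply, Representation.tprod_apply,
      TensorProduct.map_tmul, TensorProduct.congr_tmul, LinearEquiv.refl_apply, he']
    generalize e y = z
    induction z with
    | zero => simp
    | add x y hx hy => simp only [map_add, TensorProduct.tmul_add, hx, hy]
    | tmul x y => simp

end Multiplicities

namespace VectFunctor

/-- The multiplicity of an irreducible representation is the dimension of a space of highest weight
vectors. -/
theorem mult_schur_eq {ν : Fin 4 → ℤ} (hν : Antitone ν) (F : VectFunctor) (hF : IsTame F.rep) :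
    mult (schur ν) F = Module.finrank ℂ (hwSpace F.rep ν) := by
  obtain ⟨v, hv⟩ := exists_isHighest_schur hν
  rw [mult_eq, (isTame_schur ν).finrank_homSpace hF hv]

theorem isTame_tensor {F G : VectFunctor} (hF : IsTame F.rep) (hG : IsTame G.rep) :
    IsTame (F.tensor G).rep := by
  have h := hF.tprod hG
  exact h

theorem isTame_endo {F : VectFunctor} (hF : IsTame F.rep) : IsTame F.endo.rep := by
  refine isTame_tensor hF ?_
  rw [rep_dual]
  exact hF.dual

theorem mult_schur_endo {ν : Fin 4 → ℤ} (hν : Antitone ν) (F : VectFunctor) (hF : IsTame F.rep) :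
    mult (schur ν) F.endo = Module.finrank ℂ (hwSpace (F.rep.linHom F.rep) ν) := by
  rw [mult_schur_eq hν _ (isTame_endo hF), finrank_hwSpace_endo F hF]

/-- The first coordinate of a weight of `Σ_κ` is at most `κ₀`. If `κ₀ ≤ 1`, the torus element
`(2, 1, 1, 1)` has at most the eigenvalues `1` and `2`. -/
theorem schur_rep_torus {κ : Fin 4 → ℕ} (hκ : Antitone κ) (h1 : κ 0 ≤ 1) {ν : Fin 4 → ℤ}
    (hν : ν = fun i => (κ i : ℤ)) {t : Fin 4 → ℂˣ} (ht : t = ![Units.mk0 2 two_ne_zero, 1, 1, 1])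
    (x : (schur ν).obj (Fin 4 → ℂ)) :
    (schur ν).rep (torus t) ((schur ν).rep (torus t) x) - (3 : ℂ) • (schur ν).rep (torus t) x +
      (2 : ℂ) • x = 0 := by
  have hP : ∀ y : (schurPartition κ).obj (Fin 4 → ℂ), (schurPartition κ).rep (torus t)
      ((schurPartition κ).rep (torus t) y) - (3 : ℂ) • (schurPartition κ).rep (torus t) y +
        (2 : ℂ) • y = 0 := by
    intro y
    apply Subtype.ext
    change piRep (Boxes κ) (torus t) (piRep (Boxes κ) (torus t) y.1) -
      (3 : ℂ) • piRep (Boxes κ) (torus t) y.1 + (2 : ℂ) • y.1 = 0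
    refine (wordBasis (Boxes κ)).ext_elem fun I => ?_
    simp only [map_add, map_sub, map_smul, Finsupp.add_apply, Finsupp.sub_apply, Finsupp.smul_apply,
      piRep_torus_repr, smul_eq_mul, map_zero, Finsupp.zero_apply]
    by_cases hI : (wordBasis (Boxes κ)).repr y.1 I = 0
    · rw [hI]; ring
    have hle := weight_le_of_mem_range κ hκ y.2 hI 0
    have hI0 := sum_wordWt I 0
    have hr0 := sum_wordWt (rowWord κ) 0
    have hf : (Finset.univ.filter fun i : Fin 4 => i ≤ 0) = {0} := by decide
    rw [hf, Finset.sum_singleton] at hI0 hr0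
    rw [wordWt_rowWord] at hr0
    change (κ 0 : ℤ) = _ at hr0
    have hle' : wordWt I 0 ≤ κ 0 := by
      rw [hI0, hr0]
      exact_mod_cast hle
    have hwt : wchar (wordWt I) t = 2 ^ wordWt I 0 := by
      simp [wchar, ht, Fin.prod_univ_four]
    have h01 : wordWt I 0 = 0 ∨ wordWt I 0 = 1 := by omega
    rw [hwt]
    rcases h01 with h | h <;> rw [h] <;> norm_num <;> ring
  obtain ⟨v, hv⟩ := exists_isHighest_schurPartition κ hκ
  obtain ⟨w, hw⟩ := exists_isHighest_schur (ν := ν) fun i j hij => by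
    rw [hν]
    exact Int.ofNat_le.2 (hκ hij)
  rw [← hν] at hv
  obtain ⟨e, he, -⟩ := (isTame_schurPartition κ).exists_equiv (isTame_schur ν) hv hw
  obtain ⟨y, rfl⟩ := e.surjective x
  have he' : ∀ g x, (schur ν).rep g (e x) = e ((schurPartition κ).rep g x) :=
    fun g x => (he g x).symm
  have h2 := congrArg e (hP y)
  rw [map_add, map_sub, LinearEquiv.map_smul e, LinearEquiv.map_smul e, map_zero] at h2
  rw [he', he']
  exact h2

end VectFunctor

/-! ### From representations to vector bundles -/

namespace VectFunctor

/-- An isomorphism of representations gives an isomorphism of the associated bundles: in frames it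
is constant. -/
theorem bundleIso_of_equiv (σ : V10 [⋀^Fin 3]→ₗ[ℂ] ℂ) {F G : VectFunctor}
    (e : F.obj (Fin 4 → ℂ) ≃ₗ[ℂ] G.obj (Fin 4 → ℂ)) (he : Commutes F.rep G.rep e.toLinearMap) :
    BundleIso (zeroLocus σ) F G := by
  have hframe : ∀ W : zeroLocus σ,
      Nonempty ((V10 ⧸ (W : Submodule ℂ V10)) ≃ₗ[ℂ] (Fin 4 → ℂ)) := fun W => by
    refine ⟨LinearEquiv.ofFinrankEq _ _ ?_⟩
    have h1 := (W : Submodule ℂ V10).finrank_quotient_add_finrank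
    rw [W.2.1] at h1
    simp only [Module.finrank_fin_fun] at h1 ⊢
    omega
  let fr : ∀ W : zeroLocus σ, (V10 ⧸ (W : Submodule ℂ V10)) ≃ₗ[ℂ] (Fin 4 → ℂ) :=
    fun W => Classical.choice (hframe W)
  have he' : ∀ (k : (Fin 4 → ℂ) ≃ₗ[ℂ] (Fin 4 → ℂ)) x, e (F.map k x) = G.map k (e x) := by
    intro k x
    have := he (stdEquiv.symm k) x
    rwa [LinearEquiv.coe_coe, rep_apply, rep_apply, MulEquiv.apply_symm_apply] at this
  have hfr : ∀ (H : VectFunctor) (p : QFrame (zeroLocus σ)) x, H.map (fr p.pt) ((H.map p.iso).symm x) =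
      H.map (p.iso.symm.trans (fr p.pt)) x := by
    intro H p x
    rw [H.map_trans, LinearEquiv.trans_apply, map_symm]
  have hfr' : ∀ (H : VectFunctor) (p : QFrame (zeroLocus σ)) x, H.map p.iso ((H.map (fr p.pt)).symm x) =
      (H.map (p.iso.symm.trans (fr p.pt))).symm x := by
    intro H p x
    rw [LinearEquiv.eq_symm_apply, H.map_trans, LinearEquiv.trans_apply, map_symm,
      LinearEquiv.symm_apply_apply, LinearEquiv.apply_symm_apply]
  have hconst : ∀ c : ℂ, IsRegularFun fun _ : QFrame (zeroLocus σ) => c := fun c p =>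
    ⟨MvPolynomial.C c, 1, by simp, fun p' _ => by simp⟩
  refine ⟨fun W => ((F.map (fr W)).trans e).trans (G.map (fr W)).symm, fun v ξ => ?_, fun v ξ => ?_⟩
  · convert hconst (ξ (e v)) using 2 with p
    simp only [LinearEquiv.coe_coe, LinearEquiv.trans_apply]
    rw [hfr, hfr', he', LinearEquiv.symm_apply_apply]
  · convert hconst (ξ (e.symm v)) using 2 with p
    simp only [LinearEquiv.coe_coe, LinearEquiv.trans_symm, LinearEquiv.trans_apply,
      LinearEquiv.symm_symm]
    have hsymm : ∀ k y, e.symm (G.map k y) = F.map k (e.symm y) := fun k y => by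
      rw [LinearEquiv.symm_apply_eq, he', LinearEquiv.apply_symm_apply]
    rw [hfr, hfr', hsymm, LinearEquiv.symm_apply_apply]

theorem bundleIso_of_isHighest (σ : V10 [⋀^Fin 3]→ₗ[ℂ] ℂ) {F G : VectFunctor} (hF : IsTame F.rep)
    (hG : IsTame G.rep) {μ : Fin 4 → ℤ} (hv : ∃ v, IsHighest F.rep μ v)
    (hw : ∃ w, IsHighest G.rep μ w) : BundleIso (zeroLocus σ) F G := by
  obtain ⟨v, hv⟩ := hv
  obtain ⟨w, hw⟩ := hw
  obtain ⟨e, he, -⟩ := hF.exists_equiv hG hv hw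
  exact bundleIso_of_equiv σ e he

/-- Complete reducibility, with the Schur functors as the irreducible representations. -/
theorem exists_equiv_directSum (F : VectFunctor) (hF : IsTame F.rep)
    (n : {ν : Fin 4 → ℤ // Antitone ν} → ℕ)
    (hn : ∀ ν, n ν = Module.finrank ℂ (hwSpace F.rep ν.1)) :
    ∃ e : F.obj (Fin 4 → ℂ) ≃ₗ[ℂ] (directSum fun ν : {ν : Fin 4 → ℤ // Antitone ν} =>
      (schur ν.1).copies (n ν)).obj (Fin 4 → ℂ), Commutes F.rep (directSum fun ν :
        {ν : Fin 4 → ℤ // Antitone ν} => (schur ν.1).copies (n ν)).rep e.toLinearMap := by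
  classical
  obtain rfl : n = fun ν => Module.finrank ℂ (hwSpace F.rep ν.1) := funext hn
  choose w hw using fun ν : {ν : Fin 4 → ℤ // Antitone ν} => exists_isHighest_schur ν.2
  obtain ⟨e, he⟩ := hF.exists_decomposition (fun ν : {ν : Fin 4 → ℤ // Antitone ν} => ν.1)
    Subtype.val_injective (fun μ hμ => ⟨⟨μ, hμ⟩, rfl⟩) (fun ν => (schur ν.1).obj (Fin 4 → ℂ))
    (fun ν => (schur ν.1).rep) (fun ν => isTame_schur ν.1) w hw
  let D := directSum fun ν : {ν : Fin 4 → ℤ // Antitone ν} =>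
    (schur ν.1).copies (Module.finrank ℂ (hwSpace F.rep ν.1))
  have hD : ∀ g, (F.rep g) ∘ₗ e.toLinearMap = e.toLinearMap ∘ₗ D.rep g := by
    intro g
    refine DirectSum.linearMap_ext ℂ fun ν => LinearMap.ext fun x => ?_
    refine (he g ν x).symm.trans (congrArg e ?_)
    exact (DFinsupp.mapRange_single (f := fun ν : {ν : Fin 4 → ℤ // Antitone ν} =>
      ((schur ν.1).copies (Module.finrank ℂ (hwSpace F.rep ν.1))).map (stdEquiv g))
      (hf := fun i => map_zero _)).symm
  exact ⟨e.symm, fun g x => e.injective ((e.apply_symm_apply _).trans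
    ((congrArg (F.rep g) (e.apply_symm_apply x)).symm.trans
      (LinearMap.congr_fun (hD g) (e.symm x))))⟩

end VectFunctor

/-! ### The endomorphisms of `Σ_(m,t,s,0)` -/

theorem IsDetPow.exists_isHighest {M : Type} [AddCommGroup M] [Module ℂ M]
    {ρ : Representation ℂ G4 M} {k : ℤ} (h : IsDetPow ρ k) :
    ∃ v, IsHighest ρ (fun _ => k) v := by
  have : Nontrivial M := Module.nontrivial_of_finrank_pos (R := ℂ) (by rw [h.finrank_eq]; norm_num)
  obtain ⟨v, hv⟩ := exists_ne (0 : M)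
  refine ⟨v, ⟨fun u hu => ?_, fun t => ?_⟩, hv, ?_⟩
  · rw [h.apply_eq, hu.det, _root_.one_zpow, one_smul]
  · rw [h.apply_eq, det_torus_zpow]
  · refine eq_top_iff.2 (((finrank_eq_one_iff_of_nonzero v hv).1 h.finrank_eq).ge.trans ?_)
    refine Submodule.span_mono (Set.singleton_subset_iff.2 ⟨1, ?_⟩)
    simp

section SchurFunctors
open VectFunctor

theorem finrank_hwSpace_tensor_dual {F G : VectFunctor} (hF : IsTame F.rep) (hG : IsTame G.rep)
    {κ : Fin 4 → ℤ} {d : ℤ} {v : F.obj (Fin 4 → ℂ)} {w : G.obj (Fin 4 → ℂ)}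
    (hv : IsHighest F.rep κ v) (hw : IsHighest G.rep (fun k => d - κ k.rev) w) (μ : Fin 4 → ℤ) :
    Module.finrank ℂ (hwSpace (F.tensor G).rep (μ + fun _ => d)) =
      Module.finrank ℂ (hwSpace (F.rep.linHom F.rep) μ) := by
  have h1 := hv.finrank_hwSpace_tprod_dual hF hG hw μ
  rw [← rep_dual] at h1
  exact h1.trans (finrank_hwSpace_endo F hF μ)

theorem antitone_vec {a b c d : ℤ} (h1 : b ≤ a) (h2 : c ≤ b) (h3 : d ≤ c) :
    Antitone ![a, b, c, d] := by
  rw [Fin.antitone_iff_succ_le]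
  intro i
  fin_cases i
  exacts [h1, h2, h3]

theorem finrank_hwSpace_linHom_schur_alt (m t s : ℕ) (hst : s ≤ t) (hm : t + s ≤ m) :
    Module.finrank ℂ (hwSpace ((schur ![m, t, s, 0]).rep.linHom (schur ![m, t, s, 0]).rep)
      ![1, 1, -1, -1]) = (if t = 0 ∧ s = 0 then 0 else if t > s ∧ s > 0 then 2 else 1) := by
  have hanti : Antitone (![m, t, s, 0] : Fin 4 → ℤ) :=
    antitone_vec (by omega) (by omega) (by omega)
  obtain ⟨v, hv⟩ := exists_isHighest_schur hanti
  rw [hv.finrank_hwSpace_linHom_alt (isTame_schur _) hanti (by simp; omega)]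
  by_cases h1 : s < t <;> by_cases h2 : 0 < s <;> simp [h1, h2] <;> omega

theorem finrank_hwSpace_linHom_schur_theta_eq_zero (m t s : ℕ) (hst : s ≤ t) (hm : t + s ≤ m)
    (h1 : m ≤ 1) :
    Module.finrank ℂ (hwSpace ((schur ![m, t, s, 0]).rep.linHom (schur ![m, t, s, 0]).rep)
      ![2, 0, 0, -2]) = 0 := by
  have hκ : Antitone ![m, t, s, 0] := by
    rw [Fin.antitone_iff_succ_le]
    intro i
    fin_cases i
    exacts [(by omega : t ≤ m), hst, Nat.zero_le s]
  have heq : (![m, t, s, 0] : Fin 4 → ℤ) = fun i => ((![m, t, s, 0] : Fin 4 → ℕ) i : ℤ) := by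
    ext i
    fin_cases i <;> rfl
  exact finrank_hwSpace_linHom_theta_eq_zero ![Units.mk0 2 two_ne_zero, 1, 1, 1] (by simp) rfl
    (schur_rep_torus hκ h1 heq rfl)

theorem one_le_finrank_hwSpace_linHom_schur_theta (m t s : ℕ) (hst : s ≤ t) (hm : t + s ≤ m)
    (h1 : 1 < m) :
    1 ≤ Module.finrank ℂ (hwSpace ((schur ![m, t, s, 0]).rep.linHom (schur ![m, t, s, 0]).rep)
      ![2, 0, 0, -2]) := by
  have hanti : Antitone (![m, t, s, 0] : Fin 4 → ℤ) :=
    antitone_vec (by omega) (by omega) (by omega)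
  obtain ⟨v, hv⟩ := exists_isHighest_schur hanti
  exact hv.one_le_finrank_hwSpace_linHom_theta (isTame_schur _) hanti (by simp; omega)

theorem finrank_hwSpace_linHom_schur_zero (m t s : ℕ) (hst : s ≤ t) (hm : t + s ≤ m) :
    Module.finrank ℂ (hwSpace ((schur ![m, t, s, 0]).rep.linHom (schur ![m, t, s, 0]).rep)
      ![0, 0, 0, 0]) = 1 := by
  obtain ⟨v, hv⟩ := exists_isHighest_schur (ν := ![m, t, s, 0])
    (antitone_vec (by omega) (by omega) (by omega))
  have h0 : (![0, 0, 0, 0] : Fin 4 → ℤ) = 0 := by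
    ext i
    fin_cases i <;> rfl
  rw [h0]
  exact hv.finrank_hwSpace_linHom_zero (isTame_schur _)

/-- The second factor is isomorphic to `(Σ_(m,t,s,0))^∨ ⊗ det ^ m`. -/
theorem mult_tensor_schur (m t s : ℕ) (hst : s ≤ t) (hm : t + s ≤ m) {μ ν : Fin 4 → ℤ}
    (hμ : Antitone μ) (hν : ν = μ + fun _ => (m : ℤ)) :
    mult (schur ν) ((schur ![m, t, s, 0]).tensor (schur ![m, m - s, m - t, 0])) =
      Module.finrank ℂ (hwSpace ((schur ![m, t, s, 0]).rep.linHom (schur ![m, t, s, 0]).rep) μ) := by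
  obtain ⟨v, hv⟩ := exists_isHighest_schur (ν := ![m, t, s, 0])
    (antitone_vec (by omega) (by omega) (by omega))
  obtain ⟨w, hw⟩ := exists_isHighest_schur (ν := ![m, m - s, m - t, 0])
    (antitone_vec (by omega) (by omega) (by omega))
  have hwt : (![m, m - s, m - t, 0] : Fin 4 → ℤ) = fun k => m - ![(m : ℤ), t, s, 0] k.rev := by
    ext i
    fin_cases i
    · exact (sub_zero _).symm
    · rfl
    · rfl
    · exact (sub_self _).symm
  have hν' : Antitone ν := by
    rw [hν]
    exact fun i j hij => add_le_add_left (hμ hij) _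
  have hw' : IsHighest (schur ![m, m - s, m - t, 0]).rep
      (fun k => m - ![(m : ℤ), t, s, 0] k.rev) w := by
    rw [← hwt]
    exact hw
  rw [mult_schur_eq hν' _ (isTame_tensor (isTame_schur _) (isTame_schur _)), hν,
    finrank_hwSpace_tensor_dual (isTame_schur _) (isTame_schur _) hv hw']

theorem exists_isHighest_tensor_detInv {F : VectFunctor} {μ : Fin 4 → ℤ}
    (hF : ∃ v, IsHighest F.rep μ v) (d : ℕ) :
    ∃ v, IsHighest (F.tensor (detInv d)).rep (μ + fun _ => -(d : ℤ)) v := by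
  obtain ⟨v, hv⟩ := hF
  have h := hv.tprod_isDetPow (isDetPow_detInv d)
  exact h

theorem bundleIso_schur_twist (σ : V10 [⋀^Fin 3]→ₗ[ℂ] ℂ) {κ : Fin 4 → ℕ} (hκ : Antitone κ) (d : ℕ)
    {ν : Fin 4 → ℤ} (hν : ν = (fun i => (κ i : ℤ)) + fun _ => -(d : ℤ)) :
    BundleIso (zeroLocus σ) (schur ν) ((schurPartition κ).tensor (detInv d)) := by
  have hanti : Antitone ν := by
    rw [hν]
    exact fun i j hij => add_le_add_left (Int.ofNat_le.2 (hκ hij)) _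
  have h1 := exists_isHighest_tensor_detInv (exists_isHighest_schurPartition κ hκ) d
  rw [← hν] at h1
  exact bundleIso_of_isHighest σ (isTame_schur ν)
    (isTame_tensor (isTame_schurPartition κ) (isDetPow_detInv d).isTame)
    (exists_isHighest_schur hanti) h1

theorem bundleIso_schur_zero (σ : V10 [⋀^Fin 3]→ₗ[ℂ] ℂ) :
    BundleIso (zeroLocus σ) (schur ![0, 0, 0, 0]) trivial := by
  refine bundleIso_of_isHighest σ (isTame_schur _) isDetPow_trivial.isTame
    (exists_isHighest_schur (antitone_vec le_rfl le_rfl le_rfl)) ?_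
  have h0 : (![0, 0, 0, 0] : Fin 4 → ℤ) = 0 := by
    ext i
    fin_cases i <;> rfl
  rw [h0]
  exact isDetPow_trivial.exists_isHighest

end SchurFunctors

end

open VectFunctor in
theorem mainTheorem7 (m t s : ℕ) (hst : s ≤ t) (hm : t + s ≤ m) :
    -- multiplicities in `Σ_{(m,t,s,0)} ⊗ Σ_{(m,m-s,m-t,0)}`
    (mult (schur ![m, m, m, m])
        ((schur ![m, t, s, 0]).tensor (schur ![m, m - s, m - t, 0])) = 1 ∧
      mult (schur ![m + 1, m + 1, m - 1, m - 1])
        ((schur ![m, t, s, 0]).tensor (schur ![m, m - s, m - t, 0])) =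
          (if t = 0 ∧ s = 0 then 0 else if t > s ∧ s > 0 then 2 else 1) ∧
      (m ≤ 1 → mult (schur ![m + 2, m, m, m - 2])
        ((schur ![m, t, s, 0]).tensor (schur ![m, m - s, m - t, 0])) = 0) ∧
      (1 < m → 1 ≤ mult (schur ![m + 2, m, m, m - 2])
        ((schur ![m, t, s, 0]).tensor (schur ![m, m - s, m - t, 0])))) ∧
    -- the factors of `Σ_λ 𝒬 ⊗ Σ_λ 𝒬^∨` on a Debarre–Voisin fourfold, with their multiplicities
    (∀ σ : V10 [⋀^Fin 3]→ₗ[ℂ] ℂ, IsDebarreVoisin σ →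
      BundleIso (zeroLocus σ) (schur ![m, t, s, 0]).endo (directSum fun ν : {ν : Fin 4 → ℤ // Antitone ν} =>
        (schur ν.1).copies (mult (schur ν.1) (schur ![m, t, s, 0]).endo)) ∧
      (BundleIso (zeroLocus σ) (schur ![0, 0, 0, 0]) trivial ∧
        mult (schur ![0, 0, 0, 0]) (schur ![m, t, s, 0]).endo = 1) ∧
      (BundleIso (zeroLocus σ) (schur ![1, 1, -1, -1])
          ((schurPartition ![2, 2, 0, 0]).tensor (detInv 1)) ∧
        mult (schur ![1, 1, -1, -1]) (schur ![m, t, s, 0]).endo =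
          (if t = 0 ∧ s = 0 then 0 else if t > s ∧ s > 0 then 2 else 1)) ∧
      (BundleIso (zeroLocus σ) (schur ![2, 0, 0, -2])
          ((schurPartition ![4, 2, 2, 0]).tensor (detInv 2)) ∧
        (m ≤ 1 → mult (schur ![2, 0, 0, -2]) (schur ![m, t, s, 0]).endo = 0) ∧
        (1 < m → 1 ≤ mult (schur ![2, 0, 0, -2]) (schur ![m, t, s, 0]).endo))) := by
  have a0 : Antitone (![0, 0, 0, 0] : Fin 4 → ℤ) := antitone_vec le_rfl le_rfl le_rfl
  have a1 : Antitone (![1, 1, -1, -1] : Fin 4 → ℤ) :=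
    antitone_vec le_rfl (by norm_num) le_rfl
  have a2 : Antitone (![2, 0, 0, -2] : Fin 4 → ℤ) :=
    antitone_vec (by norm_num) le_rfl (by norm_num)
  have e0 : (![m, m, m, m] : Fin 4 → ℤ) = ![0, 0, 0, 0] + fun _ => (m : ℤ) := by
    ext i; fin_cases i <;> simp
  have e1 : (![m + 1, m + 1, m - 1, m - 1] : Fin 4 → ℤ) =
      ![1, 1, -1, -1] + fun _ => (m : ℤ) := by
    ext i; fin_cases i <;> simp <;> ring
  have e2 : (![m + 2, m, m, m - 2] : Fin 4 → ℤ) = ![2, 0, 0, -2] + fun _ => (m : ℤ) := by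
    ext i; fin_cases i <;> simp <;> ring
  have hM := isTame_schur ![m, t, s, 0]
  refine ⟨⟨?_, ?_, fun h => ?_, fun h => ?_⟩, fun σ _ => ⟨?_, ⟨?_, ?_⟩, ⟨?_, ?_⟩, ⟨?_, fun h => ?_,
    fun h => ?_⟩⟩⟩
  · rw [mult_tensor_schur m t s hst hm a0 e0, finrank_hwSpace_linHom_schur_zero m t s hst hm]
  · rw [mult_tensor_schur m t s hst hm a1 e1, finrank_hwSpace_linHom_schur_alt m t s hst hm]
  · rw [mult_tensor_schur m t s hst hm a2 e2,
      finrank_hwSpace_linHom_schur_theta_eq_zero m t s hst hm h]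
  · rw [mult_tensor_schur m t s hst hm a2 e2]
    exact one_le_finrank_hwSpace_linHom_schur_theta m t s hst hm h
  · obtain ⟨e, he⟩ := exists_equiv_directSum (schur ![m, t, s, 0]).endo (isTame_endo hM)
      (fun ν => mult (schur ν.1) (schur ![m, t, s, 0]).endo)
      fun ν => mult_schur_eq ν.2 _ (isTame_endo hM)
    exact bundleIso_of_equiv σ e he
  · exact bundleIso_schur_zero σ
  · rw [mult_schur_endo a0 _ hM, finrank_hwSpace_linHom_schur_zero m t s hst hm]
  · refine bundleIso_schur_twist σ (by decide) 1 ?_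
    ext i; fin_cases i <;> rfl
  · rw [mult_schur_endo a1 _ hM, finrank_hwSpace_linHom_schur_alt m t s hst hm]
  · refine bundleIso_schur_twist σ (by decide) 2 ?_
    ext i; fin_cases i <;> rfl
  · rw [mult_schur_endo a2 _ hM, finrank_hwSpace_linHom_schur_theta_eq_zero m t s hst hm h]
  · rw [mult_schur_endo a2 _ hM]
    exact one_le_finrank_hwSpace_linHom_schur_theta m t s hst hm h
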